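/- Consider a single bosonic mode on $\mathcal H=L^2(\mathbb R)$ with $a=(\hat x+i\hat p)/\sqrt2$, displacement operators $D(\xi)=e^{\xi a^\dagger-\xi^*a}$, i.e. $(D(\xi)\psi)(x)=e^{i(\sqrt2\,\mathrm{Im}\xi\,x-\mathrm{Re}\xi\,\mathrm{Im}\xi)}\psi(x-\sqrt2\,\mathrm{Re}\,\xi)$, coherent states $|\alpha\rangle=D(\alpha)|0\rangle$, characteristic function $\Phi_\rho(\xi)=\mathrm{Tr}[\rho D(\xi)]$ and trace distance $D(\rho_1,\rho_2)=\frac12\mathrm{Tr}|\rho_1-\rho_2|$. A *physical filter* is a function $\Omega:\mathbb C\to\mathbb C$ of the form $\Omega(\xi)=\int_{\mathbb C}\tilde\Omega(\alpha)e^{\xi\alpha^*-\alpha\xi^*}d^2\alpha$ with $\tilde\Omega$ a probability density on $\mathbb C$. Its filtering map is $\mathcal E_\Omega(\rho)=\int\tilde\Omega(\alpha)D(\alpha)\rho D(\alpha)^\dagger d^2\alpha$; write $\rho_\Omega=\mathcal E_\Omega(\rho)$. The entanglement fidelity is $F_e(\rho,\mathcal E_\Omega)=\langle\mu|(\mathcal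 E_\Omega\otimes\mathcal I)(|\mu\rangle\langle\mu|)|\mu\rangle$ for a purification $\mu$ of $\rho$. (1) Let $\Omega$ be a physical filter. Then $\mathcal E_\Omega$ is a CPTP map on the trace-class operators. For every density operator $\rho$: $\rho_\Omega$ is a density operator with $\Phi_{\rho_\Omega}=\Phi_\rho\,\Omega$; $F_e(\rho,\mathcal E_\Omega)$ does not depend on the purification, equals $\int\tilde\Omega(\alpha)|\Phi_\rho(\alpha)|^2d^2\alpha$ and is at most $1$; and $$D(\rho,\rho_\Omega)\le\sqrt{1-F_e(\rho,\mathcal E_\Omega)}.$$ Moreover, for every CPTP map $\mathcal E$ from the mode to any system, $D(\mathcal E(\rho),\mathcal E(\rho_\Omega))\le D(\rho,\rho_\Omega)$, and for every POVM $\{\Pi_n\}$, with $p(n|\rho)=\mathrm{Tr}[\rho\Pi_n]$, $\frac12\sum_n|p(n|\rho)-p(n|\rho_\Omega)|\le D(\rho,\rho_\Omega)$ (the sum converging). (2) If $(\Omega_L)_{L>0}$ are physical filters with $\Omega_L(\xi)\to1$ as $L\to\infty$ for every $\xi$, then $\sqrt{1-F_e(\rho,\mathcal E_{\Omega_L})}\to0$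 as $L\to\infty$ for every density operator $\rho$. (3) Let $2<q<\infty$ and, for $L>0$, $\Omega_L(\xi)=\int\omega_L(\zeta)\omega_L(\xi-\zeta)d^2\zeta$ with $\omega_L(\xi)=\frac1L2^{1/q}\sqrt{\frac{q}{2\pi\Gamma(2/q)}}\,e^{-|\xi|^q/L^q}$ (the nonclassicality filters). Every $\Omega_L$ is a physical filter with $\tilde\Omega_L(\alpha)=\pi^{-2}\int\Omega_L(\xi)e^{\alpha\xi^*-\xi\alpha^*}d^2\xi$, and $\Omega_L\to1$ pointwise as $L\to\infty$. For every density operator $\rho$ and every $L>0$, the state $\rho_{\Omega_L}$ has a regular Glauber–Sudarshan function: the integral $P(\alpha)=\pi^{-2}\int\Phi_{\rho_{\Omega_L}}(\xi)e^{|\xi|^2/2}e^{\alpha\xi^*-\xi\alpha^*}d^2\xi$ converges absolutely, $P$ is real, $C^\infty$ and integrable over $\mathbb C$, and $\rho_{\Omega_L}=\int P(\alpha)|\alpha\rangle\langle\alpha|\,d^2\alpha$ as an ordinary absolutely convergent integral. For every $\delta>0$ there is $L_0>0$ (depending only on $q,\rho,\delta$) such that for all $L\ge L_0$: $\sqrt{1-F_e(\rho,\mathcal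 E_{\Omega_L})}\le\delta$, $D(\rho,\rho_{\Omega_L})\le\delta$, $D(\mathcal E(\rho),\mathcal E(\rho_{\Omega_L}))\le\delta$ for every CPTP map $\mathcal E$ from the mode to any system, and $\frac12\sum_n|p(n|\rho)-p(n|\rho_{\Omega_L})|\le\delta$ for every POVM $\{\Pi_n\}$. -/

import Mathlib

open scoped TensorProduct InnerProductSpace ContDiff
open MeasureTheory Filter Topology

noncomputable section

namespace PhaseSpace

/-! ### Trace, trace class, states, trace distance -/

section Operators

variable (H : Type*) [NormedAddCommGroup H] [InnerProductSpace ℂ H] [CompleteSpace H]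

/-- The index set of a fixed Hilbert basis of `H`. -/
def basisIndex : Set H := (exists_hilbertBasis ℂ H).choose

/-- A fixed Hilbert basis of `H`. -/
def stdBasis : HilbertBasis (basisIndex H) ℂ H := (exists_hilbertBasis ℂ H).choose_spec.choose

variable {H}

/-- `Tr T = ∑ᵢ ⟨eᵢ, T eᵢ⟩`; used for trace-class `T` only. -/
def opTrace (T : H →L[ℂ] H) : ℂ := ∑' i, ⟪stdBasis H i, T (stdBasis H i)⟫_ℂ

/-- `T` is of trace class: `Tr |T| < ∞`, where `|T| = √(T† T)`. -/
def IsTraceClass (T : H →L[ℂ] H) : Prop :=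
  Summable fun i => ⟪stdBasis H i, CFC.abs T (stdBasis H i)⟫_ℂ

/-- Density operators: positive trace-class operators of trace one. -/
structure IsDensityOperator (ρ : H →L[ℂ] H) : Prop where
  isPositive : ρ.IsPositive
  isTraceClass : IsTraceClass ρ
  trace_eq_one : opTrace ρ = 1

/-- The trace distance `D(ρ₁, ρ₂) = ½ Tr |ρ₁ - ρ₂|`. -/
def traceDist (ρ₁ ρ₂ : H →L[ℂ] H) : ℝ := (1 / 2) * (opTrace (CFC.abs (ρ₁ - ρ₂))).re

/-- A finite matrix of operators `X j k` on `H` is positive as an operator on `H ⊗ ℂⁿ`. -/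
def IsPositiveBlock {H : Type*} [NormedAddCommGroup H] [InnerProductSpace ℂ H] {n : ℕ}
    (X : Fin n → Fin n → H →L[ℂ] H) : Prop :=
  ∀ v : Fin n → H, (∑ j, ∑ k, ⟪v j, X j k (v k)⟫_ℂ).im = 0 ∧
    0 ≤ (∑ j, ∑ k, ⟪v j, X j k (v k)⟫_ℂ).re

/-- Quantum channels (CPTP maps): linear, completely positive and trace-preserving maps from the
trace-class operators on `H` to the trace-class operators on `K`. The values of `𝓔` outside the
trace class are irrelevant. -/
structure IsChannel {K : Type*} [NormedAddCommGroup K] [InnerProductSpace ℂ K] [CompleteSpace K]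
    (𝓔 : (H →L[ℂ] H) → (K →L[ℂ] K)) : Prop where
  map_traceClass : ∀ T, IsTraceClass T → IsTraceClass (𝓔 T)
  map_add : ∀ S T, IsTraceClass S → IsTraceClass T → 𝓔 (S + T) = 𝓔 S + 𝓔 T
  map_smul : ∀ (c : ℂ) (T), IsTraceClass T → 𝓔 (c • T) = c • 𝓔 T
  completelyPositive : ∀ (n : ℕ) (X : Fin n → Fin n → H →L[ℂ] H),
    (∀ j k, IsTraceClass (X j k)) → IsPositiveBlock X → IsPositiveBlock fun j k => 𝓔 (X j k)
  trace_map : ∀ T, IsTraceClass T → opTrace (𝓔 T) = opTrace T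

/-- Positive operator-valued measures `{Mₙ}`: `Mₙ ≥ 0` and `∑ₙ Mₙ = I` (strongly). -/
structure IsPOVM {ι : Type*} (M : ι → H →L[ℂ] H) : Prop where
  isPositive : ∀ n, (M n).IsPositive
  hasSum : ∀ x : H, HasSum (fun n => M n x) x

/-- The Born rule `p(n|ρ) = Tr[ρ Mₙ]`. -/
def bornProb (ρ Mn : H →L[ℂ] H) : ℝ := (opTrace (ρ ∘L Mn)).re

end Operators

/-! ### A single bosonic mode, in the Schrödinger representation -/

/-- The Hilbert space `L²(ℝ)` of a single mode. -/
abbrev Mode : Type := Lp ℂ 2 (volume : Measure ℝ)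

theorem memLp_phase_mul (θ : C(ℝ, ℝ)) (ψ : Mode) :
    MemLp (fun x => Complex.exp (Complex.I * θ x) * ψ x) 2 volume := by
  have h : AEStronglyMeasurable (fun x : ℝ => Complex.exp (Complex.I * θ x) * ψ x) volume :=
    (by fun_prop : Continuous fun x : ℝ => Complex.exp (Complex.I * θ x)).aestronglyMeasurable.mul
      (Lp.memLp ψ).1
  refine (Lp.memLp ψ).of_le h (Eventually.of_forall fun x => ?_)
  rw [norm_mul, mul_comm Complex.I, Complex.norm_exp_ofReal_mul_I, one_mul]

/-- Multiplication by the phase `exp(i θ(x))` on `L²(ℝ)`. -/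
def phaseMul (θ : C(ℝ, ℝ)) : Mode →ₗᵢ[ℂ] Mode where
  toFun ψ := (memLp_phase_mul θ ψ).toLp _
  map_add' φ ψ := by
    rw [← MemLp.toLp_add, MemLp.toLp_eq_toLp_iff]
    filter_upwards [Lp.coeFn_add φ ψ] with x hx
    simp only [hx, Pi.add_apply, mul_add]
  map_smul' c ψ := by
    rw [RingHom.id_apply, ← MemLp.toLp_const_smul, MemLp.toLp_eq_toLp_iff]
    filter_upwards [Lp.coeFn_smul c ψ] with x hx
    simp [hx, mul_left_comm]
  norm_map' ψ := by
    rw [LinearMap.coe_mk, AddHom.coe_mk, Lp.norm_toLp, Lp.norm_def]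
    congr 1
    refine eLpNorm_congr_norm_ae (Eventually.of_forall fun x => ?_)
    rw [norm_mul, mul_comm Complex.I, Complex.norm_exp_ofReal_mul_I, one_mul]

/-- The phase `√2 Im ξ · x - Re ξ · Im ξ`. -/
def displacementPhase (ξ : ℂ) : C(ℝ, ℝ) where
  toFun x := √2 * ξ.im * x - ξ.re * ξ.im

/-- The displacement operator `D(ξ) = exp(ξ a† - ξ* a)` with `a = (x + i p) / √2`, `p = -i d/dx`.
With `u = √2 Re ξ`, `v = √2 Im ξ` one has `ξ a† - ξ* a = i (v x - u p)`, so that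
`(D(ξ) ψ)(x) = exp(i (v x - u v / 2)) ψ(x - u)`. -/
def displacementIso (ξ : ℂ) : Mode →ₗᵢ[ℂ] Mode :=
  (phaseMul (displacementPhase ξ)).comp
    (Lp.compMeasurePreservingₗᵢ ℂ (fun x : ℝ => x - √2 * ξ.re)
      (measurePreserving_sub_right volume (√2 * ξ.re)))

/-- The displacement operator as a bounded operator. -/
def displacement (ξ : ℂ) : Mode →L[ℂ] Mode := (displacementIso ξ).toContinuousLinearMap

theorem displacement_ae (ξ : ℂ) (ψ : Mode) :
    displacement ξ ψ =ᵐ[volume] fun x : ℝ =>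
      Complex.exp (Complex.I * ((√2 * ξ.im * x - ξ.re * ξ.im : ℝ) : ℂ)) *
        ψ (x - √2 * ξ.re) := by
  have h1 := Lp.coeFn_compMeasurePreserving ψ
    (measurePreserving_sub_right (volume : Measure ℝ) (√2 * ξ.re))
  have h2 := (memLp_phase_mul (displacementPhase ξ) (Lp.compMeasurePreservingₗᵢ ℂ
    (fun x : ℝ => x - √2 * ξ.re) (measurePreserving_sub_right volume (√2 * ξ.re)) ψ)).coeFn_toLp
  filter_upwards [h1, h2] with x hx1 hx2
  refine hx2.trans ?_
  have h3 : (Lp.compMeasurePreservingₗᵢ ℂ (fun x : ℝ => x - √2 * ξ.re)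
    (measurePreserving_sub_right volume (√2 * ξ.re)) ψ) x = ψ (x - √2 * ξ.re) := hx1
  simp only [h3]
  rfl

theorem memLp_vacuum :
    MemLp (fun x : ℝ => ((Real.pi ^ (-(1 / 4 : ℝ)) * Real.exp (-x ^ 2 / 2) : ℝ) : ℂ)) 2
      volume := by
  rw [memLp_two_iff_integrable_sq_norm (by fun_prop)]
  have h : Integrable fun x : ℝ => (Real.pi ^ (-(1 / 4 : ℝ))) ^ 2 * Real.exp (-1 * x ^ 2) :=
    (integrable_exp_neg_mul_sq one_pos).const_mul _
  refine h.congr (Eventually.of_forall fun x => ?_)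
  simp only [Complex.norm_real, Real.norm_eq_abs, sq_abs, mul_pow, ← Real.exp_nat_mul]
  congr 2
  push_cast
  ring

/-- The vacuum `|0⟩`, that is `π^(-1/4) exp(-x²/2)`. -/
def vacuum : Mode := memLp_vacuum.toLp _

/-- The coherent state `|α⟩ = D(α)|0⟩`. -/
def coherentState (α : ℂ) : Mode := displacement α vacuum

/-- The projection `|α⟩⟨α|`. -/
def coherentProj (α : ℂ) : Mode →L[ℂ] Mode :=
  InnerProductSpace.rankOne ℂ (coherentState α) (coherentState α)

/-- The characteristic function `Φ(ξ) = Tr[ρ D(ξ)]`. -/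
def charFn (ρ : Mode →L[ℂ] Mode) (ξ : ℂ) : ℂ := opTrace (ρ ∘L displacement ξ)

/-- The Fourier kernel `exp(α ξ* - ξ α*)`. -/
def fourierKernel (α ξ : ℂ) : ℂ :=
  Complex.exp (α * (starRingEnd ℂ) ξ - ξ * (starRingEnd ℂ) α)

/-- `P : ℂ → ℝ` is the Glauber–Sudarshan function of `σ`, and it is regular: the defining integral
`P(α) = π⁻² ∫ Φ(ξ) exp(|ξ|²/2) exp(α ξ* - ξ α*) d²ξ` converges absolutely, `P` is smooth and
integrable, and `σ = ∫ P(α) |α⟩⟨α| d²α` as an ordinary integral. -/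
structure IsRegularPFunction (σ : Mode →L[ℂ] Mode) (P : ℂ → ℝ) : Prop where
  integrable_charFn : Integrable fun ξ : ℂ => charFn σ ξ * Real.exp (‖ξ‖ ^ 2 / 2)
  eq_fourier : ∀ α, (P α : ℂ) = (1 / (Real.pi : ℂ) ^ 2) *
    ∫ ξ : ℂ, charFn σ ξ * Real.exp (‖ξ‖ ^ 2 / 2) * fourierKernel α ξ
  smooth : ContDiff ℝ ∞ P
  integrable : Integrable P
  integrable_repr : Integrable fun α => P α • coherentProj α
  repr : σ = ∫ α, P α • coherentProj α

/-! ### Filters -/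

/-- `Ω` is a physical filter function with Fourier transform `p`: `p` is a probability density on
the phase space `ℂ` and `Ω(ξ) = ∫ p(α) exp(ξ α* - α ξ*) d²α`. -/
structure IsPhysicalFilter (Ω : ℂ → ℂ) (p : ℂ → ℝ) : Prop where
  nonneg : ∀ α, 0 ≤ p α
  integrable : Integrable p
  integral_eq_one : ∫ α, p α = 1
  eq_fourier : ∀ ξ, Ω ξ = ∫ α, p α * fourierKernel ξ α

/-- The filtering map `𝓔_Ω(ρ) = ∫ p(α) D(α) ρ D(α)† d²α`, `p` the Fourier transform of `Ω`. -/
def filterMap (p : ℂ → ℝ) (ρ : Mode →L[ℂ] Mode) : Mode →L[ℂ] Mode :=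
  ∫ α, p α • (displacement α ∘L ρ ∘L ContinuousLinearMap.adjoint (displacement α))

/-- The Hilbert-space tensor product. -/
abbrev HilbertTensor (H E : Type*) [NormedAddCommGroup H] [InnerProductSpace ℂ H]
    [NormedAddCommGroup E] [InnerProductSpace ℂ E] : Type _ :=
  UniformSpace.Completion (H ⊗[ℂ] E)

section Environment

variable {E : Type*} [NormedAddCommGroup E] [InnerProductSpace ℂ E]

/-- The product vector `h ⊗ e`. -/
def prodVec {H : Type*} [NormedAddCommGroup H] [InnerProductSpace ℂ H] (h : H) (e : E) :
    HilbertTensor H E :=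
  ((h ⊗ₜ[ℂ] e : H ⊗[ℂ] E) : UniformSpace.Completion (H ⊗[ℂ] E))

variable (E) in
/-- `D(α) ⊗ I` on the tensor product of the mode with an environment `E`. -/
def displacementTensor (α : ℂ) : HilbertTensor Mode E →L[ℂ] HilbertTensor Mode E :=
  ((displacementIso α).rTensor E).toContinuousLinearMap.completion

theorem displacementTensor_prodVec (α : ℂ) (h : Mode) (e : E) :
    displacementTensor E α (prodVec h e) = prodVec (displacement α h) e := by
  simp [displacementTensor, prodVec, displacement]

/-- `(𝓔_Ω ⊗ I)(σ) = ∫ p(α) (D(α) ⊗ I) σ (D(α) ⊗ I)† d²α`. -/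
def filterMapTensor (p : ℂ → ℝ) (σ : HilbertTensor Mode E →L[ℂ] HilbertTensor Mode E) :
    HilbertTensor Mode E →L[ℂ] HilbertTensor Mode E :=
  ∫ α, p α • (displacementTensor E α ∘L σ ∘L
    ContinuousLinearMap.adjoint (displacementTensor E α))

/-- The vector `μ` purifies `ρ`: the partial trace of `|μ⟩⟨μ|` over the environment is `ρ`, that is
`⟨x, ρ y⟩ = ∑ⱼ ⟨x ⊗ eⱼ, μ⟩ ⟨μ, y ⊗ eⱼ⟩`. -/
def IsPurification [CompleteSpace E] (ρ : Mode →L[ℂ] Mode) (μ : HilbertTensor Mode E) : Prop :=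
  ∀ x y : Mode, HasSum
    (fun j => ⟪prodVec x (stdBasis E j), μ⟫_ℂ * ⟪μ, prodVec y (stdBasis E j)⟫_ℂ) ⟪x, ρ y⟫_ℂ

/-- `⟨μ| (𝓔_Ω ⊗ I)(|μ⟩⟨μ|) |μ⟩`. -/
def purificationOverlap (p : ℂ → ℝ) (μ : HilbertTensor Mode E) : ℝ :=
  (⟪μ, filterMapTensor p (InnerProductSpace.rankOne ℂ μ μ) μ⟫_ℂ).re

end Environment

/-- The canonical purification `∑ⱼ √ρ eⱼ ⊗ eⱼ` of a density operator `ρ`. -/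
def purification {H : Type*} [NormedAddCommGroup H] [InnerProductSpace ℂ H] [CompleteSpace H]
    (ρ : H →L[ℂ] H) : HilbertTensor H H :=
  ∑' j, prodVec (CFC.sqrt ρ (stdBasis H j)) (stdBasis H j)

/-- The entanglement fidelity `F_e(ρ, 𝓔_Ω)`. -/
def entanglementFidelity (p : ℂ → ℝ) (ρ : Mode →L[ℂ] Mode) : ℝ :=
  purificationOverlap p (purification ρ)

/-! ### Nonclassicality filters -/

/-- `ω_L(ξ) = L⁻¹ 2^(1/q) √(q / (2 π Γ(2/q))) exp(-|ξ|^q / L^q)`. -/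
def omegaFn (q L : ℝ) (ξ : ℂ) : ℝ :=
  (1 / L) * 2 ^ (1 / q) * √(q / (2 * Real.pi * Real.Gamma (2 / q))) *
    Real.exp (-(‖ξ‖ ^ q / L ^ q))

/-- The nonclassicality filter `Ω_L(ξ) = ∫ ω_L(ζ) ω_L(ξ - ζ) d²ζ`. -/
def nonclassicalityFilter (q L : ℝ) (ξ : ℂ) : ℂ :=
  ((∫ ζ : ℂ, omegaFn q L ζ * omegaFn q L (ξ - ζ) : ℝ) : ℂ)

/-- The Fourier transform `π⁻² ∫ Ω(ξ) exp(α ξ* - ξ α*) d²ξ` of the nonclassicality filter. -/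
def nonclassicalityDensity (q L : ℝ) (α : ℂ) : ℝ :=
  ((1 / (Real.pi : ℂ) ^ 2) * ∫ ξ : ℂ, nonclassicalityFilter q L ξ * fourierKernel α ξ).re

end PhaseSpace

end

set_option linter.unusedSectionVars false

namespace PhaseSpace

/-! ### Trace class operators as sums of rank-one operators. -/

section NuclearOperators

variable {H : Type*} [NormedAddCommGroup H] [InnerProductSpace ℂ H] [CompleteSpace H]

/-! Trace class operators are handled through expansions `T = ∑ₖ |w k⟩⟨v k|` (`HasRankOneSum`) and
through the bound `TraceNormLE`, which tests `T` against contractions on finite parts of a basis.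
Polar decomposition makes the two equivalent. Expansions turn traces and characteristic functions
into sums of inner products. The finite tests pass through operator-valued integrals, although these
converge only in operator norm.

Error bound. If `ρ = ∑ |v k⟩⟨v k|`, then `D(α) ρ D(α)†` is expanded by the vectors `D(α) v k`, and
`∑ ⟨v k, D(α) v k⟩ = Φ_ρ(α)`. Two states whose expansions overlap in a real number `r` are at trace
distance at most `√(1 - r²)` (`traceNormLE_sub_of_overlap`). After a phase has made the overlap
equal to `|Φ_ρ(α)|`, averaging over `α` and concavity of the square root give `√(1 - ∫ p |Φ_ρ|²)`. A
vector purifying `ρ` is `∑ mⱼ ⊗ eⱼ` with `ρ = ∑ |mⱼ⟩⟨mⱼ|`, so `⟨μ, (D(α) ⊗ I) μ⟩ = Φ_ρ(α)` for every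
purification and the integral is the fidelity. Channels and measurements do not increase the
distance, by the Jordan decomposition of the difference of the states.

Convergence. Near `0` continuity makes `1 - |Φ_ρ|²` small, and away from `0` it is dominated by a
multiple of `1 - exp(-|α|²)`. By Gaussian duality `π ∫ p(α) exp(-|α|²) = ∫ Ω(ξ) exp(-|ξ|²)`, which
tends to `π` when `Ω → 1` pointwise, by dominated convergence with `|Ω| ≤ 1`.

Nonclassicality filters. `Ω_L = ω ∗ ω` has as Fourier transform the square of a real function. A
bounded integrable function with nonnegative transform has an integrable transform
(`integrable_of_planeFourier_nonneg`), so inversion applies and `Ω_L` is physical.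

Regularity of `P`. Factor `Φ_ρ Ω_L exp(|ξ|²/2)` as `(Ω_L exp(|ξ|²)) · (Φ_ρ exp(-|ξ|²/2))`. The
second factor transforms into `π` times the Husimi function, which is nonnegative and hence
integrable. For the first, linearising `exp(|ζ + s η|²)` by a Gaussian integral over `z` writes the
transform of its kernel as an average of products of transforms of tilted windows. For `s = -1`
these products are squared moduli, hence integrable, and they dominate the case `s = 1` that is
needed (`integrable_planeFourier_shear_exp`). The transform of the product is a convolution of
integrable functions, so `P` is integrable. The identity `σ = ∫ P(α) |α⟩⟨α|` follows because a trace
class operator is determined by its characteristic function (`eq_zero_of_charFn_eq_zero`), which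
rests on `∫ exp(-|ξ|²/2) D(ξ) = π |0⟩⟨0|` and on totality of coherent states. -/

/-- The polar decomposition of a bounded operator. -/
theorem exists_polar_decomposition (T : H →L[ℂ] H) :
    ∃ U : H →L[ℂ] H, (∀ x, ‖U x‖ ≤ ‖x‖) ∧ (∀ x, T x = U (CFC.abs T x)) ∧
      ∀ x y, ⟪x, CFC.abs T y⟫_ℂ = ⟪U x, T y⟫_ℂ := by
  set A := CFC.abs T with hA
  have hsa : ContinuousLinearMap.adjoint A = A := by
    have := (CFC.abs_nonneg T).isSelfAdjoint.star_eq
    rwa [ContinuousLinearMap.star_eq_adjoint] at this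
  have hinner : ∀ x y, ⟪A x, A y⟫_ℂ = ⟪T x, T y⟫_ℂ := fun x y => by
    have h := CFC.abs_mul_abs T
    rw [← hA, ContinuousLinearMap.star_eq_adjoint] at h
    have h2 : A (A y) = ContinuousLinearMap.adjoint T (T y) := congrArg (fun S => S y) h
    rw [← ContinuousLinearMap.adjoint_inner_right A, hsa, h2,
      ContinuousLinearMap.adjoint_inner_right]
  have hnorm : ∀ x, ‖T x‖ ≤ 1 * ‖A x‖ := fun x => by
    rw [one_mul, ← sq_le_sq₀ (norm_nonneg _) (norm_nonneg _), ← inner_self_eq_norm_sq (𝕜 := ℂ),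
      ← inner_self_eq_norm_sq (𝕜 := ℂ), hinner]
  -- `U` is the extension of `|T| x ↦ T x` to the closed range of `|T|`, set to zero on the
  -- orthogonal complement.
  let M : Submodule ℂ H := (LinearMap.range A.toLinearMap).topologicalClosure
  have hmem : ∀ x, A x ∈ M := fun x => Submodule.le_topologicalClosure _ ⟨x, rfl⟩
  have : CompleteSpace M := (Submodule.isClosed_topologicalClosure _).completeSpace_coe
  let e : H →ₗ[ℂ] M := A.toLinearMap.codRestrict M hmem
  have hdense : DenseRange e := by
    rintro ⟨x, hx⟩
    rw [Metric.mem_closure_iff]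
    intro ε hε
    obtain ⟨_, ⟨z, rfl⟩, hz⟩ := Metric.mem_closure_iff.1
      (show x ∈ closure (LinearMap.range A.toLinearMap : Set H) from hx) ε hε
    exact ⟨e z, ⟨z, rfl⟩, hz⟩
  let V : M →L[ℂ] H := T.toLinearMap.extendOfNorm e
  have hV : ∀ x, V ⟨A x, hmem x⟩ = T x := fun x =>
    LinearMap.extendOfNorm_eq (f := T.toLinearMap) (e := e) hdense ⟨1, hnorm⟩ x
  have hVn : ∀ x, ‖V x‖ ≤ 1 * ‖x‖ :=
    LinearMap.norm_extendOfNorm_apply_le (f := T.toLinearMap) (e := e) hdense 1 hnorm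
  have hproj : ∀ x, M.orthogonalProjectionOnto (A x) = ⟨A x, hmem x⟩ := fun x =>
    M.orthogonalProjectionOnto_mem_subspace_eq_self (⟨A x, hmem x⟩ : M)
  refine ⟨V ∘L M.orthogonalProjectionOnto, fun x => ?_, fun x => ?_, fun x y => ?_⟩
  · have h1 := hVn (M.orthogonalProjectionOnto x)
    rw [one_mul] at h1
    refine h1.trans ?_
    simpa using M.orthogonalProjectionOnto.le_of_opNorm_le M.orthogonalProjectionOnto_norm_le x
  · simp [hproj, hV]
  · have key : ∀ z : M, ⟪(z : H), A y⟫_ℂ = ⟪V z, T y⟫_ℂ := by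
      intro z
      refine hdense.induction_on (p := fun z : M => ⟪(z : H), A y⟫_ℂ = ⟪V z, T y⟫_ℂ) z
        (isClosed_eq (by fun_prop) (by fun_prop)) fun a => ?_
      have : V (e a) = T a := hV a
      rw [this]
      exact hinner a y
    rw [ContinuousLinearMap.comp_apply, ← key]
    exact (M.inner_orthogonalProjectionOnto_eq_of_mem_right ⟨A y, hmem y⟩ x).symm

/-- `T = ∑ₖ |w k⟩⟨v k|` weakly, with square-summable families `w` and `v`. -/
structure HasRankOneSum {ι : Type*} (w v : ι → H) (T : H →L[ℂ] H) : Prop where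
  summable_left : Summable fun k => ‖w k‖ ^ 2
  summable_right : Summable fun k => ‖v k‖ ^ 2
  hasSum_inner : ∀ x y, HasSum (fun k => ⟪x, w k⟫_ℂ * ⟪v k, y⟫_ℂ) ⟪x, T y⟫_ℂ

/-- The trace norm of `T` is at most `c`. -/
def TraceNormLE (T : H →L[ℂ] H) (c : ℝ) : Prop :=
  ∀ U : H →L[ℂ] H, (∀ x, ‖U x‖ ≤ ‖x‖) → ∀ s : Finset (basisIndex H),
    ∑ i ∈ s, ‖⟪U (stdBasis H i), T (stdBasis H i)⟫_ℂ‖ ≤ c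

variable {T S : H →L[ℂ] H} {c d : ℝ} {ι : Type*} {w v : ι → H}

/-- Cauchy–Schwarz followed by Bessel's inequality for `U† x` and `y`: the trace norm bound for a
single rank-one operator. -/
theorem sum_norm_inner_mul_inner_le {x y : H} {U : H →L[ℂ] H} (hU : ∀ x, ‖U x‖ ≤ ‖x‖)
    (s : Finset (basisIndex H)) :
    ∑ i ∈ s, ‖⟪U (stdBasis H i), x⟫_ℂ‖ * ‖⟪y, stdBasis H i⟫_ℂ‖ ≤ ‖x‖ * ‖y‖ := by
  have hadj : ‖ContinuousLinearMap.adjoint U x‖ ≤ ‖x‖ := by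
    have h1 : ‖ContinuousLinearMap.adjoint U‖ ≤ 1 := by
      rw [LinearIsometryEquiv.norm_map]
      exact U.opNorm_le_bound zero_le_one (by simpa using hU)
    simpa using (ContinuousLinearMap.adjoint U).le_of_opNorm_le h1 x
  have h1 := (stdBasis H).orthonormal.sum_inner_products_le (ContinuousLinearMap.adjoint U x)
    (s := s)
  have h2 := (stdBasis H).orthonormal.sum_inner_products_le y (s := s)
  refine (Real.sum_mul_le_sqrt_mul_sqrt _ _ _).trans ?_
  refine mul_le_mul (Real.sqrt_le_iff.2 ⟨norm_nonneg _, ?_⟩)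
    (Real.sqrt_le_iff.2 ⟨norm_nonneg _, ?_⟩) (Real.sqrt_nonneg _) (norm_nonneg _)
  · refine le_trans (le_of_eq ?_) (h1.trans (pow_le_pow_left₀ (norm_nonneg _) hadj 2))
    exact Finset.sum_congr rfl fun i _ => by rw [ContinuousLinearMap.adjoint_inner_right]
  · refine le_trans (le_of_eq ?_) h2
    exact Finset.sum_congr rfl fun i _ => by rw [norm_inner_symm]

namespace HasRankOneSum

theorem summable_norm_mul_norm (h : HasRankOneSum w v T) :
    Summable fun k => ‖w k‖ * ‖v k‖ :=
  .of_nonneg_of_le (fun _ => by positivity)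
    (fun k => by nlinarith [sq_nonneg (‖w k‖ - ‖v k‖), sq_nonneg (‖w k‖), sq_nonneg (‖v k‖)])
    (h.summable_left.add h.summable_right)

theorem summable_norm_inner (h : HasRankOneSum w v T) (x y : H) :
    Summable fun k => ‖⟪x, w k⟫_ℂ * ⟪v k, y⟫_ℂ‖ := by
  refine .of_nonneg_of_le (fun _ => by positivity) (fun k => ?_)
    (h.summable_norm_mul_norm.mul_left (‖x‖ * ‖y‖))
  rw [norm_mul]
  calc _ ≤ (‖x‖ * ‖w k‖) * (‖v k‖ * ‖y‖) := by gcongr <;> exact norm_inner_le_norm _ _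
    _ = _ := by ring

/-- The square-summability hypotheses upgrade the weak expansion to one that converges absolutely in
operator norm. -/
theorem hasSum_rankOne (h : HasRankOneSum w v T) :
    HasSum (fun k => InnerProductSpace.rankOne ℂ (w k) (v k)) T := by
  have hs : Summable fun k => InnerProductSpace.rankOne ℂ (w k) (v k) :=
    .of_norm (by simpa using h.summable_norm_mul_norm)
  convert! hs.hasSum
  ext y
  refine ext_inner_left ℂ fun x => ?_
  refine (h.hasSum_inner x y).unique ?_
  have h1 := (hs.hasSum.mapL (ContinuousLinearMap.apply ℂ H y)).mapL (innerSL ℂ x)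
  simpa [inner_smul_right, mul_comm] using h1

theorem of_hasSum_rankOne (hw : Summable fun k => ‖w k‖ ^ 2) (hv : Summable fun k => ‖v k‖ ^ 2)
    (h : HasSum (fun k => InnerProductSpace.rankOne ℂ (w k) (v k)) T) : HasRankOneSum w v T := by
  refine ⟨hw, hv, fun x y => ?_⟩
  have h1 := (h.mapL (ContinuousLinearMap.apply ℂ H y)).mapL (innerSL ℂ x)
  simpa [inner_smul_right, mul_comm] using h1

theorem traceNormLE (h : HasRankOneSum w v T) : TraceNormLE T (∑' k, ‖w k‖ * ‖v k‖) := by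
  intro U hU s
  have h1 : ∀ i, ‖⟪U (stdBasis H i), T (stdBasis H i)⟫_ℂ‖ ≤
      ∑' k, ‖⟪U (stdBasis H i), w k⟫_ℂ * ⟪v k, stdBasis H i⟫_ℂ‖ := fun i => by
    rw [← (h.hasSum_inner _ _).tsum_eq]
    exact norm_tsum_le_tsum_norm (h.summable_norm_inner _ _)
  calc _ ≤ ∑ i ∈ s, ∑' k, ‖⟪U (stdBasis H i), w k⟫_ℂ * ⟪v k, stdBasis H i⟫_ℂ‖ :=
        Finset.sum_le_sum fun i _ => h1 i
    _ = ∑' k, ∑ i ∈ s, ‖⟪U (stdBasis H i), w k⟫_ℂ * ⟪v k, stdBasis H i⟫_ℂ‖ :=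
        (Summable.tsum_finsetSum fun i _ => h.summable_norm_inner _ _).symm
    _ ≤ _ := by
        refine Summable.tsum_le_tsum (fun k => ?_)
          (summable_sum fun i _ => h.summable_norm_inner _ _) h.summable_norm_mul_norm
        simp only [norm_mul]
        exact sum_norm_inner_mul_inner_le hU s

/-- Fubini for the double family indexed by `k` and the basis: summing over the basis first is
Parseval, summing over `k` first is the expansion of the diagonal entry. It frees the trace from the
chosen basis. -/
theorem hasSum_trace (h : HasRankOneSum w v T) :
    HasSum (fun i => ⟪stdBasis H i, T (stdBasis H i)⟫_ℂ) (∑' k, ⟪v k, w k⟫_ℂ) := by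
  obtain ⟨f, hfdef⟩ : ∃ f : ι × basisIndex H → ℂ, ∀ k i, f (k, i) =
    ⟪stdBasis H i, w k⟫_ℂ * ⟪v k, stdBasis H i⟫_ℂ := 
    ⟨fun q => ⟪stdBasis H q.2, w q.1⟫_ℂ * ⟪v q.1, stdBasis H q.2⟫_ℂ, fun _ _ => rfl⟩
  have hf : Summable f := by
    refine .of_norm (summable_of_sum_le (c := ∑' k, ‖w k‖ * ‖v k‖) (fun _ => norm_nonneg _)
      fun u => ?_)
    classical
    calc ∑ q ∈ u, ‖f q‖ ≤ ∑ q ∈ u.image Prod.fst ×ˢ u.image Prod.snd, ‖f q‖ :=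
          Finset.sum_le_sum_of_subset_of_nonneg Finset.subset_product fun _ _ _ => norm_nonneg _
      _ = ∑ k ∈ u.image Prod.fst, ∑ i ∈ u.image Prod.snd, ‖f (k, i)‖ := Finset.sum_product _ _ _
      _ ≤ ∑ k ∈ u.image Prod.fst, ‖w k‖ * ‖v k‖ := Finset.sum_le_sum fun k _ => by
          simp only [hfdef, norm_mul]
          exact sum_norm_inner_mul_inner_le (U := .id ℂ H) (fun x => le_rfl) _
      _ ≤ _ := h.summable_norm_mul_norm.sum_le_tsum _ fun _ _ => by positivity
  have h1 : HasSum f (∑' k, ⟪v k, w k⟫_ℂ) := by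
    have h2 := hf.hasSum.prod_fiberwise (g := fun k => ⟪v k, w k⟫_ℂ) fun k => by
      simpa [hfdef, mul_comm] using (stdBasis H).hasSum_inner_mul_inner (v k) (w k)
    rw [h2.tsum_eq]
    exact hf.hasSum
  have h3 : HasSum (fun q : basisIndex H × ι => f (q.2, q.1)) (∑' k, ⟪v k, w k⟫_ℂ) :=
    (Equiv.prodComm (basisIndex H) ι).hasSum_iff.2 h1
  refine h3.prod_fiberwise fun i => ?_
  simp only [hfdef]
  exact h.hasSum_inner _ _

theorem opTrace_eq (h : HasRankOneSum w v T) : opTrace T = ∑' k, ⟪v k, w k⟫_ℂ :=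
  h.hasSum_trace.tsum_eq

theorem summable_comp {B : H →L[ℂ] H} {u : ι → H} (hu : Summable fun k => ‖u k‖ ^ 2) :
    Summable fun k => ‖B (u k)‖ ^ 2 := by
  refine .of_nonneg_of_le (fun _ => by positivity) (fun k => ?_) (hu.mul_left (‖B‖ ^ 2))
  rw [← mul_pow]
  exact pow_le_pow_left₀ (norm_nonneg _) (B.le_opNorm _) 2

theorem comp_left (h : HasRankOneSum w v T) (B : H →L[ℂ] H) :
    HasRankOneSum (fun k => B (w k)) v (B ∘L T) := by
  refine ⟨summable_comp h.summable_left, h.summable_right, fun x y => ?_⟩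
  simpa [ContinuousLinearMap.adjoint_inner_left] using
    h.hasSum_inner (ContinuousLinearMap.adjoint B x) y

theorem comp_right (h : HasRankOneSum w v T) (B : H →L[ℂ] H) :
    HasRankOneSum w (fun k => ContinuousLinearMap.adjoint B (v k)) (T ∘L B) := by
  refine ⟨h.summable_left, summable_comp h.summable_right, fun x y => ?_⟩
  simpa [ContinuousLinearMap.adjoint_inner_left] using h.hasSum_inner x (B y)

end HasRankOneSum

theorem IsTraceClass.hasSum_abs (h : IsTraceClass T) :
    HasSum (fun i => ⟪stdBasis H i, CFC.abs T (stdBasis H i)⟫_ℂ) (opTrace (CFC.abs T)) :=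
  h.hasSum

theorem inner_eq_norm_sqrt {A : H →L[ℂ] H} (hA : 0 ≤ A) (x y : H) :
    ⟪x, A y⟫_ℂ = ⟪CFC.sqrt A x, CFC.sqrt A y⟫_ℂ := by
  have hsa : ContinuousLinearMap.adjoint (CFC.sqrt A) = CFC.sqrt A := by
    have := (CFC.sqrt_nonneg A).isSelfAdjoint.star_eq
    rwa [ContinuousLinearMap.star_eq_adjoint] at this
  have h1 : A y = CFC.sqrt A (CFC.sqrt A y) :=
    congrArg (fun S : H →L[ℂ] H => S y) (CFC.sqrt_mul_sqrt_self A hA).symm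
  rw [h1, ← hsa, ContinuousLinearMap.adjoint_inner_right, hsa]

theorem inner_self_eq_norm_sqrt {A : H →L[ℂ] H} (hA : 0 ≤ A) (x : H) :
    ⟪x, A x⟫_ℂ = ((‖CFC.sqrt A x‖ ^ 2 : ℝ) : ℂ) := by
  rw [inner_eq_norm_sqrt hA, inner_self_eq_norm_sq_to_K]
  simp

theorem hasSum_norm_sqrt {A : H →L[ℂ] H} (hA : 0 ≤ A) 
    (h : Summable fun i => ⟪stdBasis H i, A (stdBasis H i)⟫_ℂ) :
    HasSum (fun i => ‖CFC.sqrt A (stdBasis H i)‖ ^ 2) (opTrace A).re := by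
  refine (Complex.hasSum_re h.hasSum).congr_fun fun i => ?_
  rw [inner_self_eq_norm_sqrt hA, Complex.ofReal_re]

/-- A positive operator of finite trace is `∑ᵢ |√A eᵢ⟩⟨√A eᵢ|`. -/
theorem hasRankOneSum_sqrt {A : H →L[ℂ] H} (hA : 0 ≤ A)
    (h : Summable fun i => ⟪stdBasis H i, A (stdBasis H i)⟫_ℂ) :
    HasRankOneSum (fun i => CFC.sqrt A (stdBasis H i)) (fun i => CFC.sqrt A (stdBasis H i)) A := by
  refine ⟨(hasSum_norm_sqrt hA h).summable, (hasSum_norm_sqrt hA h).summable, fun x y => ?_⟩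
  have hsa : ContinuousLinearMap.adjoint (CFC.sqrt A) = CFC.sqrt A := by
    have := (CFC.sqrt_nonneg A).isSelfAdjoint.star_eq
    rwa [ContinuousLinearMap.star_eq_adjoint] at this
  have h1 := (stdBasis H).hasSum_inner_mul_inner (CFC.sqrt A x) (CFC.sqrt A y)
  rw [← inner_eq_norm_sqrt hA] at h1
  refine h1.congr_fun fun k => ?_
  rw [← ContinuousLinearMap.adjoint_inner_left (CFC.sqrt A),
    ← ContinuousLinearMap.adjoint_inner_right (CFC.sqrt A), hsa]

/-- Expand `|T|` by the vectors `√|T| eᵢ` and apply the partial isometry of the polar decomposition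
on the left; it does not lengthen vectors. -/
theorem IsTraceClass.exists_hasRankOneSum (h : IsTraceClass T) :
    ∃ w v : basisIndex H → H, HasRankOneSum w v T ∧
      ∑' k, ‖w k‖ * ‖v k‖ ≤ (opTrace (CFC.abs T)).re := by
  obtain ⟨U, hU, hT, -⟩ := exists_polar_decomposition T
  have h1 := (hasRankOneSum_sqrt (CFC.abs_nonneg T) h).comp_left U
  have h2 : U ∘L CFC.abs T = T := by ext x; simp [hT]
  rw [h2] at h1
  refine ⟨_, _, h1, ?_⟩
  have h3 := hasSum_norm_sqrt (CFC.abs_nonneg T) h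
  rw [← h3.tsum_eq]
  refine Summable.tsum_le_tsum (fun k => ?_) h1.summable_norm_mul_norm h3.summable
  rw [pow_two]
  exact mul_le_mul_of_nonneg_right (hU _) (norm_nonneg _)

theorem IsTraceClass.traceNormLE (h : IsTraceClass T) :
    TraceNormLE T (opTrace (CFC.abs T)).re := by
  obtain ⟨w, v, hT, hc⟩ := h.exists_hasRankOneSum
  exact fun U hU s => (hT.traceNormLE U hU s).trans hc

namespace TraceNormLE

theorem mono (h : TraceNormLE T c) (hcd : c ≤ d) : TraceNormLE T d :=
  fun U hU s => (h U hU s).trans hcd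

/-- The polar factor `U` is itself an admissible test contraction, and it turns the entries of `T`
into those of `|T|`. -/
theorem isTraceClass (h : TraceNormLE T c) : IsTraceClass T := by
  obtain ⟨U, hU, -, hT⟩ := exists_polar_decomposition T
  refine .of_norm (summable_of_sum_le (fun _ => norm_nonneg _) (c := c) fun s => ?_)
  simpa only [hT] using h U hU s

theorem trace_abs_le (h : TraceNormLE T c) : (opTrace (CFC.abs T)).re ≤ c := by
  obtain ⟨U, hU, -, hT⟩ := exists_polar_decomposition T
  refine hasSum_le_of_sum_le (Complex.hasSum_re h.isTraceClass.hasSum_abs) fun s => ?_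
  refine le_trans (Finset.sum_le_sum fun i _ => ?_) (h U hU s)
  rw [hT]
  exact Complex.re_le_norm _

theorem summable_norm (h : TraceNormLE T c) :
    Summable fun i => ‖⟪stdBasis H i, T (stdBasis H i)⟫_ℂ‖ :=
  summable_of_sum_le (fun _ => norm_nonneg _) (c := c) fun s =>
    h (.id ℂ H) (fun _ => le_rfl) s

theorem add (hT : TraceNormLE T c) (hS : TraceNormLE S d) : TraceNormLE (T + S) (c + d) := by
  intro U hU s
  refine le_trans ?_ (add_le_add (hT U hU s) (hS U hU s))
  rw [← Finset.sum_add_distrib]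
  refine Finset.sum_le_sum fun i _ => ?_
  rw [add_apply, inner_add_right]
  exact norm_add_le _ _

theorem smul (hT : TraceNormLE T c) (a : ℂ) : TraceNormLE (a • T) (‖a‖ * c) := by
  intro U hU s
  refine le_trans (le_of_eq ?_) (mul_le_mul_of_nonneg_left (hT U hU s) (norm_nonneg a))
  rw [Finset.mul_sum]
  exact Finset.sum_congr rfl fun i _ => by
    rw [smul_apply, inner_smul_right, norm_mul]

theorem neg (hT : TraceNormLE T c) : TraceNormLE (-T) c := by
  simpa using hT.smul (-1)

theorem sub (hT : TraceNormLE T c) (hS : TraceNormLE S d) : TraceNormLE (T - S) (c + d) := by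
  simpa [sub_eq_add_neg] using hT.add hS.neg

end TraceNormLE

namespace IsTraceClass

theorem summable (h : IsTraceClass T) :
    Summable fun i => ⟪stdBasis H i, T (stdBasis H i)⟫_ℂ := .of_norm h.traceNormLE.summable_norm

theorem neg (hT : IsTraceClass T) : IsTraceClass (-T) := hT.traceNormLE.neg.isTraceClass

theorem sub (hT : IsTraceClass T) (hS : IsTraceClass S) : IsTraceClass (T - S) :=
  (hT.traceNormLE.sub hS.traceNormLE).isTraceClass

theorem comp_right (hT : IsTraceClass T) (B : H →L[ℂ] H) : IsTraceClass (T ∘L B) := by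
  obtain ⟨w, v, h, -⟩ := hT.exists_hasRankOneSum
  exact (h.comp_right B).traceNormLE.isTraceClass

theorem opTrace_sub (hT : IsTraceClass T) (hS : IsTraceClass S) :
    opTrace (T - S) = opTrace T - opTrace S := by
  rw [opTrace, opTrace, opTrace, ← hT.summable.tsum_sub hS.summable]
  simp

end IsTraceClass

theorem HasRankOneSum.isTraceClass (h : HasRankOneSum w v T) : IsTraceClass T :=
  h.traceNormLE.isTraceClass

end NuclearOperators

/-! ### Operator-valued integrals, quantum channels and measurements. -/

section NuclearOperators

variable {H : Type*} [NormedAddCommGroup H] [InnerProductSpace ℂ H] [CompleteSpace H]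
variable {X : Type*} [MeasurableSpace X] {m : Measure X} {f : X → H →L[ℂ] H} {g : X → ℝ}

theorem integrable_inner_apply (hf : Integrable f m) (x y : H) :
    Integrable (fun t => ⟪x, f t y⟫_ℂ) m :=
  (((innerSL ℂ x) ∘L (ContinuousLinearMap.apply ℂ H y)).integrable_comp hf :)

theorem inner_integral_apply (hf : Integrable f m) (x y : H) :
    ⟪x, (∫ t, f t ∂m) y⟫_ℂ = ∫ t, ⟪x, f t y⟫_ℂ ∂m :=
  (((innerSL ℂ x) ∘L (ContinuousLinearMap.apply ℂ H y)).integral_comp_comm hf).symm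

/-- Each test involves finitely many matrix entries, and these are continuous in operator norm, so
they commute with the integral. -/
theorem TraceNormLE.integral (hf : Integrable f m) (hg : Integrable g m)
    (h : ∀ t, TraceNormLE (f t) (g t)) : TraceNormLE (∫ t, f t ∂m) (∫ t, g t ∂m) := by
  intro U hU s
  have hi := fun i : basisIndex H => integrable_inner_apply hf (U (stdBasis H i)) (stdBasis H i)
  calc _ ≤ ∑ i ∈ s, ∫ t, ‖⟪U (stdBasis H i), f t (stdBasis H i)⟫_ℂ‖ ∂m := by
        refine Finset.sum_le_sum fun i _ => ?_
        rw [inner_integral_apply hf]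
        exact norm_integral_le_integral_norm _
    _ = ∫ t, ∑ i ∈ s, ‖⟪U (stdBasis H i), f t (stdBasis H i)⟫_ℂ‖ ∂m :=
        (integral_finsetSum _ fun i _ => (hi i).norm).symm
    _ ≤ _ := integral_mono (integrable_finsetSum _ fun i _ => (hi i).norm) hg
        fun t => h t U hU s

/-- The trace is not continuous in operator norm. The integrable bound `g` on trace norms is what
allows the sum over the basis to be exchanged with the integral. -/
theorem opTrace_integral [Countable (basisIndex H)] (hf : Integrable f m) (hg : Integrable g m)
    (h : ∀ t, TraceNormLE (f t) (g t)) : opTrace (∫ t, f t ∂m) = ∫ t, opTrace (f t) ∂m := by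
  have hi := fun i : basisIndex H => integrable_inner_apply hf (stdBasis H i) (stdBasis H i)
  rw [opTrace]
  simp only [inner_integral_apply hf]
  refine (hasSum_integral_of_summable_integral_norm hi ?_).tsum_eq
  refine summable_of_sum_le (c := ∫ t, g t ∂m) (fun i => integral_nonneg fun t => norm_nonneg _)
    fun s => ?_
  rw [← integral_finsetSum _ fun i _ => (hi i).norm]
  exact integral_mono (integrable_finsetSum _ fun i _ => (hi i).norm) hg
    fun t => h t (.id ℂ H) (fun _ => le_rfl) s

theorem isTraceClass_of_nonneg {A : H →L[ℂ] H} (hA : 0 ≤ A)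
    (h : Summable fun i => ‖CFC.sqrt A (stdBasis H i)‖ ^ 2) : IsTraceClass A := by
  rw [IsTraceClass, CFC.abs_of_nonneg A hA]
  simp only [inner_self_eq_norm_sqrt hA]
  exact_mod_cast h

theorem IsTraceClass.of_le {A B : H →L[ℂ] H} (hA : 0 ≤ A) (hAB : A ≤ B) (hB : IsTraceClass B) :
    IsTraceClass A := by
  have hB0 := hA.trans hAB
  refine isTraceClass_of_nonneg hA (.of_nonneg_of_le (fun _ => by positivity) (fun i => ?_)
    (hasSum_norm_sqrt hB0 hB.summable).summable)
  have h1 := ((ContinuousLinearMap.le_def A B).1 hAB).re_inner_nonneg_right (stdBasis H i)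
  rw [sub_apply, inner_sub_right, inner_self_eq_norm_sqrt hA,
    inner_self_eq_norm_sqrt hB0, map_sub] at h1
  simpa [← Complex.ofReal_pow] using h1

/-- The Jordan decomposition. Both parts lie below `|A|`, hence are trace class, and they add up to
`|A|`. -/
theorem IsTraceClass.exists_sub {A : H →L[ℂ] H} (hA : IsTraceClass A) (hsa : IsSelfAdjoint A) :
    ∃ P N : H →L[ℂ] H, 0 ≤ P ∧ 0 ≤ N ∧ IsTraceClass P ∧ IsTraceClass N ∧ A = P - N ∧
      (opTrace P).re + (opTrace N).re = (opTrace (CFC.abs A)).re := by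
  have hadd := CFC.posPart_add_negPart A hsa
  have hP : (0 : H →L[ℂ] H) ≤ A⁺ := CFC.posPart_nonneg A
  have hN : (0 : H →L[ℂ] H) ≤ A⁻ := CFC.negPart_nonneg A
  have habs : IsTraceClass (CFC.abs A) := by
    rw [IsTraceClass, CFC.cfcAbs_cfcAbs]
    exact hA
  have hPt : IsTraceClass A⁺ := habs.of_le hP (by rw [← hadd]; exact le_add_of_nonneg_right hN)
  have hNt : IsTraceClass A⁻ := habs.of_le hN (by rw [← hadd]; exact le_add_of_nonneg_left hP)
  refine ⟨A⁺, A⁻, hP, hN, hPt, hNt, (CFC.posPart_sub_negPart A hsa).symm, ?_⟩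
  have h1 : CFC.abs A - A⁻ = A⁺ := by rw [← hadd]; abel
  have h2 := habs.opTrace_sub hNt
  rw [h1] at h2
  rw [h2]
  simp

theorem traceNormLE_of_nonneg {A : H →L[ℂ] H} (hA : 0 ≤ A) (h : IsTraceClass A) :
    TraceNormLE A (opTrace A).re := by
  simpa [CFC.abs_of_nonneg A hA] using h.traceNormLE

/-- Extracts plain positivity of a map from complete positivity, as the case `n = 1`. -/
theorem isPositiveBlock_one {A : H →L[ℂ] H} :
    (IsPositiveBlock fun _ _ : Fin 1 => A) ↔ 0 ≤ A := by
  rw [ContinuousLinearMap.nonneg_iff_isPositive]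
  constructor
  · intro h
    rw [ContinuousLinearMap.isPositive_iff_complex]
    intro x
    have h1 := h fun _ => x
    simp only [Finset.univ_unique, Finset.sum_const, Finset.card_singleton, one_smul] at h1
    have h2 : ⟪A x, x⟫_ℂ = starRingEnd ℂ ⟪x, A x⟫_ℂ := (inner_conj_symm _ _).symm
    have h3 : ⟪A x, x⟫_ℂ = ⟪x, A x⟫_ℂ := by rw [h2, Complex.conj_eq_iff_im.2 h1.1]
    rw [h3]
    exact ⟨Complex.ext (by simp) (by simp [h1.1]), h1.2⟩
  · intro h v
    simp only [Finset.univ_unique, Finset.sum_singleton]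
    rw [inner_self_eq_norm_sqrt (ContinuousLinearMap.nonneg_iff_isPositive _ |>.2 h)]
    exact ⟨Complex.ofReal_im _, by rw [Complex.ofReal_re]; positivity⟩

/-- The trace norm does not increase under quantum channels. -/
theorem IsChannel.traceDist_le {K : Type*} [NormedAddCommGroup K] [InnerProductSpace ℂ K]
    [CompleteSpace K] {𝓔 : (H →L[ℂ] H) → (K →L[ℂ] K)} (h𝓔 : IsChannel 𝓔) {ρ σ : H →L[ℂ] H}
    (hρ : IsTraceClass ρ) (hσ : IsTraceClass σ) (hsa : IsSelfAdjoint (ρ - σ)) :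
    traceDist (𝓔 ρ) (𝓔 σ) ≤ traceDist ρ σ := by
  obtain ⟨P, N, hP, hN, hPt, hNt, hA, htr⟩ := (hρ.sub hσ).exists_sub hsa
  have hmap : ∀ {S T : H →L[ℂ] H}, IsTraceClass S → IsTraceClass T → 𝓔 (S - T) = 𝓔 S - 𝓔 T := by
    intro S T hS hT
    have h1 := h𝓔.map_add S (-T) hS hT.neg
    have h2 := h𝓔.map_smul (-1) T hT
    rw [neg_one_smul, neg_one_smul] at h2
    rw [sub_eq_add_neg, h1, h2, sub_eq_add_neg]
  have hpos : ∀ {S : H →L[ℂ] H}, 0 ≤ S → IsTraceClass S →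
      TraceNormLE (𝓔 S) (opTrace S).re := by
    intro S hS hSt
    rw [← h𝓔.trace_map S hSt]
    exact traceNormLE_of_nonneg (isPositiveBlock_one.1 (h𝓔.completelyPositive 1 (fun _ _ => S)
      (fun _ _ => hSt) (isPositiveBlock_one.2 hS))) (h𝓔.map_traceClass S hSt)
  -- A channel keeps the traces of the two positive parts, whose sum is the trace norm of the
  -- difference.
  have h1 := ((hpos hP hPt).sub (hpos hN hNt)).trace_abs_le
  rw [htr, ← hmap hPt hNt, ← hA, hmap hρ hσ] at h1
  exact mul_le_mul_of_nonneg_left h1 (by norm_num)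

/-- With `P = ∑ |v k⟩⟨v k|` the probabilities are sums over `k` of the nonnegative numbers `⟨v k, Mₙ
v k⟩`, so the sums over `n` and `k` can be exchanged. -/
theorem IsPOVM.hasSum_bornProb {ι : Type*} {M : ι → H →L[ℂ] H} (hM : IsPOVM M) {P : H →L[ℂ] H}
    (hP : 0 ≤ P) (hPt : IsTraceClass P) :
    (∀ n, 0 ≤ bornProb P (M n)) ∧ HasSum (fun n => bornProb P (M n)) (opTrace P).re := by
  have hr := hasRankOneSum_sqrt hP hPt.summable
  have hs := hasSum_norm_sqrt hP hPt.summable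
  set v := fun i => CFC.sqrt P (stdBasis H i)
  have hborn : ∀ n, HasSum (fun k => (⟪v k, M n (v k)⟫_ℂ).re) (bornProb P (M n)) := fun n => by
    have h1 := hr.comp_right (M n)
    have h2 : Summable fun k => ⟪ContinuousLinearMap.adjoint (M n) (v k), v k⟫_ℂ := by
      refine .of_norm (.of_nonneg_of_le (fun _ => norm_nonneg _) (fun k => ?_)
        h1.summable_norm_mul_norm)
      rw [mul_comm]
      exact norm_inner_le_norm _ _
    have h3 := Complex.hasSum_re h2.hasSum
    rw [← h1.opTrace_eq] at h3
    refine h3.congr_fun fun k => ?_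
    rw [ContinuousLinearMap.adjoint_inner_left]
  have hnn : ∀ n k, 0 ≤ (⟪v k, M n (v k)⟫_ℂ).re := fun n k =>
    (hM.isPositive n).re_inner_nonneg_right (v k)
  have hk : ∀ k, HasSum (fun n => (⟪v k, M n (v k)⟫_ℂ).re) (‖v k‖ ^ 2) := fun k => by
    have h1 := Complex.hasSum_re ((hM.hasSum (v k)).mapL (innerSL ℂ (v k)))
    simp only [innerSL_apply_apply] at h1
    rw [inner_self_eq_norm_sq_to_K] at h1
    simpa [← Complex.ofReal_pow] using h1
  refine ⟨fun n => (hborn n).nonneg (hnn n), ?_⟩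
  have hsum : Summable fun q : basisIndex H × ι => (⟪v q.1, M q.2 (v q.1)⟫_ℂ).re := by
    rw [summable_prod_of_nonneg fun q => hnn q.2 q.1]
    refine ⟨fun k => (hk k).summable, ?_⟩
    simp only [fun k => (hk k).tsum_eq]
    exact hs.summable
  have h1 := hsum.hasSum
  rw [← (h1.prod_fiberwise hk).tsum_eq, hs.tsum_eq] at h1
  exact ((Equiv.prodComm ι (basisIndex H)).hasSum_iff.2 h1).prod_fiberwise hborn

theorem IsTraceClass.bornProb_sub {S T M : H →L[ℂ] H} (hS : IsTraceClass S)
    (hT : IsTraceClass T) : bornProb (S - T) M = bornProb S M - bornProb T M := by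
  rw [bornProb, bornProb, bornProb, ContinuousLinearMap.sub_comp,
    (hS.comp_right M).opTrace_sub (hT.comp_right M), Complex.sub_re]

/-- The outcome distributions of a measurement are at most as far apart as the states. -/
theorem IsPOVM.sum_abs_le {ι : Type*} {M : ι → H →L[ℂ] H} (hM : IsPOVM M) {ρ σ : H →L[ℂ] H}
    (hρ : IsTraceClass ρ) (hσ : IsTraceClass σ) (hsa : IsSelfAdjoint (ρ - σ)) :
    Summable (fun n => |bornProb ρ (M n) - bornProb σ (M n)|) ∧
      (1 / 2) * ∑' n, |bornProb ρ (M n) - bornProb σ (M n)| ≤ traceDist ρ σ := by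
  obtain ⟨P, N, hP, hN, hPt, hNt, hA, htr⟩ := (hρ.sub hσ).exists_sub hsa
  obtain ⟨hP0, hPs⟩ := hM.hasSum_bornProb hP hPt
  obtain ⟨hN0, hNs⟩ := hM.hasSum_bornProb hN hNt
  have hle : ∀ n, |bornProb ρ (M n) - bornProb σ (M n)| ≤
      bornProb P (M n) + bornProb N (M n) := fun n => by
    rw [← hρ.bornProb_sub hσ, hA, hPt.bornProb_sub hNt]
    refine (abs_sub _ _).trans ?_
    rw [abs_of_nonneg (hP0 n), abs_of_nonneg (hN0 n)]
  have hsum := Summable.of_nonneg_of_le (fun _ => abs_nonneg _) hle (hPs.add hNs).summable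
  refine ⟨hsum, mul_le_mul_of_nonneg_left ?_ (by norm_num)⟩
  rw [← htr, ← (hPs.add hNs).tsum_eq]
  exact hsum.tsum_le_tsum hle (hPs.add hNs).summable

end NuclearOperators

/-! ### Displacement operators: strong continuity, Weyl relation, vacuum expectation. -/

section Displacement

/-- Distinct vectors are at distance `√2`, so balls of radius `1 / 2` around them are disjoint open
sets in a separable space. -/
theorem countable_of_orthonormal {H ι : Type*} [NormedAddCommGroup H]
    [InnerProductSpace ℂ H] [TopologicalSpace.SeparableSpace H] {v : ι → H}
    (hv : Orthonormal ℂ v) : Countable ι := by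
  refine Pairwise.countable_of_isOpen_disjoint (s := fun i => Metric.ball (v i) (1 / 2))
    (fun i j hij => ?_) (fun i => Metric.isOpen_ball)
    (fun i => ⟨v i, Metric.mem_ball_self (by norm_num)⟩)
  refine Metric.ball_disjoint_ball ?_
  have h1 : ‖v i - v j‖ * ‖v i - v j‖ = 2 := by
    rw [@norm_sub_mul_self ℂ, hv.inner_eq_zero hij]
    simp [hv.norm_eq_one]
    norm_num
  rw [dist_eq_norm]
  nlinarith [norm_nonneg (v i - v j)]

instance countable_basisIndex : Countable (basisIndex Mode) :=
  have : Fact ((2 : ENNReal) ≠ ⊤) := ⟨by simp⟩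
  countable_of_orthonormal (stdBasis Mode).orthonormal

theorem norm_displacement (ξ : ℂ) (ψ : Mode) : ‖displacement ξ ψ‖ = ‖ψ‖ :=
  (displacementIso ξ).norm_map ψ

theorem inner_displacement (ξ : ℂ) (φ ψ : Mode) :
    ⟪displacement ξ φ, displacement ξ ψ⟫_ℂ = ⟪φ, ψ⟫_ℂ :=
  (displacementIso ξ).inner_map_map φ ψ

theorem phaseMul_ae (θ : C(ℝ, ℝ)) (ψ : Mode) :
    phaseMul θ ψ =ᵐ[volume] fun x => Complex.exp (Complex.I * θ x) * ψ x :=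
  (memLp_phase_mul θ ψ).coeFn_toLp

/-- For isometric images of one vector the distance is a function of the inner product, and that is
continuous in `ξ` by dominated convergence. -/
theorem continuous_phaseMul (ψ : Mode) :
    Continuous fun ξ => phaseMul (displacementPhase ξ) ψ := by
  have hin : ∀ ξ₀, Continuous fun ξ => ⟪phaseMul (displacementPhase ξ₀) ψ,
      phaseMul (displacementPhase ξ) ψ⟫_ℂ := by
    intro ξ₀
    have h1 : ∀ ξ, ⟪phaseMul (displacementPhase ξ₀) ψ, phaseMul (displacementPhase ξ) ψ⟫_ℂ =
        ∫ x, ⟪Complex.exp (Complex.I * displacementPhase ξ₀ x) * ψ x,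
          Complex.exp (Complex.I * displacementPhase ξ x) * ψ x⟫_ℂ := fun ξ => by
      rw [L2.inner_def]
      refine integral_congr_ae ?_
      filter_upwards [phaseMul_ae (displacementPhase ξ₀) ψ, phaseMul_ae (displacementPhase ξ) ψ]
        with x h2 h3
      rw [h2, h3]
    simp only [h1]
    have hsq : Integrable fun x => ‖ψ x‖ ^ 2 :=
      (memLp_two_iff_integrable_sq_norm (Lp.memLp ψ).1).1 (Lp.memLp ψ)
    refine continuous_of_dominated (bound := fun x => ‖ψ x‖ ^ 2) (fun ξ => ?_) (fun ξ => ?_) hsq ?_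
    · exact (memLp_phase_mul (displacementPhase ξ₀) ψ).1.inner
        (memLp_phase_mul (displacementPhase ξ) ψ).1
    · refine Eventually.of_forall fun x => (norm_inner_le_norm _ _).trans (le_of_eq ?_)
      rw [norm_mul, norm_mul, mul_comm Complex.I, Complex.norm_exp_ofReal_mul_I,
        mul_comm Complex.I, Complex.norm_exp_ofReal_mul_I]
      ring
    · refine Eventually.of_forall fun x => ?_
      have : Continuous fun ξ => displacementPhase ξ x := by
        change Continuous fun ξ : ℂ => √2 * ξ.im * x - ξ.re * ξ.im
        fun_prop
      fun_prop
  rw [continuous_iff_continuousAt]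
  intro ξ₀
  rw [ContinuousAt, tendsto_iff_norm_sub_tendsto_zero]
  have h2 : ∀ ξ, ‖phaseMul (displacementPhase ξ) ψ - phaseMul (displacementPhase ξ₀) ψ‖ =
      √(2 * ‖ψ‖ ^ 2 - 2 * (⟪phaseMul (displacementPhase ξ₀) ψ,
      phaseMul (displacementPhase ξ) ψ⟫_ℂ).re) := fun ξ => by
    rw [← Real.sqrt_sq (norm_nonneg (_ - _)), @norm_sub_sq ℂ, ← inner_conj_symm,
      LinearIsometry.norm_map, LinearIsometry.norm_map]
    simp only [RCLike.re_to_complex, Complex.conj_re]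
    congr 1
    ring
  simp only [h2]
  have h3 : Continuous fun ξ => √(2 * ‖ψ‖ ^ 2 - 2 * (⟪phaseMul (displacementPhase ξ₀) ψ,
      phaseMul (displacementPhase ξ) ψ⟫_ℂ).re) := by
    have := hin ξ₀
    fun_prop
  convert h3.tendsto ξ₀
  rw [inner_self_eq_norm_sq_to_K, LinearIsometry.norm_map]
  simp [← Complex.ofReal_pow]

/-- Displacements are strongly continuous. -/
theorem continuous_displacement (ψ : Mode) : Continuous fun ξ => displacement ξ ψ := by
  let g : ℂ → C(ℝ, ℝ) := fun ξ => ⟨fun x => x - √2 * ξ.re, by fun_prop⟩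
  have hg : Continuous g := ContinuousMap.continuous_of_continuous_uncurry _
    (by change Continuous fun p : ℂ × ℝ => p.2 - √2 * p.1.re; fun_prop)
  let τ : ℂ → Mode := fun ξ => Lp.compMeasurePreserving (g ξ)
    (measurePreserving_sub_right volume (√2 * ξ.re)) ψ
  have hτ : Continuous τ := by
    rw [continuous_iff_continuousAt]
    exact fun ξ => Filter.Tendsto.compMeasurePreservingLp tendsto_const_nhds (hg.tendsto ξ)
      _ _ (by simp)
  have hD : ∀ ξ, displacement ξ ψ = phaseMul (displacementPhase ξ) (τ ξ) := fun ξ => rfl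
  rw [continuous_iff_continuousAt]
  intro ξ₀
  -- The translated vector and the phase both vary with `ξ`. Splitting off `τ ξ - τ ξ₀` leaves the
  -- phase acting on a fixed vector, and isometry controls the rest.
  have h1 : Tendsto (fun ξ => phaseMul (displacementPhase ξ) (τ ξ - τ ξ₀) +
      phaseMul (displacementPhase ξ) (τ ξ₀)) (𝓝 ξ₀)
      (𝓝 (0 + phaseMul (displacementPhase ξ₀) (τ ξ₀))) := by
    refine Tendsto.add ?_ ((continuous_phaseMul (τ ξ₀)).tendsto ξ₀)
    rw [tendsto_zero_iff_norm_tendsto_zero]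
    simp only [LinearIsometry.norm_map]
    exact tendsto_iff_norm_sub_tendsto_zero.1 (hτ.tendsto ξ₀)
  rw [ContinuousAt]
  simp only [hD]
  rw [zero_add] at h1
  refine h1.congr fun ξ => ?_
  rw [← map_add, sub_add_cancel]

/-- The Weyl relation. -/
theorem displacement_comp (α β : ℂ) : displacement α ∘L displacement β =
    Complex.exp ((α * (starRingEnd ℂ) β - (starRingEnd ℂ) α * β) / 2) •
      displacement (α + β) := by
  ext1 ψ
  refine Lp.ext ?_
  have h2 := (measurePreserving_sub_right (volume : Measure ℝ)
    (√2 * α.re)).quasiMeasurePreserving.ae_eq_comp (displacement_ae β ψ)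
  filter_upwards [displacement_ae α (displacement β ψ), h2, displacement_ae (α + β) ψ,
    Lp.coeFn_smul (Complex.exp ((α * (starRingEnd ℂ) β - (starRingEnd ℂ) α * β) / 2))
      (displacement (α + β) ψ)] with x h1 h2 h3 h4
  simp only [Function.comp_apply] at h2
  rw [ContinuousLinearMap.comp_apply, h1, h2, smul_apply, h4, Pi.smul_apply,
    h3, smul_eq_mul, ← mul_assoc, ← mul_assoc, ← Complex.exp_add, ← Complex.exp_add]
  have h5 : x - √2 * α.re - √2 * β.re = x - √2 * (α + β).re := by rw [Complex.add_re]; ring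
  rw [h5]
  congr 2
  have h6 : ((√2 : ℝ) : ℂ) * ((√2 : ℝ) : ℂ) = 2 := by
    rw [← Complex.ofReal_mul, Real.mul_self_sqrt (by norm_num)]; norm_num
  have h7 : (α * (starRingEnd ℂ) β - (starRingEnd ℂ) α * β) / 2 =
      Complex.I * ((α.im * β.re - α.re * β.im : ℝ) : ℂ) := by
    apply Complex.ext <;> simp <;> ring
  rw [h7]
  push_cast [Complex.add_re, Complex.add_im]
  linear_combination (-Complex.I * β.im * α.re) * h6

theorem displacement_zero : displacement 0 = .id ℂ Mode := by
  ext1 ψ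
  refine Lp.ext ?_
  filter_upwards [displacement_ae 0 ψ] with x h
  rw [h]
  simp

theorem displacement_apply_displacement (α β : ℂ) (ψ : Mode) :
    displacement α (displacement β ψ) =
      Complex.exp ((α * (starRingEnd ℂ) β - (starRingEnd ℂ) α * β) / 2) •
        displacement (α + β) ψ :=
  congrArg (fun S : Mode →L[ℂ] Mode => S ψ) (displacement_comp α β)

theorem displacement_displacement_neg (ξ : ℂ) (ψ : Mode) :
    displacement ξ (displacement (-ξ) ψ) = ψ := by
  rw [displacement_apply_displacement]
  simp [displacement_zero, mul_comm]

theorem adjoint_displacement (ξ : ℂ) :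
    ContinuousLinearMap.adjoint (displacement ξ) = displacement (-ξ) := by
  ext1 ψ
  refine ext_inner_left ℂ fun φ => ?_
  rw [ContinuousLinearMap.adjoint_inner_right, ← inner_displacement ξ φ (displacement (-ξ) ψ),
    displacement_displacement_neg]

/-- The two Weyl phases agree and combine into the Fourier kernel. Hence shifting a state multiplies
its characteristic function by a character. -/
theorem displacement_conj (α ξ : ℂ) (ψ : Mode) :
    displacement (-α) (displacement ξ (displacement α ψ)) =
      fourierKernel ξ α • displacement ξ ψ := by
  rw [displacement_apply_displacement ξ α, map_smul, displacement_apply_displacement, smul_smul,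
    ← Complex.exp_add, neg_add_cancel_comm_assoc, fourierKernel]
  congr 2
  simp only [map_add, map_neg]
  ring

theorem norm_fourierKernel (α ξ : ℂ) : ‖fourierKernel α ξ‖ = 1 := by
  rw [fourierKernel, Complex.norm_exp]
  simp
  ring

theorem vacuum_ae : vacuum =ᵐ[volume] fun x : ℝ =>
    ((Real.pi ^ (-(1 / 4 : ℝ)) * Real.exp (-x ^ 2 / 2) : ℝ) : ℂ) := memLp_vacuum.coeFn_toLp

/-- After completion to a single quadratic exponent this is a one-dimensional complex Gaussian
integral. -/
theorem inner_vacuum_displacement_vacuum (ξ : ℂ) :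
    ⟪vacuum, displacement ξ vacuum⟫_ℂ = Real.exp (-‖ξ‖ ^ 2 / 2) := by
  have h1 : ⟪vacuum, displacement ξ vacuum⟫_ℂ = ∫ x : ℝ, ((Real.pi ^ (-(1 / 2 : ℝ)) : ℝ) : ℂ) *
      Complex.exp (-1 * x ^ 2 + (√2 * ξ) * x + (-ξ.re ^ 2 - Complex.I * ξ.re * ξ.im)) := by
    rw [L2.inner_def]
    refine integral_congr_ae ?_
    have h2 := (measurePreserving_sub_right (volume : Measure ℝ)
      (√2 * ξ.re)).quasiMeasurePreserving.ae_eq_comp vacuum_ae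
    filter_upwards [vacuum_ae, displacement_ae ξ vacuum, h2] with x h3 h4 h5
    simp only [Function.comp_apply] at h5
    rw [h3, h4, h5, RCLike.inner_apply, Complex.conj_ofReal]
    have h6 : (Real.pi ^ (-(1 / 2 : ℝ)) : ℝ) =
        Real.pi ^ (-(1 / 4 : ℝ)) * Real.pi ^ (-(1 / 4 : ℝ)) := by
      rw [← Real.rpow_add Real.pi_pos]
      norm_num
    rw [h6]
    have h7 : ((√2 : ℝ) : ℂ) * ((√2 : ℝ) : ℂ) = 2 := by
      rw [← Complex.ofReal_mul, Real.mul_self_sqrt (by norm_num)]; norm_num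
    have h8 : (-1 * x ^ 2 + (√2 * ξ) * x + (-ξ.re ^ 2 - Complex.I * ξ.re * ξ.im) : ℂ) =
        Complex.I * ((√2 * ξ.im * x - ξ.re * ξ.im : ℝ) : ℂ) +
        ((-(x - √2 * ξ.re) ^ 2 / 2 : ℝ) : ℂ) + ((-x ^ 2 / 2 : ℝ) : ℂ) := by
      nth_rewrite 1 [← Complex.re_add_im ξ]
      push_cast
      linear_combination (ξ.re ^ 2 / 2 : ℂ) * h7
    rw [h8, Complex.exp_add, Complex.exp_add]
    push_cast
    ring
  rw [h1, integral_const_mul, integral_cexp_quadratic (by norm_num)]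
  have h9 : (((Real.pi ^ (-(1 / 2 : ℝ)) : ℝ) : ℂ)) * (Real.pi / -(-1) : ℂ) ^ (1 / 2 : ℂ) = 1 := by
    have : (Real.pi / -(-1) : ℂ) = ((Real.pi : ℝ) : ℂ) := by norm_num
    rw [this, Complex.ofReal_cpow Real.pi_pos.le, ← Complex.cpow_add _ _ (by simp [Real.pi_ne_zero])]
    norm_num
  rw [← mul_assoc, h9, one_mul, Complex.ofReal_exp]
  congr 1
  have h7 : ((√2 : ℝ) : ℂ) * ((√2 : ℝ) : ℂ) = 2 := by
    rw [← Complex.ofReal_mul, Real.mul_self_sqrt (by norm_num)]; norm_num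
  have h10 : ‖ξ‖ ^ 2 = ξ.re ^ 2 + ξ.im ^ 2 := by
    rw [← Complex.normSq_eq_norm_sq, Complex.normSq_apply]; ring
  rw [h10]
  have h11 : ξ ^ 2 = ξ.re ^ 2 - ξ.im ^ 2 + 2 * Complex.I * ξ.re * ξ.im := by
    nth_rewrite 1 [← Complex.re_add_im ξ]
    linear_combination (ξ.im ^ 2 : ℂ) * Complex.I_sq
  push_cast
  linear_combination (ξ ^ 2 / 4) * h7 + (1 / 2 : ℂ) * h11

theorem norm_vacuum : ‖vacuum‖ = 1 := by
  have h := inner_vacuum_displacement_vacuum 0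
  rw [displacement_zero, ContinuousLinearMap.id_apply, inner_self_eq_norm_sq_to_K] at h
  have h2 : ‖vacuum‖ ^ 2 = 1 := by
    have := congrArg Complex.re h
    simpa [← Complex.ofReal_pow] using this
  nlinarith [norm_nonneg vacuum]

end Displacement

/-! ### The filtering map: channel property, characteristic function, trace distance. -/

section Filter

variable {ρ T : Mode →L[ℂ] Mode} {ι : Type*} {w v : ι → Mode} {p : ℂ → ℝ}

theorem HasRankOneSum.conj_displacement (h : HasRankOneSum w v T) (α : ℂ) :
    HasRankOneSum (fun k => displacement α (w k)) (fun k => displacement α (v k))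
      (displacement α ∘L T ∘L ContinuousLinearMap.adjoint (displacement α)) := by
  simpa using (h.comp_right (ContinuousLinearMap.adjoint (displacement α))).comp_left
    (displacement α)

theorem continuous_rankOne_apply {X H : Type*} [TopologicalSpace X] [NormedAddCommGroup H]
    [InnerProductSpace ℂ H] {f g : X → H} (hf : Continuous f) (hg : Continuous g) :
    Continuous fun x => InnerProductSpace.rankOne ℂ (f x) (g x) := by
  simp only [InnerProductSpace.rankOne_def]
  fun_prop

/-- Displacements are only strongly continuous, but on a rank-one operator that gives norm
continuity, and the rank-one expansion converges uniformly in `α`. This provides the measurability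
of the filtering integrand. -/
theorem continuous_conj_displacement (hT : IsTraceClass T) : Continuous fun α =>
    displacement α ∘L T ∘L ContinuousLinearMap.adjoint (displacement α) := by
  obtain ⟨w, v, h, -⟩ := hT.exists_hasRankOneSum
  have h1 := fun α => (h.conj_displacement α).hasSum_rankOne.tsum_eq
  simp only [← h1]
  refine continuous_tsum (fun k => continuous_rankOne_apply (continuous_displacement _)
    (continuous_displacement _)) h.summable_norm_mul_norm fun k α => ?_
  rw [InnerProductSpace.norm_rankOne, norm_displacement, norm_displacement]

theorem traceNormLE_conj_displacement (h : HasRankOneSum w v T) (α : ℂ) :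
    TraceNormLE (displacement α ∘L T ∘L ContinuousLinearMap.adjoint (displacement α))
      (∑' k, ‖w k‖ * ‖v k‖) := by
  simpa [norm_displacement] using (h.conj_displacement α).traceNormLE

theorem norm_conj_displacement_le (T : Mode →L[ℂ] Mode) (α : ℂ) :
    ‖displacement α ∘L T ∘L ContinuousLinearMap.adjoint (displacement α)‖ ≤ ‖T‖ := by
  refine ContinuousLinearMap.opNorm_le_bound _ (norm_nonneg _) fun x => ?_
  rw [ContinuousLinearMap.comp_apply, norm_displacement, ContinuousLinearMap.comp_apply,
    adjoint_displacement]
  refine (T.le_opNorm _).trans_eq ?_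
  rw [norm_displacement]

theorem integrable_conj_displacement (hp : Integrable p) (hT : IsTraceClass T) :
    Integrable fun α => p α •
      (displacement α ∘L T ∘L ContinuousLinearMap.adjoint (displacement α)) := by
  refine (hp.norm.mul_const ‖T‖).mono'
    (hp.1.smul (continuous_conj_displacement hT).aestronglyMeasurable)
    (Eventually.of_forall fun α => ?_)
  rw [norm_smul]
  exact mul_le_mul_of_nonneg_left (norm_conj_displacement_le T α) (norm_nonneg _)

theorem TraceNormLE.real_smul {H : Type*} [NormedAddCommGroup H] [InnerProductSpace ℂ H]
    [CompleteSpace H] {T : H →L[ℂ] H} {c : ℝ} (h : TraceNormLE T c) (a : ℝ) :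
    TraceNormLE (a • T) (|a| * c) := by
  simpa [Complex.coe_smul] using h.smul (a : ℂ)

theorem inner_real_smul_right {H : Type*} [NormedAddCommGroup H] [InnerProductSpace ℂ H]
    (a : ℝ) (x y : H) : ⟪x, a • y⟫_ℂ = a * ⟪x, y⟫_ℂ := by
  rw [← Complex.coe_smul, inner_smul_right]

theorem opTrace_real_smul {H : Type*} [NormedAddCommGroup H] [InnerProductSpace ℂ H]
    [CompleteSpace H] (a : ℝ) (T : H →L[ℂ] H) : opTrace (a • T) = a * opTrace T := by
  rw [opTrace, opTrace, ← tsum_mul_left]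
  refine tsum_congr fun i => ?_
  exact inner_real_smul_right _ _ _

theorem opTrace_real_smul_mode (a : ℝ) (T : Mode →L[ℂ] Mode) :
    opTrace (a • T) = a * opTrace T :=
  opTrace_real_smul a T

theorem opTrace_conj_displacement (hT : IsTraceClass T) (α : ℂ) :
    opTrace (displacement α ∘L T ∘L ContinuousLinearMap.adjoint (displacement α)) =
      opTrace T := by
  obtain ⟨w, v, h, -⟩ := hT.exists_hasRankOneSum
  rw [h.opTrace_eq, (h.conj_displacement α).opTrace_eq]
  simp only [inner_displacement]

theorem traceNormLE_filterMap (hp : Integrable p) (h : HasRankOneSum w v T) :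
    TraceNormLE (filterMap p T) (∫ α, |p α| * ∑' k, ‖w k‖ * ‖v k‖) :=
  .integral (integrable_conj_displacement hp h.isTraceClass) (hp.abs.mul_const _)
    fun α => (traceNormLE_conj_displacement h α).real_smul (p α)

theorem inner_filterMap_apply (hp : Integrable p) (hT : IsTraceClass T) (x y : Mode) :
    ⟪x, filterMap p T y⟫_ℂ = ∫ α, ⟪x, (p α •
      (displacement α ∘L T ∘L ContinuousLinearMap.adjoint (displacement α))) y⟫_ℂ :=
  inner_integral_apply (integrable_conj_displacement hp hT) x y

theorem isChannel_filterMap {Ω : ℂ → ℂ} (hΩ : IsPhysicalFilter Ω p) :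
    IsChannel (filterMap p) where
  map_traceClass T hT := by
    obtain ⟨w, v, h, -⟩ := hT.exists_hasRankOneSum
    exact (traceNormLE_filterMap hΩ.integrable h).isTraceClass
  map_add S T hS hT := by
    rw [filterMap, filterMap, filterMap,
      ← integral_add (integrable_conj_displacement hΩ.integrable hS)
        (integrable_conj_displacement hΩ.integrable hT)]
    simp only [ContinuousLinearMap.add_comp, ContinuousLinearMap.comp_add, smul_add]
  map_smul c T _ := by
    rw [filterMap, filterMap, ← integral_smul]
    refine integral_congr_ae (Eventually.of_forall fun α => ?_)
    simp only [ContinuousLinearMap.smul_comp, ContinuousLinearMap.comp_smul]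
    exact smul_comm _ _ _
  completelyPositive n X hX hpos v := by
    have hint := fun j k => integrable_inner_apply
      (integrable_conj_displacement hΩ.integrable (hX j k)) (v j) (v k)
    -- Moving `D(α)` onto the vectors makes the block form an average, with weight `p`, of the form
    -- of `X` at `D(α)† v j`.
    have h1 : ∑ j, ∑ k, ⟪v j, filterMap p (X j k) (v k)⟫_ℂ = ∫ α, (p α : ℂ) *
        ∑ j, ∑ k, ⟪ContinuousLinearMap.adjoint (displacement α) (v j),
          X j k (ContinuousLinearMap.adjoint (displacement α) (v k))⟫_ℂ := by
      simp only [inner_filterMap_apply hΩ.integrable (hX _ _)]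
      simp only [← integral_finsetSum _ fun k _ => hint _ k]
      rw [← integral_finsetSum _ fun j _ => integrable_finsetSum _ fun k _ => hint j k]
      refine integral_congr_ae (Eventually.of_forall fun α => ?_)
      simp only [Finset.mul_sum]
      refine Finset.sum_congr rfl fun j _ => Finset.sum_congr rfl fun k _ => ?_
      rw [ContinuousLinearMap.adjoint_inner_left]
      exact inner_real_smul_right _ _ _
    have h2 : ∀ α, (p α : ℂ) *
        ∑ j, ∑ k, ⟪ContinuousLinearMap.adjoint (displacement α) (v j),
          X j k (ContinuousLinearMap.adjoint (displacement α) (v k))⟫_ℂ =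
        ((p α * (∑ j, ∑ k, ⟪ContinuousLinearMap.adjoint (displacement α) (v j),
          X j k (ContinuousLinearMap.adjoint (displacement α) (v k))⟫_ℂ).re : ℝ) : ℂ) := by
      intro α
      have h3 := (hpos fun j => ContinuousLinearMap.adjoint (displacement α) (v j)).1
      apply Complex.ext
      · simp
      · simp [h3]
    rw [h1]
    simp only [h2]
    rw [integral_complex_ofReal]
    refine ⟨Complex.ofReal_im _, ?_⟩
    exact integral_nonneg fun α => mul_nonneg (hΩ.nonneg α) (hpos _).2
  trace_map T hT := by
    obtain ⟨w, v, h, -⟩ := hT.exists_hasRankOneSum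
    refine (opTrace_integral (integrable_conj_displacement hΩ.integrable h.isTraceClass)
      (hΩ.integrable.abs.mul_const _)
      (fun α => (traceNormLE_conj_displacement h α).real_smul (p α))).trans ?_
    simp only [opTrace_real_smul_mode, opTrace_conj_displacement hT]
    rw [integral_mul_const, integral_complex_ofReal, hΩ.integral_eq_one, Complex.ofReal_one, one_mul]

theorem isDensityOperator_filterMap {Ω : ℂ → ℂ} (hΩ : IsPhysicalFilter Ω p)
    (hρ : IsDensityOperator ρ) : IsDensityOperator (filterMap p ρ) := by
  have h := isChannel_filterMap hΩ
  refine ⟨?_, h.map_traceClass ρ hρ.isTraceClass, ?_⟩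
  · rw [← ContinuousLinearMap.nonneg_iff_isPositive]
    exact isPositiveBlock_one.1 (h.completelyPositive 1 (fun _ _ => ρ)
      (fun _ _ => hρ.isTraceClass)
      (isPositiveBlock_one.2 ((ContinuousLinearMap.nonneg_iff_isPositive _).2 hρ.isPositive)))
  · rw [h.trace_map ρ hρ.isTraceClass, hρ.trace_eq_one]

theorem HasRankOneSum.charFn_eq (h : HasRankOneSum w v ρ) (ξ : ℂ) :
    charFn ρ ξ = ∑' k, ⟪v k, displacement ξ (w k)⟫_ℂ := by
  rw [charFn, (h.comp_right (displacement ξ)).opTrace_eq]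
  simp only [ContinuousLinearMap.adjoint_inner_left]

theorem IsTraceClass.continuous_charFn (hρ : IsTraceClass ρ) : Continuous (charFn ρ) := by
  obtain ⟨w, v, h, -⟩ := hρ.exists_hasRankOneSum
  have : charFn ρ = fun ξ => ∑' k, ⟪v k, displacement ξ (w k)⟫_ℂ := funext h.charFn_eq
  rw [this]
  refine continuous_tsum (fun k => continuous_const.inner (continuous_displacement _))
    h.summable_norm_mul_norm fun k ξ => ?_
  refine (norm_inner_le_norm _ _).trans_eq ?_
  rw [norm_displacement, mul_comm]

theorem HasRankOneSum.norm_charFn_le (h : HasRankOneSum w v ρ) (ξ : ℂ) :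
    ‖charFn ρ ξ‖ ≤ ∑' k, ‖w k‖ * ‖v k‖ := by
  rw [h.charFn_eq]
  refine tsum_of_norm_bounded h.summable_norm_mul_norm.hasSum fun k => ?_
  refine (norm_inner_le_norm _ _).trans_eq ?_
  rw [norm_displacement, mul_comm]

theorem charFn_zero (ρ : Mode →L[ℂ] Mode) : charFn ρ 0 = opTrace ρ := by
  rw [charFn, displacement_zero, ContinuousLinearMap.comp_id]

theorem IsDensityOperator.nonneg (hρ : IsDensityOperator ρ) : 0 ≤ ρ :=
  (ContinuousLinearMap.nonneg_iff_isPositive _).2 hρ.isPositive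

theorem IsDensityOperator.exists_hasRankOneSum (hρ : IsDensityOperator ρ) :
    ∃ v : basisIndex Mode → Mode, HasRankOneSum v v ρ ∧ HasSum (fun k => ‖v k‖ ^ 2) 1 := by
  refine ⟨_, hasRankOneSum_sqrt hρ.nonneg hρ.isTraceClass.summable, ?_⟩
  simpa [hρ.trace_eq_one] using hasSum_norm_sqrt hρ.nonneg hρ.isTraceClass.summable

theorem IsDensityOperator.norm_charFn_le_one (hρ : IsDensityOperator ρ) (ξ : ℂ) :
    ‖charFn ρ ξ‖ ≤ 1 := by
  obtain ⟨v, h, hs⟩ := hρ.exists_hasRankOneSum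
  refine (h.norm_charFn_le ξ).trans_eq ?_
  simp only [← pow_two, hs.tsum_eq]

theorem charFn_conj_displacement (hρ : IsTraceClass ρ) (α ξ : ℂ) :
    charFn (displacement α ∘L ρ ∘L ContinuousLinearMap.adjoint (displacement α)) ξ =
      charFn ρ ξ * fourierKernel ξ α := by
  obtain ⟨w, v, h, -⟩ := hρ.exists_hasRankOneSum
  rw [(h.conj_displacement α).charFn_eq, h.charFn_eq, ← tsum_mul_right]
  refine tsum_congr fun k => ?_
  rw [← ContinuousLinearMap.adjoint_inner_right, adjoint_displacement, displacement_conj,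
    inner_smul_right, mul_comm]

/-- The characteristic function of an operator-valued integral. -/
theorem charFn_integral {X : Type*} [MeasurableSpace X] {m : Measure X}
    {f : X → Mode →L[ℂ] Mode} {g : X → ℝ} (hf : Integrable f m) (hg : Integrable g m)
    (h : ∀ t, TraceNormLE (f t) (g t)) (ξ : ℂ) :
    charFn (∫ t, f t ∂m) ξ = ∫ t, charFn (f t) ξ ∂m := by
  let L : (Mode →L[ℂ] Mode) →L[ℂ] (Mode →L[ℂ] Mode) :=
    (ContinuousLinearMap.compL ℂ Mode Mode Mode).flip (displacement ξ)
  have h1 : (∫ t, f t ∂m) ∘L displacement ξ = ∫ t, f t ∘L displacement ξ ∂m :=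
    (L.integral_comp_comm hf).symm
  rw [charFn, h1]
  refine opTrace_integral (L.integrable_comp hf) hg fun t => ?_
  obtain ⟨w, v, hwv, hc⟩ := (h t).isTraceClass.exists_hasRankOneSum
  refine (hwv.comp_right (displacement ξ)).traceNormLE.mono ?_
  simp only [adjoint_displacement, norm_displacement]
  exact hc.trans (h t).trace_abs_le

theorem charFn_real_smul (a : ℝ) (T : Mode →L[ℂ] Mode) (ξ : ℂ) :
    charFn (a • T) ξ = a * charFn T ξ := by
  rw [charFn, ContinuousLinearMap.smul_comp, opTrace_real_smul_mode, charFn]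

theorem charFn_filterMap {Ω : ℂ → ℂ} (hΩ : IsPhysicalFilter Ω p) (hρ : IsTraceClass ρ) (ξ : ℂ) :
    charFn (filterMap p ρ) ξ = charFn ρ ξ * Ω ξ := by
  obtain ⟨w, v, h, -⟩ := hρ.exists_hasRankOneSum
  rw [filterMap, charFn_integral (integrable_conj_displacement hΩ.integrable hρ)
      (hΩ.integrable.abs.mul_const _)
      (fun α => (traceNormLE_conj_displacement h α).real_smul (p α)), hΩ.eq_fourier,
      ← integral_const_mul]
  refine integral_congr_ae (Eventually.of_forall fun α => ?_)
  simp only [charFn_real_smul, charFn_conj_displacement hρ]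
  ring

theorem exists_hasRankOneSum_of_summable {H ι : Type*} [NormedAddCommGroup H]
    [InnerProductSpace ℂ H] [CompleteSpace H] {w v : ι → H} (hw : Summable fun k => ‖w k‖ ^ 2)
    (hv : Summable fun k => ‖v k‖ ^ 2) : ∃ T, HasRankOneSum w v T := by
  have hs : Summable fun k => InnerProductSpace.rankOne ℂ (w k) (v k) := by
    refine .of_norm (.of_nonneg_of_le (fun _ => norm_nonneg _) (fun k => ?_) (hw.add hv))
    rw [InnerProductSpace.norm_rankOne]
    nlinarith [sq_nonneg (‖w k‖ - ‖v k‖), sq_nonneg (‖w k‖), sq_nonneg (‖v k‖)]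
  exact ⟨_, .of_hasSum_rankOne hw hv hs.hasSum⟩

theorem tsum_mul_le_sqrt_mul_sqrt {ι : Type*} {a b : ι → ℝ} {A B : ℝ} (ha : ∀ k, 0 ≤ a k)
    (hb : ∀ k, 0 ≤ b k) (hA : HasSum (fun k => a k ^ 2) A) (hB : HasSum (fun k => b k ^ 2) B) :
    ∑' k, a k * b k ≤ √A * √B := by
  refine Real.tsum_le_of_sum_le (fun k => mul_nonneg (ha k) (hb k)) fun s => ?_
  refine (Real.sum_mul_le_sqrt_mul_sqrt s a b).trans ?_
  exact mul_le_mul (Real.sqrt_le_sqrt (sum_le_hasSum s (fun _ _ => sq_nonneg _) hA))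
    (Real.sqrt_le_sqrt (sum_le_hasSum s (fun _ _ => sq_nonneg _) hB)) (Real.sqrt_nonneg _)
    (Real.sqrt_nonneg _)

/-- The trace norm of a difference of two states with purifications of overlap `r`. -/
theorem traceNormLE_sub_of_overlap {H ι : Type*} [NormedAddCommGroup H] [InnerProductSpace ℂ H]
    [CompleteSpace H] {v u : ι → H} {S T : H →L[ℂ] H} (hT : HasRankOneSum v v T)
    (hS : HasRankOneSum u u S) (hv : HasSum (fun k => ‖v k‖ ^ 2) 1)
    (hu : HasSum (fun k => ‖u k‖ ^ 2) 1) {r : ℝ} (hr : HasSum (fun k => (⟪v k, u k⟫_ℂ).re) r) :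
    TraceNormLE (T - S) (2 * √(1 - r ^ 2)) := by
  have hd : HasSum (fun k => ‖v k - u k‖ ^ 2) (2 * (1 - r)) := by
    convert! (hv.sub (hr.mul_left 2)).add hu using 1
    · exact funext fun k => @norm_sub_sq ℂ _ _ _ _ _ _
    · ring
  have hs : HasSum (fun k => ‖v k + u k‖ ^ 2) (2 * (1 + r)) := by
    convert! (hv.add (hr.mul_left 2)).add hu using 1
    · exact funext fun k => @norm_add_sq ℂ _ _ _ _ _ _
    · ring
  obtain ⟨A, hA⟩ := exists_hasRankOneSum_of_summable hd.summable hs.summable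
  obtain ⟨B, hB⟩ := exists_hasRankOneSum_of_summable hs.summable hd.summable
  -- Polarisation: `|v⟩⟨v| - |u⟩⟨u|` is half of `|v - u⟩⟨v + u| + |v + u⟩⟨v - u|`. The squared norms
  -- sum to `2 (1 - r)` and `2 (1 + r)`, and Cauchy–Schwarz gives `2 √(1 - r²)` for each term.
  have hAB : T - S = (1 / 2 : ℝ) • (A + B) := by
    ext y
    refine ext_inner_left ℂ fun x => ?_
    have h1 := ((hA.hasSum_inner x y).add (hB.hasSum_inner x y)).mul_left (1 / 2 : ℂ)
    have h2 := (hT.hasSum_inner x y).sub (hS.hasSum_inner x y)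
    rw [smul_apply, ← Complex.coe_smul, inner_smul_right, sub_apply, add_apply,
      inner_sub_right, inner_add_right]
    push_cast
    refine h2.unique (h1.congr_fun fun k => ?_)
    simp only [inner_sub_left, inner_add_left, inner_sub_right, inner_add_right]
    ring
  have h0 : ∀ {a b : ι → H}, HasSum (fun k => ‖a k‖ ^ 2) (2 * (1 - r)) →
      HasSum (fun k => ‖b k‖ ^ 2) (2 * (1 + r)) → ∑' k, ‖a k‖ * ‖b k‖ ≤ 2 * √(1 - r ^ 2) := by
    intro a b ha hb
    refine (tsum_mul_le_sqrt_mul_sqrt (fun _ => norm_nonneg _) (fun _ => norm_nonneg _)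
      ha hb).trans_eq ?_
    have h1 : 0 ≤ 2 * (1 - r) := ha.nonneg fun _ => sq_nonneg _
    rw [← Real.sqrt_mul h1, show 2 * (1 - r) * (2 * (1 + r)) = 2 ^ 2 * (1 - r ^ 2) by ring,
      Real.sqrt_mul (by norm_num), Real.sqrt_sq (by norm_num)]
  rw [hAB]
  refine (((hA.traceNormLE.mono (h0 hd hs)).add (hB.traceNormLE.mono ?_)).real_smul _).mono
    (c := |(1 / 2 : ℝ)| * (2 * √(1 - r ^ 2) + 2 * √(1 - r ^ 2))) ?_
  · simp only [mul_comm ‖v _ + u _‖]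
    exact h0 hd hs
  · rw [abs_of_pos (by norm_num)]
    linarith

/-- The expanding vectors of the shifted state may be multiplied by a common phase without changing
the state. The phase is chosen to make the overlap `Φ_ρ(α)` real and nonnegative. -/
theorem traceNormLE_sub_conj_displacement (hρ : IsDensityOperator ρ) (α : ℂ) :
    TraceNormLE (ρ - displacement α ∘L ρ ∘L ContinuousLinearMap.adjoint (displacement α))
      (2 * √(1 - ‖charFn ρ α‖ ^ 2)) := by
  obtain ⟨v, h, hs⟩ := hρ.exists_hasRankOneSum
  obtain ⟨z, hz, hzΦ⟩ : ∃ z : ℂ, ‖z‖ = 1 ∧ z * charFn ρ α = ‖charFn ρ α‖ := by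
    obtain ⟨z, hz, h1⟩ := RCLike.exists_norm_eq_mul_self (charFn ρ α)
    exact ⟨z, hz, h1.symm⟩
  have hc := h.conj_displacement α
  have hzz : starRingEnd ℂ z * z = 1 := by
    rw [Complex.conj_mul', hz]; norm_num
  have hu : HasRankOneSum (fun k => z • displacement α (v k)) (fun k => z • displacement α (v k))
      (displacement α ∘L ρ ∘L ContinuousLinearMap.adjoint (displacement α)) := by
    refine ⟨?_, ?_, fun x y => (hc.hasSum_inner x y).congr_fun fun k => ?_⟩
    · simpa [norm_smul, hz] using hc.summable_left
    · simpa [norm_smul, hz] using hc.summable_left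
    · rw [inner_smul_right, inner_smul_left]
      linear_combination (⟪x, displacement α (v k)⟫_ℂ * ⟪displacement α (v k), y⟫_ℂ) * hzz
  refine traceNormLE_sub_of_overlap h hu hs ?_ ?_
  · simpa [norm_smul, hz, norm_displacement] using hs
  · have h1 : Summable fun k => ⟪v k, displacement α (v k)⟫_ℂ :=
      .of_norm (.of_nonneg_of_le (fun _ => norm_nonneg _) (fun k =>
        (norm_inner_le_norm _ _).trans_eq (by rw [norm_displacement, pow_two])) hs.summable)
    have h2 := Complex.hasSum_re (h1.hasSum.mul_left z)
    rw [← h.charFn_eq, hzΦ, Complex.ofReal_re] at h2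
    simpa only [inner_smul_right] using h2

/-- Jensen's inequality for the square root, from the tangent bound `√f ≤ f / (2 t) + t / 2`
optimised at `t = √X`. When `X = 0` the bound is used for arbitrarily small `t`. -/
theorem integral_mul_sqrt_le {X : Type*} [MeasurableSpace X] {m : Measure X} {p f : X → ℝ}
    (hp0 : ∀ x, 0 ≤ p x) (hp : Integrable p m) (hp1 : ∫ x, p x ∂m = 1) (hf0 : ∀ x, 0 ≤ f x)
    (hpf : Integrable (fun x => p x * f x) m) (hps : Integrable (fun x => p x * √(f x)) m) :
    ∫ x, p x * √(f x) ∂m ≤ √(∫ x, p x * f x ∂m) := by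
  set X := ∫ x, p x * f x ∂m
  have hX : 0 ≤ X := integral_nonneg fun x => mul_nonneg (hp0 x) (hf0 x)
  have key : ∀ t > 0, ∫ x, p x * √(f x) ∂m ≤ (X / t + t) / 2 := by
    intro t ht
    have h1 : (X / t + t) / 2 = ∫ x, (p x * f x) * (1 / (2 * t)) + p x * (t / 2) ∂m := by
      rw [integral_add (hpf.mul_const _) (hp.mul_const _), integral_mul_const, integral_mul_const,
        hp1]
      change (X / t + t) / 2 = X * _ + _
      field_simp
    rw [h1]
    refine integral_mono hps ((hpf.mul_const _).add (hp.mul_const _)) fun x => ?_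
    have h2 : √(f x) ≤ f x * (1 / (2 * t)) + t / 2 := by
      have h3 := Real.sq_sqrt (hf0 x)
      have h4 : f x * (1 / (2 * t)) + t / 2 - √(f x) = (√(f x) - t) ^ 2 / (2 * t) := by
        field_simp
        linear_combination -h3
      have : 0 ≤ (√(f x) - t) ^ 2 / (2 * t) := by positivity
      linarith
    have := mul_le_mul_of_nonneg_left h2 (hp0 x)
    simp only
    linarith
  rcases hX.eq_or_lt with h | h
  · rw [← h, Real.sqrt_zero]
    refine le_of_forall_pos_le_add fun ε hε => ?_
    have := key ε hε
    rw [← h] at this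
    simp at this
    linarith
  · refine (key √X (Real.sqrt_pos.2 h)).trans_eq ?_
    rw [Real.div_sqrt]
    ring

theorem integrable_mul_normSq_charFn (hp : Integrable p) (hρ : IsDensityOperator ρ) :
    Integrable fun α => p α * ‖charFn ρ α‖ ^ 2 := by
  have hc := hρ.isTraceClass.continuous_charFn
  refine hp.norm.mono' (hp.1.mul (by fun_prop : Continuous fun α => ‖charFn ρ α‖ ^ 2).aestronglyMeasurable)
    (Eventually.of_forall fun α => ?_)
  rw [norm_mul]
  refine mul_le_of_le_one_right (norm_nonneg _) ?_
  rw [norm_pow, norm_norm]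
  exact pow_le_one₀ (norm_nonneg _) (hρ.norm_charFn_le_one α)

theorem traceDist_filterMap_le {Ω : ℂ → ℂ} (hΩ : IsPhysicalFilter Ω p)
    (hρ : IsDensityOperator ρ) :
    traceDist ρ (filterMap p ρ) ≤ √(1 - ∫ α, p α * ‖charFn ρ α‖ ^ 2) := by
  have hc := hρ.isTraceClass.continuous_charFn
  have hi := hΩ.integrable
  have hf0 : ∀ α, 0 ≤ 1 - ‖charFn ρ α‖ ^ 2 := fun α =>
    sub_nonneg.2 (pow_le_one₀ (norm_nonneg _) (hρ.norm_charFn_le_one α))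
  have hps : Integrable fun α => p α * √(1 - ‖charFn ρ α‖ ^ 2) := by
    refine hi.norm.mono' (hi.1.mul
      (by fun_prop : Continuous fun α => √(1 - ‖charFn ρ α‖ ^ 2)).aestronglyMeasurable)
      (Eventually.of_forall fun α => ?_)
    rw [norm_mul]
    refine mul_le_of_le_one_right (norm_nonneg _) ?_
    rw [Real.norm_eq_abs, abs_of_nonneg (Real.sqrt_nonneg _), Real.sqrt_le_one]
    linarith [sq_nonneg ‖charFn ρ α‖]
  have h1 : ρ - filterMap p ρ = ∫ α, p α • (ρ -
      displacement α ∘L ρ ∘L ContinuousLinearMap.adjoint (displacement α)) := by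
    simp only [smul_sub]
    rw [integral_sub (hi.smul_const _) (integrable_conj_displacement hi hρ.isTraceClass),
      integral_smul_const, hΩ.integral_eq_one, one_smul]
    rfl
  have hint : Integrable fun α => p α • (ρ -
      displacement α ∘L ρ ∘L ContinuousLinearMap.adjoint (displacement α)) := by
    simp only [smul_sub]
    exact (hi.smul_const _).sub (integrable_conj_displacement hi hρ.isTraceClass)
  have h2 : TraceNormLE (ρ - filterMap p ρ) (∫ α, (p α * √(1 - ‖charFn ρ α‖ ^ 2)) * 2) := by
    rw [h1]
    refine .integral hint (hps.mul_const 2) fun α => ?_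
    refine ((traceNormLE_sub_conj_displacement hρ α).real_smul (p α)).mono (le_of_eq ?_)
    rw [abs_of_nonneg (hΩ.nonneg α)]
    ring
  have h3 := h2.trace_abs_le
  rw [integral_mul_const] at h3
  have h4 : ∫ α, p α * (1 - ‖charFn ρ α‖ ^ 2) = 1 - ∫ α, p α * ‖charFn ρ α‖ ^ 2 := by
    simp only [mul_sub, mul_one]
    rw [integral_sub hi (integrable_mul_normSq_charFn hi hρ), hΩ.integral_eq_one]
  have h5 := integral_mul_sqrt_le hΩ.nonneg hi hΩ.integral_eq_one hf0
    (by simp only [mul_sub, mul_one]; exact hi.sub (integrable_mul_normSq_charFn hi hρ)) hps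
  rw [h4] at h5
  rw [traceDist]
  linarith

end Filter

/-! ### Hilbert space tensor products and purifications. -/

section Tensor

variable {H : Type*} [NormedAddCommGroup H] [InnerProductSpace ℂ H]
variable {E : Type*} [NormedAddCommGroup E] [InnerProductSpace ℂ E]

theorem inner_prodVec (h h' : H) (e e' : E) :
    ⟪prodVec h e, prodVec h' e'⟫_ℂ = ⟪h, h'⟫_ℂ * ⟪e, e'⟫_ℂ := by
  rw [prodVec, prodVec, UniformSpace.Completion.inner_coe, TensorProduct.inner_tmul]

theorem norm_prodVec (h : H) (e : E) : ‖prodVec h e‖ = ‖h‖ * ‖e‖ := by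
  rw [prodVec, UniformSpace.Completion.norm_coe, TensorProduct.norm_tmul]

theorem prodVec_add_left (h h' : H) (e : E) :
    prodVec (h + h') e = prodVec h e + prodVec h' e := by
  rw [prodVec, TensorProduct.add_tmul, UniformSpace.Completion.coe_add]; rfl

theorem prodVec_smul_left (c : ℂ) (h : H) (e : E) : prodVec (c • h) e = c • prodVec h e := by
  simp [prodVec, ← TensorProduct.smul_tmul']

theorem prodVec_add_right (h : H) (e e' : E) :
    prodVec h (e + e') = prodVec h e + prodVec h e' := by
  rw [prodVec, TensorProduct.tmul_add, UniformSpace.Completion.coe_add]; rfl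

theorem prodVec_smul_right (c : ℂ) (h : H) (e : E) : prodVec h (c • e) = c • prodVec h e := by
  simp [prodVec]

/-- `e ↦ h ⊗ e`. -/
noncomputable def prodVecRight (h : H) : E →L[ℂ] HilbertTensor H E :=
  LinearMap.mkContinuous
    { toFun := fun e => prodVec h e
      map_add' := prodVec_add_right h
      map_smul' := fun c e => prodVec_smul_right c h e } ‖h‖ fun e => (norm_prodVec h e).le

variable [CompleteSpace E]

/-- `h ↦ h ⊗ eⱼ`. -/
noncomputable def prodVecBasis (H : Type*) [NormedAddCommGroup H] [InnerProductSpace ℂ H] 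
    (j : basisIndex E) : H →ₗᵢ[ℂ] HilbertTensor H E where
  toFun h := prodVec h (stdBasis E j)
  map_add' h h' := prodVec_add_left h h' _
  map_smul' c h := prodVec_smul_left c h _
  norm_map' h := (norm_prodVec h _).trans (by rw [(stdBasis E).orthonormal.norm_eq_one, mul_one])

theorem orthogonalFamily_prodVecBasis :
    OrthogonalFamily ℂ (fun _ : basisIndex E => H) (prodVecBasis H) := by
  intro i j hij x y
  refine (inner_prodVec x y _ _).trans ?_
  rw [(stdBasis E).orthonormal.inner_eq_zero hij, mul_zero]

theorem inner_prodVecBasis_hasSum {m : basisIndex E → H} {ν : HilbertTensor H E}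
    (h : HasSum (fun j => prodVecBasis H j (m j)) ν) (x : H) (j : basisIndex E) :
    ⟪prodVec x (stdBasis E j), ν⟫_ℂ = ⟪x, m j⟫_ℂ := by
  have h1 := h.mapL (innerSL ℂ (prodVec x (stdBasis E j)))
  refine h1.unique ?_
  convert! hasSum_single j fun i hi => ?_
  · exact ((inner_prodVec _ _ _ _).trans (by
      rw [inner_self_eq_norm_sq_to_K, (stdBasis E).orthonormal.norm_eq_one]; simp)).symm
  · refine (inner_prodVec _ _ _ _).trans ?_
    rw [(stdBasis E).orthonormal.inner_eq_zero hi.symm, mul_zero]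

variable [CompleteSpace H]

/-- Expanding the second factor in the basis puts every product vector in the closed span of the
spaces `H ⊗ eⱼ`, and product vectors generate. This gives every vector coordinates `m j` in `H`. -/
theorem isHilbertSum_prodVecBasis :
    IsHilbertSum ℂ (fun _ : basisIndex E => H) (prodVecBasis H) := by
  refine .mk orthogonalFamily_prodVecBasis fun μ h => ?_
  clear h
  set M := (⨆ j, LinearMap.range (prodVecBasis (E := E) H j).toLinearMap).topologicalClosure
  have hM : IsClosed (M : Set (HilbertTensor H E)) := Submodule.isClosed_topologicalClosure _
  have hpure : ∀ (h : H) (e : E), prodVec h e ∈ M := by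
    intro h e
    have h1 := ((stdBasis E).hasSum_repr e).mapL (prodVecRight h)
    refine hM.mem_of_tendsto h1 (Eventually.of_forall fun s => M.sum_mem fun j _ => ?_)
    rw [map_smul]
    exact M.smul_mem _ (Submodule.le_topologicalClosure _
      (Submodule.mem_iSup_of_mem j ⟨h, rfl⟩))
  induction μ using UniformSpace.Completion.induction_on with
  | hp => exact hM
  | ih z =>
    induction z using TensorProduct.induction_on with
    | zero => rw [UniformSpace.Completion.coe_zero]; exact M.zero_mem
    | tmul h e => exact hpure h e
    | add x y hx hy => rw [UniformSpace.Completion.coe_add]; exact M.add_mem hx hy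

theorem exists_hasSum_prodVecBasis (μ : HilbertTensor H E) : ∃ m : basisIndex E → H,
    Summable (fun j => ‖m j‖ ^ 2) ∧ HasSum (fun j => prodVecBasis H j (m j)) μ := by
  have hV := isHilbertSum_prodVecBasis (H := H) (E := E)
  have h1 := hV.hasSum_linearIsometryEquiv_symm (hV.linearIsometryEquiv μ)
  rw [LinearIsometryEquiv.symm_apply_apply] at h1
  exact ⟨_, (orthogonalFamily_prodVecBasis.summable_iff_norm_sq_summable _).1 h1.summable, h1⟩

theorem hasSum_inner_purification {A : H →L[ℂ] H} (hA : 0 ≤ A) (h : IsTraceClass A) (x y : H) :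
    HasSum (fun j => ⟪prodVec x (stdBasis H j), purification A⟫_ℂ *
      ⟪purification A, prodVec y (stdBasis H j)⟫_ℂ) ⟪x, A y⟫_ℂ := by
  have hr := hasRankOneSum_sqrt hA h.summable
  have hsum : HasSum (fun j => prodVecBasis (E := H) H j (CFC.sqrt A (stdBasis H j)))
      (purification A) :=
    ((orthogonalFamily_prodVecBasis.summable_iff_norm_sq_summable _).2 hr.summable_left).hasSum
  refine (hr.hasSum_inner x y).congr_fun fun j => ?_
  rw [inner_prodVecBasis_hasSum hsum, ← inner_conj_symm (purification A),
    inner_prodVecBasis_hasSum hsum, inner_conj_symm]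

end Tensor

/-! ### Entanglement fidelity as an average of the squared characteristic function. -/

section Fidelity

variable {ρ : Mode →L[ℂ] Mode} {p : ℂ → ℝ}
variable {E : Type*} [NormedAddCommGroup E] [InnerProductSpace ℂ E]

theorem norm_displacementTensor_le (α : ℂ) (μ : HilbertTensor Mode E) :
    ‖displacementTensor E α μ‖ ≤ ‖μ‖ := by
  induction μ using UniformSpace.Completion.induction_on with
  | hp => exact isClosed_le (by fun_prop) (by fun_prop)
  | ih z =>
    rw [displacementTensor, ContinuousLinearMap.completion_apply_coe,
      UniformSpace.Completion.norm_coe, UniformSpace.Completion.norm_coe]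
    exact (((displacementIso α).rTensor E).norm_map z).le

variable [CompleteSpace E]

theorem hasSum_displacementTensor {m : basisIndex E → Mode} {μ : HilbertTensor Mode E}
    (h : HasSum (fun j => prodVecBasis Mode j (m j)) μ) (α : ℂ) :
    HasSum (fun j => prodVecBasis Mode j (displacement α (m j))) (displacementTensor E α μ) :=
  (h.mapL (displacementTensor E α)).congr_fun fun j =>
    (displacementTensor_prodVec α (m j) (stdBasis E j)).symm

/-- Finite partial sums of the coordinate expansion are continuous in `α`, and they approximate
uniformly because `D(α) ⊗ I` does not increase norms. -/
theorem continuous_displacementTensor (μ : HilbertTensor Mode E) :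
    Continuous fun α => displacementTensor E α μ := by
  obtain ⟨m, -, hμ⟩ := exists_hasSum_prodVecBasis μ
  refine continuous_of_uniform_approx_of_continuous fun u hu => ?_
  obtain ⟨ε, hε, hu⟩ := Metric.mem_uniformity_dist.1 hu
  obtain ⟨s, hs⟩ := (Metric.tendsto_nhds.1 hμ ε hε).exists
  refine ⟨fun α => ∑ j ∈ s, prodVecBasis Mode j (displacement α (m j)),
    continuous_finsetSum _ fun j _ => (prodVecBasis Mode j).continuous.comp
      (continuous_displacement _), fun α => hu ?_⟩
  have h1 : ∑ j ∈ s, prodVecBasis (E := E) Mode j (displacement α (m j)) =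
      displacementTensor E α (∑ j ∈ s, prodVecBasis Mode j (m j)) := by
    rw [map_sum]
    exact Finset.sum_congr rfl fun j _ =>
      (displacementTensor_prodVec α (m j) (stdBasis E j)).symm
  simp only [h1]
  rw [dist_comm, dist_eq_norm, ← map_sub]
  refine (norm_displacementTensor_le _ _).trans_lt ?_
  rwa [← dist_eq_norm]

/-- The coordinates of a purifying vector are a rank-one expansion of the state; all independence of
the purification comes from here. -/
theorem IsPurification.hasRankOneSum {m : basisIndex E → Mode} {μ : HilbertTensor Mode E}
    (hm : Summable fun j => ‖m j‖ ^ 2) (h : HasSum (fun j => prodVecBasis Mode j (m j)) μ)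
    (hμ : IsPurification ρ μ) : HasRankOneSum m m ρ := by
  refine ⟨hm, hm, fun x y => (hμ x y).congr_fun fun j => ?_⟩
  rw [inner_prodVecBasis_hasSum h, ← inner_conj_symm μ, inner_prodVecBasis_hasSum h,
    inner_conj_symm]

theorem IsPurification.inner_displacementTensor {μ : HilbertTensor Mode E}
    (hμ : IsPurification ρ μ) (α : ℂ) : ⟪μ, displacementTensor E α μ⟫_ℂ = charFn ρ α := by
  obtain ⟨m, hm, h⟩ := exists_hasSum_prodVecBasis μ
  rw [(hμ.hasRankOneSum hm h).charFn_eq]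
  have h1 := (h.mapL (innerSL ℂ (displacementTensor E α μ))).star
  simp only [innerSL_apply_apply, ← starRingEnd_apply, inner_conj_symm] at h1
  refine h1.tsum_eq.symm.trans (tsum_congr fun j => ?_)
  exact inner_prodVecBasis_hasSum (hasSum_displacementTensor h α) (m j) j

theorem IsPurification.purificationOverlap_eq {μ : HilbertTensor Mode E}
    (hμ : IsPurification ρ μ) (hp : Integrable p) :
    purificationOverlap p μ = ∫ α, p α * ‖charFn ρ α‖ ^ 2 := by
  have h1 : ∀ α, displacementTensor E α ∘L InnerProductSpace.rankOne ℂ μ μ ∘L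
      ContinuousLinearMap.adjoint (displacementTensor E α) =
      InnerProductSpace.rankOne ℂ (displacementTensor E α μ) (displacementTensor E α μ) := by
    intro α
    ext y
    simp [ContinuousLinearMap.adjoint_inner_right]
  have hint : Integrable fun α => p α • (displacementTensor E α ∘L
      InnerProductSpace.rankOne ℂ μ μ ∘L ContinuousLinearMap.adjoint (displacementTensor E α)) := by
    simp only [h1]
    refine (hp.norm.mul_const (‖μ‖ * ‖μ‖)).mono' (hp.1.smul (continuous_rankOne_apply
      (continuous_displacementTensor μ) (continuous_displacementTensor μ)).aestronglyMeasurable)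
      (Eventually.of_forall fun α => ?_)
    rw [norm_smul, InnerProductSpace.norm_rankOne]
    have := norm_displacementTensor_le α μ
    gcongr
  rw [purificationOverlap, filterMapTensor, inner_integral_apply hint]
  have h2 : ∀ α, ⟪μ, (p α • (displacementTensor E α ∘L
      InnerProductSpace.rankOne ℂ μ μ ∘L
      ContinuousLinearMap.adjoint (displacementTensor E α))) μ⟫_ℂ =
      ((p α * ‖charFn ρ α‖ ^ 2 : ℝ) : ℂ) := by
    intro α
    rw [h1]
    refine (inner_real_smul_right _ _ _).trans ?_
    refine (congrArg (_ * ·) (InnerProductSpace.inner_right_rankOne_apply _ _ _ _)).trans ?_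
    rw [← inner_conj_symm (displacementTensor E α μ), hμ.inner_displacementTensor,
      Complex.mul_conj']
    push_cast
    rfl
  simp only [h2]
  rw [integral_complex_ofReal, Complex.ofReal_re]

theorem isPurification_purification (hρ : IsDensityOperator ρ) :
    IsPurification ρ (purification ρ) :=
  hasSum_inner_purification hρ.nonneg hρ.isTraceClass

theorem entanglementFidelity_eq (hρ : IsDensityOperator ρ) (hp : Integrable p) :
    entanglementFidelity p ρ = ∫ α, p α * ‖charFn ρ α‖ ^ 2 :=
  (isPurification_purification hρ).purificationOverlap_eq hp

theorem entanglementFidelity_le_one {Ω : ℂ → ℂ} (hΩ : IsPhysicalFilter Ω p)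
    (hρ : IsDensityOperator ρ) : entanglementFidelity p ρ ≤ 1 := by
  rw [entanglementFidelity_eq hρ hΩ.integrable, ← hΩ.integral_eq_one]
  refine integral_mono (integrable_mul_normSq_charFn hΩ.integrable hρ) hΩ.integrable fun α => ?_
  exact mul_le_of_le_one_right (hΩ.nonneg α)
    (pow_le_one₀ (norm_nonneg _) (hρ.norm_charFn_le_one α))

end Fidelity

/-! ### Fourier analysis on the phase plane. -/

section FourierPlane

open FourierTransform

theorem fourierKernel_eq_exp (α ξ : ℂ) :
    fourierKernel α ξ = Complex.exp (2 * Complex.I * (⟪Complex.I * ξ, α⟫_ℝ : ℝ)) := by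
  rw [fourierKernel]
  congr 1
  rw [Complex.inner]
  apply Complex.ext <;> simp <;> ring

theorem fourierKernel_neg_left (α ξ : ℂ) : fourierKernel (-α) ξ = fourierKernel ξ α := by
  rw [fourierKernel, fourierKernel]
  congr 1
  simp
  ring

theorem fourierKernel_neg_right (α ξ : ℂ) : fourierKernel α (-ξ) = fourierKernel ξ α := by
  rw [fourierKernel, fourierKernel]
  congr 1
  simp
  ring

theorem conj_fourierKernel (α ξ : ℂ) :
    starRingEnd ℂ (fourierKernel α ξ) = fourierKernel ξ α := by
  rw [fourierKernel, fourierKernel, ← Complex.exp_conj]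
  congr 1
  simp
  ring

theorem fourierKernel_add_left (α β ξ : ℂ) :
    fourierKernel (α + β) ξ = fourierKernel α ξ * fourierKernel β ξ := by
  rw [fourierKernel, fourierKernel, fourierKernel, ← Complex.exp_add]
  congr 1
  simp
  ring

theorem fourierKernel_add_right (α ξ η : ℂ) :
    fourierKernel α (ξ + η) = fourierKernel α ξ * fourierKernel α η := by
  rw [fourierKernel, fourierKernel, fourierKernel, ← Complex.exp_add]
  congr 1
  simp
  ring

theorem fourierKernel_zero_left (ξ : ℂ) : fourierKernel 0 ξ = 1 := by simp [fourierKernel]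

@[fun_prop]
theorem continuous_fourierKernel {X : Type*} [TopologicalSpace X] {f g : X → ℂ}
    (hf : Continuous f) (hg : Continuous g) : Continuous fun x => fourierKernel (f x) (g x) := by
  unfold fourierKernel
  fun_prop

theorem integrable_gaussian {b : ℝ} (hb : 0 < b) :
    Integrable fun ξ : ℂ => Real.exp (-b * ‖ξ‖ ^ 2) := by
  have h := (GaussianFourier.integrable_cexp_neg_mul_sq_norm_add (V := ℂ) (b := b)
    (by simpa using hb) 0 0).re
  refine h.congr (Eventually.of_forall fun ξ => ?_)
  have : (-(b : ℂ) * (‖ξ‖ : ℂ) ^ 2 + 0 * ((⟪(0 : ℂ), ξ⟫_ℝ : ℝ) : ℂ)) =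
      ((-b * ‖ξ‖ ^ 2 : ℝ) : ℂ) := by push_cast; ring
  simp only [this, ← Complex.ofReal_exp]
  rfl

theorem integral_gaussian_plane {b : ℝ} (hb : 0 < b) :
    ∫ ξ : ℂ, Real.exp (-b * ‖ξ‖ ^ 2) = Real.pi / b := by
  rw [GaussianFourier.integral_rexp_neg_mul_sq_norm hb, Complex.finrank_real_complex]
  norm_num

theorem integral_gaussian_mul_fourierKernel {b : ℝ} (hb : 0 < b) (α : ℂ) :
    ∫ ξ : ℂ, (Real.exp (-b * ‖ξ‖ ^ 2) : ℂ) * fourierKernel ξ α =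
      ((Real.pi / b * Real.exp (-‖α‖ ^ 2 / b) : ℝ) : ℂ) := by
  have h := GaussianFourier.integral_cexp_neg_mul_sq_norm_add (V := ℂ) (b := b)
    (by simpa using hb) (2 * Complex.I) (Complex.I * α)
  have h1 : ∀ ξ : ℂ, (Real.exp (-b * ‖ξ‖ ^ 2) : ℂ) * fourierKernel ξ α =
      Complex.exp (-b * ‖ξ‖ ^ 2 + 2 * Complex.I * (⟪Complex.I * α, ξ⟫_ℝ : ℝ)) := by
    intro ξ
    rw [fourierKernel_eq_exp, Complex.exp_add]
    push_cast
    rfl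
  simp only [h1]
  rw [h, Complex.finrank_real_complex]
  push_cast
  rw [norm_mul, Complex.norm_I, one_mul]
  have h2 : ((2 : ℂ) / 2) = 1 := by norm_num
  rw [h2, Complex.cpow_one]
  congr 2
  have hb' : (b : ℂ) ≠ 0 := by exact_mod_cast hb.ne'
  field_simp
  rw [Complex.I_sq]
  ring

/-- `∫ g(ξ) exp(α ξ* - ξ α*) d²ξ`. -/
noncomputable def planeFourier (g : ℂ → ℂ) (α : ℂ) : ℂ := ∫ ξ : ℂ, g ξ * fourierKernel α ξ

/-- The symplectic kernel is the standard Fourier character after rotation by `i` and scaling by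
`π⁻¹`. Inversion and smoothness are transported through this substitution. -/
theorem planeFourier_eq (g : ℂ → ℂ) (α : ℂ) :
    planeFourier g α = 𝓕 g (((Real.pi⁻¹ : ℝ) : ℂ) * (Complex.I * α)) := by
  rw [planeFourier, Real.fourier_eq']
  refine integral_congr_ae (Eventually.of_forall fun ξ => ?_)
  simp only [smul_eq_mul]
  rw [mul_comm, fourierKernel]
  congr 2
  have hpi : (Real.pi : ℂ) ≠ 0 := by exact_mod_cast Real.pi_ne_zero
  have h1 : (⟪ξ, ((Real.pi⁻¹ : ℝ) : ℂ) * (Complex.I * α)⟫_ℝ : ℝ) =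
      Real.pi⁻¹ * (ξ.im * α.re - ξ.re * α.im) := by
    rw [Complex.inner]
    simp
    ring
  rw [h1]
  push_cast
  field_simp
  apply Complex.ext <;> simp <;> ring

theorem integral_comp_pi_inv_mul_I {F : Type*} [NormedAddCommGroup F] [NormedSpace ℝ F]
    (f : ℂ → F) : ∫ α : ℂ, f (((Real.pi⁻¹ : ℝ) : ℂ) * (Complex.I * α)) =
      Real.pi ^ 2 • ∫ w : ℂ, f w := by
  have h1 : ∫ α : ℂ, f (((Real.pi⁻¹ : ℝ) : ℂ) * (Complex.I * α)) =
      ∫ α : ℂ, f (((Real.pi⁻¹ : ℝ) : ℂ) * α) := by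
    have := (rotation ⟨Complex.I, by simp [Submonoid.unitSphere]⟩).measurePreserving
    exact this.integral_comp (rotation _).toHomeomorph.measurableEmbedding
      (fun α => f (((Real.pi⁻¹ : ℝ) : ℂ) * α))
  rw [h1]
  have h2 := Measure.integral_comp_inv_smul_of_nonneg (volume : Measure ℂ) f Real.pi_pos.le
  rw [Complex.finrank_real_complex] at h2
  simpa using h2

theorem integrable_comp_pi_inv_mul_I {F : Type*} [NormedAddCommGroup F] {f : ℂ → F} :
    Integrable (fun α : ℂ => f (((Real.pi⁻¹ : ℝ) : ℂ) * (Complex.I * α))) ↔ Integrable f := by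
  have h2 := integrable_comp_smul_iff (volume : Measure ℂ) f (inv_ne_zero Real.pi_ne_zero)
  have h3 := (rotation ⟨Complex.I, by simp [Submonoid.unitSphere]⟩).measurePreserving
  rw [← h2]
  simp only [Complex.real_smul]
  exact h3.integrable_comp_emb (rotation _).toHomeomorph.measurableEmbedding
    (g := fun α => f (((Real.pi⁻¹ : ℝ) : ℂ) * α))

variable {g : ℂ → ℂ}

theorem continuous_planeFourier (hg : Integrable g) : Continuous (planeFourier g) := by
  refine continuous_of_dominated (bound := fun ξ => ‖g ξ‖) (fun α => ?_) (fun α => ?_) hg.norm ?_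
  · exact hg.1.mul (by fun_prop : Continuous fun ξ => fourierKernel α ξ).aestronglyMeasurable
  · exact Eventually.of_forall fun ξ => by rw [norm_mul, norm_fourierKernel, mul_one]
  · exact Eventually.of_forall fun ξ => by fun_prop

theorem norm_planeFourier_le (α : ℂ) : ‖planeFourier g α‖ ≤ ∫ ξ, ‖g ξ‖ := by
  refine (norm_integral_le_integral_norm _).trans_eq ?_
  simp only [norm_mul, norm_fourierKernel, mul_one]

/-- Fourier inversion on the phase plane. -/
theorem planeFourier_inversion (hg : Integrable g) (hc : Continuous g)
    (hF : Integrable (planeFourier g)) (ξ : ℂ) :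
    ∫ α : ℂ, planeFourier g α * fourierKernel ξ α = Real.pi ^ 2 * g ξ := by
  have h1 : planeFourier g = fun α => 𝓕 g (((Real.pi⁻¹ : ℝ) : ℂ) * (Complex.I * α)) :=
    funext (planeFourier_eq g)
  rw [h1, integrable_comp_pi_inv_mul_I] at hF
  have h2 := congrFun (hc.fourierInv_fourier_eq hg hF) ξ
  rw [Real.fourierInv_eq'] at h2
  have h3 := integral_comp_pi_inv_mul_I
    (fun w : ℂ => Complex.exp (((2 * Real.pi * ⟪w, ξ⟫_ℝ : ℝ) : ℂ) * Complex.I) • 𝓕 g w)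
  rw [h2, Complex.real_smul] at h3
  push_cast at h3
  rw [← h3]
  refine integral_congr_ae (Eventually.of_forall fun α => ?_)
  simp only [smul_eq_mul]
  rw [planeFourier_eq, mul_comm, fourierKernel]
  push_cast
  congr 2
  have hpi : (Real.pi : ℂ) ≠ 0 := by exact_mod_cast Real.pi_ne_zero
  have h4 : (⟪(Real.pi : ℂ)⁻¹ * (Complex.I * α), ξ⟫_ℝ : ℝ) =
      Real.pi⁻¹ * (ξ.im * α.re - ξ.re * α.im) := by
    rw [← Complex.ofReal_inv, Complex.inner]
    simp
    ring
  rw [h4]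
  push_cast
  field_simp
  apply Complex.ext <;> simp <;> ring

theorem integrable_mul_mul_fourierKernel {f : ℂ → ℂ} (hf : Integrable f) (hg : Integrable g) :
    Integrable (fun q : ℂ × ℂ => f q.1 * (g q.2 * fourierKernel q.1 q.2))
      (volume.prod volume) := by
  have h : Integrable (fun q : ℂ × ℂ => f q.1 * g q.2) (volume.prod volume) := hf.mul_prod hg
  refine h.mono ?_ (Eventually.of_forall fun q => ?_)
  · refine (h.1.mul (by fun_prop : Continuous fun q : ℂ × ℂ =>
      fourierKernel q.1 q.2).aestronglyMeasurable).congr (Eventually.of_forall fun q => ?_)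
    exact mul_assoc _ _ _
  · simp only [norm_mul, norm_fourierKernel, mul_one]
    exact le_rfl

theorem integral_mul_planeFourier {f : ℂ → ℂ} (hf : Integrable f) (hg : Integrable g) :
    ∫ α, f α * planeFourier g α = ∫ ξ, g ξ * ∫ α, f α * fourierKernel α ξ := by
  have h1 := integral_integral_swap (f := fun α ξ : ℂ => f α * (g ξ * fourierKernel α ξ))
    (integrable_mul_mul_fourierKernel hf hg)
  simp only [planeFourier, ← integral_const_mul]
  rw [h1]
  refine integral_congr_ae (Eventually.of_forall fun ξ => ?_)
  refine integral_congr_ae (Eventually.of_forall fun α => ?_)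
  ring

/-- Integrating a Fourier transform against a Gaussian. -/
theorem integral_gaussian_mul_planeFourier (hg : Integrable g) {b : ℝ} (hb : 0 < b) :
    ∫ α : ℂ, (Real.exp (-b * ‖α‖ ^ 2) : ℂ) * planeFourier g α =
      ∫ ξ : ℂ, g ξ * ((Real.pi / b * Real.exp (-‖ξ‖ ^ 2 / b) : ℝ) : ℂ) := by
  have hgauss : Integrable fun α : ℂ => (Real.exp (-b * ‖α‖ ^ 2) : ℂ) :=
    (integrable_gaussian hb).ofReal
  rw [integral_mul_planeFourier hgauss hg]
  simp only [integral_gaussian_mul_fourierKernel hb]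

/-- A bounded integrable function with nonnegative Fourier transform has an integrable Fourier
transform. -/
theorem integrable_of_planeFourier_nonneg (hg : Integrable g) {C : ℝ} (hC : ∀ ξ, ‖g ξ‖ ≤ C)
    {F : ℂ → ℝ} (hF0 : ∀ α, 0 ≤ F α) (hF : ∀ α, planeFourier g α = F α) : Integrable F := by
  have hFc : Continuous F := by
    have h1 : F = fun α => (planeFourier g α).re := funext fun α => by rw [hF, Complex.ofReal_re]
    rw [h1]
    exact Complex.continuous_re.comp (continuous_planeFourier hg)
  have hFb : ∀ α, F α ≤ ∫ ξ, ‖g ξ‖ := fun α => by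
    have := norm_planeFourier_le (g := g) α
    rw [hF, Complex.norm_real] at this
    exact (le_abs_self _).trans this
  have hC0 : 0 ≤ C := (norm_nonneg _).trans (hC 0)
  -- By duality the Gaussian moves onto `g` as `π / b` times a Gaussian of total mass `π b`, so the
  -- bound `C π²` does not depend on `b`.
  have hgauss : ∀ b > 0, Integrable (fun α => Real.exp (-b * ‖α‖ ^ 2) * F α) ∧
      ∫ α, Real.exp (-b * ‖α‖ ^ 2) * F α ≤ C * Real.pi ^ 2 := by
    intro b hb
    refine ⟨((integrable_gaussian hb).mul_const (∫ ξ, ‖g ξ‖)).mono'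
      (by fun_prop : Continuous fun α => Real.exp (-b * ‖α‖ ^ 2) * F α).aestronglyMeasurable
      (Eventually.of_forall fun α => ?_), ?_⟩
    · rw [Real.norm_eq_abs, abs_of_nonneg (mul_nonneg (Real.exp_pos _).le (hF0 α))]
      exact mul_le_mul_of_nonneg_left (hFb α) (Real.exp_pos _).le
    have h1 := integral_gaussian_mul_planeFourier hg hb
    have h2 : ∀ α, (Real.exp (-b * ‖α‖ ^ 2) : ℂ) * planeFourier g α =
        ((Real.exp (-b * ‖α‖ ^ 2) * F α : ℝ) : ℂ) := fun α => by rw [hF]; push_cast; rfl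
    simp only [h2] at h1
    rw [integral_complex_ofReal] at h1
    have h3 : ∫ α, Real.exp (-b * ‖α‖ ^ 2) * F α ≤
        ‖∫ ξ : ℂ, g ξ * ((Real.pi / b * Real.exp (-‖ξ‖ ^ 2 / b) : ℝ) : ℂ)‖ := by
      rw [← h1, Complex.norm_real]
      exact le_abs_self _
    have hib := integrable_gaussian (inv_pos.2 hb)
    refine h3.trans ((norm_integral_le_of_norm_le
      (g := fun ξ => C * (Real.pi / b * Real.exp (-b⁻¹ * ‖ξ‖ ^ 2)))
      ((hib.const_mul _).const_mul _) (Eventually.of_forall fun ξ => ?_)).trans_eq ?_)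
    · rw [norm_mul, Complex.norm_real, Real.norm_eq_abs, abs_of_nonneg (by positivity)]
      have h4 : -‖ξ‖ ^ 2 / b = -b⁻¹ * ‖ξ‖ ^ 2 := by field_simp
      rw [h4]
      exact mul_le_mul_of_nonneg_right (hC ξ) (by positivity)
    · rw [integral_const_mul, integral_const_mul, integral_gaussian_plane (inv_pos.2 hb)]
      field_simp
  refine (aecover_closedBall (x := (0 : ℂ)) (r := fun n : ℕ => (n : ℝ))
    tendsto_natCast_atTop_atTop).integrable_of_integral_bounded_of_nonneg_ae
    (Real.exp 1 * (C * Real.pi ^ 2))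
    (fun n => hFc.continuousOn.integrableOn_compact (isCompact_closedBall _ _))
    (Eventually.of_forall hF0) ((eventually_gt_atTop 0).mono fun n hn => ?_)
  have hn' : (0 : ℝ) < n := by exact_mod_cast hn
  -- With `b = 1 / n²` the Gaussian is at least `exp(-1)` on the ball of radius `n`, whence the
  -- factor `exp 1`.
  obtain ⟨hi, hle⟩ := hgauss (1 / (n : ℝ) ^ 2) (by positivity)
  calc ∫ α in Metric.closedBall 0 (n : ℝ), F α
      ≤ ∫ α in Metric.closedBall 0 (n : ℝ),
          Real.exp 1 * (Real.exp (-(1 / (n : ℝ) ^ 2) * ‖α‖ ^ 2) * F α) := by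
        refine setIntegral_mono_on
          (hFc.continuousOn.integrableOn_compact (isCompact_closedBall _ _))
          (hi.const_mul _).integrableOn Metric.isClosed_closedBall.measurableSet fun α hα => ?_
        rw [← mul_assoc, ← Real.exp_add]
        refine le_mul_of_one_le_left (hF0 α) (Real.one_le_exp ?_)
        rw [mem_closedBall_zero_iff] at hα
        have : ‖α‖ ^ 2 ≤ (n : ℝ) ^ 2 := pow_le_pow_left₀ (norm_nonneg _) hα 2
        have h5 : 1 / (n : ℝ) ^ 2 * ‖α‖ ^ 2 ≤ 1 := by
          rw [one_div, inv_mul_le_iff₀ (by positivity)]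
          linarith
        linarith
    _ ≤ ∫ α, Real.exp 1 * (Real.exp (-(1 / (n : ℝ) ^ 2) * ‖α‖ ^ 2) * F α) :=
        setIntegral_le_integral (hi.const_mul _) (Eventually.of_forall fun α =>
          mul_nonneg (Real.exp_pos _).le (mul_nonneg (Real.exp_pos _).le (hF0 α)))
    _ ≤ _ := by
        rw [integral_const_mul]
        exact mul_le_mul_of_nonneg_left hle (Real.exp_pos _).le

end FourierPlane

/-! ### Fidelity along filters tending to one. -/

section Convergence

variable {Ω : ℂ → ℂ} {p : ℂ → ℝ} {ρ : Mode →L[ℂ] Mode}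

theorem IsPhysicalFilter.eq_planeFourier (hΩ : IsPhysicalFilter Ω p) :
    Ω = planeFourier fun α => (p α : ℂ) := funext hΩ.eq_fourier

theorem IsPhysicalFilter.continuous (hΩ : IsPhysicalFilter Ω p) : Continuous Ω := by
  rw [hΩ.eq_planeFourier]
  exact continuous_planeFourier hΩ.integrable.ofReal

theorem IsPhysicalFilter.norm_le_one (hΩ : IsPhysicalFilter Ω p) (ξ : ℂ) : ‖Ω ξ‖ ≤ 1 := by
  rw [hΩ.eq_planeFourier]
  refine (norm_planeFourier_le ξ).trans_eq ?_
  simp only [Complex.norm_real, Real.norm_eq_abs, fun α => abs_of_nonneg (hΩ.nonneg α)]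
  exact hΩ.integral_eq_one

/-- Turns information about the filter into concentration of its density: the Gaussian `exp(-|ξ|²)`
is its own transform up to the factor `π`. -/
theorem IsPhysicalFilter.integral_gaussian_mul (hΩ : IsPhysicalFilter Ω p) :
    ∫ ξ : ℂ, (Real.exp (-1 * ‖ξ‖ ^ 2) : ℂ) * Ω ξ =
      ((Real.pi * ∫ α, p α * Real.exp (-‖α‖ ^ 2) : ℝ) : ℂ) := by
  have hp : Integrable fun α => (p α : ℂ) := hΩ.integrable.ofReal
  have h := integral_gaussian_mul_planeFourier hp one_pos
  rw [hΩ.eq_planeFourier, h, ← integral_const_mul, ← integral_complex_ofReal]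
  refine integral_congr_ae (Eventually.of_forall fun α => ?_)
  simp only [div_one]
  push_cast
  ring

theorem IsPhysicalFilter.integrable_mul_gaussian (hΩ : IsPhysicalFilter Ω p) :
    Integrable fun α => p α * Real.exp (-‖α‖ ^ 2) := by
  refine hΩ.integrable.norm.mono' (hΩ.integrable.1.mul
    (by fun_prop : Continuous fun α : ℂ => Real.exp (-‖α‖ ^ 2)).aestronglyMeasurable)
    (Eventually.of_forall fun α => ?_)
  rw [norm_mul]
  refine mul_le_of_le_one_right (norm_nonneg _) ?_
  rw [Real.norm_eq_abs, Real.abs_exp, Real.exp_le_one_iff]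
  linarith [sq_nonneg ‖α‖]

theorem tendsto_integral_mul_gaussian {Ω : ℝ → ℂ → ℂ} {p : ℝ → ℂ → ℝ}
    (hΩ : ∀ L, 0 < L → IsPhysicalFilter (Ω L) (p L))
    (hlim : ∀ ξ, Tendsto (fun L => Ω L ξ) atTop (𝓝 1)) :
    Tendsto (fun L => ∫ α, p L α * Real.exp (-‖α‖ ^ 2)) atTop (𝓝 1) := by
  have h1 : Tendsto (fun L => ∫ ξ : ℂ, (Real.exp (-1 * ‖ξ‖ ^ 2) : ℂ) * Ω L ξ) atTop
      (𝓝 (∫ ξ : ℂ, (Real.exp (-1 * ‖ξ‖ ^ 2) : ℂ) * 1)) := by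
    refine tendsto_integral_filter_of_dominated_convergence
      (fun ξ : ℂ => Real.exp (-1 * ‖ξ‖ ^ 2)) ?_ ?_ (integrable_gaussian one_pos) ?_
    · filter_upwards [eventually_gt_atTop 0] with L hL
      have := (hΩ L hL).continuous
      exact (by fun_prop : Continuous _).aestronglyMeasurable
    · filter_upwards [eventually_gt_atTop 0] with L hL
      refine Eventually.of_forall fun ξ => ?_
      rw [norm_mul, Complex.norm_real, Real.norm_eq_abs, Real.abs_exp]
      exact mul_le_of_le_one_right (Real.exp_pos _).le ((hΩ L hL).norm_le_one ξ)
    · exact Eventually.of_forall fun ξ => (hlim ξ).const_mul _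
  simp only [mul_one] at h1
  rw [integral_complex_ofReal, integral_gaussian_plane one_pos, div_one] at h1
  have h2 : Tendsto (fun L => Real.pi * ∫ α, p L α * Real.exp (-‖α‖ ^ 2)) atTop (𝓝 Real.pi) := by
    have h3 := (Complex.continuous_re.tendsto _).comp h1
    rw [Complex.ofReal_re] at h3
    refine h3.congr' ?_
    filter_upwards [eventually_gt_atTop 0] with L hL
    simp only [Function.comp_apply]
    rw [(hΩ L hL).integral_gaussian_mul, Complex.ofReal_re]
  have h4 := h2.const_mul Real.pi⁻¹
  simpa [Real.pi_ne_zero] using h4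

/-- The entanglement fidelity tends to one along physical filters tending to one. -/
theorem tendsto_entanglementFidelity {Ω : ℝ → ℂ → ℂ} {p : ℝ → ℂ → ℝ}
    (hΩ : ∀ L, 0 < L → IsPhysicalFilter (Ω L) (p L))
    (hlim : ∀ ξ, Tendsto (fun L => Ω L ξ) atTop (𝓝 1)) (hρ : IsDensityOperator ρ) :
    Tendsto (fun L => entanglementFidelity (p L) ρ) atTop (𝓝 1) := by
  have hJ := tendsto_integral_mul_gaussian hΩ hlim
  have hc := hρ.isTraceClass.continuous_charFn
  rw [Metric.tendsto_nhds]
  intro ε hε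
  have hΦ : ∀ᶠ α in 𝓝 (0 : ℂ), 1 - ‖charFn ρ α‖ ^ 2 < ε / 2 := by
    have h1 : Tendsto (fun α => 1 - ‖charFn ρ α‖ ^ 2) (𝓝 0) (𝓝 (1 - ‖charFn ρ 0‖ ^ 2)) :=
      (by fun_prop : Continuous fun α => 1 - ‖charFn ρ α‖ ^ 2).tendsto 0
    rw [charFn_zero, hρ.trace_eq_one, norm_one, one_pow, sub_self] at h1
    exact h1.eventually_lt_const (half_pos hε)
  obtain ⟨r, hr, hball⟩ := Metric.eventually_nhds_iff.1 hΦ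
  have hK : 0 < 1 - Real.exp (-r ^ 2) := by
    rw [sub_pos, Real.exp_lt_one_iff]
    nlinarith
  set K := 1 - Real.exp (-r ^ 2)
  -- Inside the disc of radius `r` continuity at `0` suffices. Outside it the left side is at most
  -- `1`, while `1 - exp(-|α|²)` is at least `K`.
  have hpt : ∀ α, 1 - ‖charFn ρ α‖ ^ 2 ≤ ε / 2 + K⁻¹ * (1 - Real.exp (-‖α‖ ^ 2)) := by
    intro α
    have h0 : 0 ≤ 1 - Real.exp (-‖α‖ ^ 2) := by
      rw [sub_nonneg, Real.exp_le_one_iff]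
      linarith [sq_nonneg ‖α‖]
    by_cases hα : ‖α‖ < r
    · have := hball (y := α) (by simpa using hα)
      have : 0 ≤ K⁻¹ * (1 - Real.exp (-‖α‖ ^ 2)) := mul_nonneg (inv_nonneg.2 hK.le) h0
      linarith
    · have h1 : K ≤ 1 - Real.exp (-‖α‖ ^ 2) := by
        have : Real.exp (-‖α‖ ^ 2) ≤ Real.exp (-r ^ 2) :=
          Real.exp_le_exp.2 (by nlinarith [not_lt.1 hα])
        linarith
      have h2 : 1 ≤ K⁻¹ * (1 - Real.exp (-‖α‖ ^ 2)) := by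
        rw [inv_mul_eq_div, le_div_iff₀ hK]
        linarith
      linarith [sq_nonneg ‖charFn ρ α‖]
  have hJ2 : ∀ᶠ L in atTop, K⁻¹ * (1 - ∫ α, p L α * Real.exp (-‖α‖ ^ 2)) < ε / 2 := by
    have h1 := (hJ.const_sub 1).const_mul K⁻¹
    rw [sub_self, mul_zero] at h1
    exact h1.eventually_lt_const (half_pos hε)
  filter_upwards [hJ2, eventually_gt_atTop 0] with L hL hL0
  have hp := hΩ L hL0
  have hle := entanglementFidelity_le_one hp hρ
  rw [Real.dist_eq, abs_sub_comm, abs_of_nonneg (sub_nonneg.2 hle)]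
  have hi := integrable_mul_normSq_charFn hp.integrable hρ
  have h1 : 1 - entanglementFidelity (p L) ρ = ∫ α, (p L α - p L α * ‖charFn ρ α‖ ^ 2) := by
    rw [integral_sub hp.integrable hi, hp.integral_eq_one,
      entanglementFidelity_eq hρ hp.integrable]
  have hi2 := (hp.integrable.sub hp.integrable_mul_gaussian).const_mul K⁻¹
  have h2 : ∫ α, (p L α - p L α * ‖charFn ρ α‖ ^ 2) ≤
      ∫ α, (p L α * (ε / 2) + K⁻¹ * (p L α - p L α * Real.exp (-‖α‖ ^ 2))) := by
    refine integral_mono (hp.integrable.sub hi) ((hp.integrable.mul_const _).add hi2) fun α => ?_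
    have := mul_le_mul_of_nonneg_left (hpt α) (hp.nonneg α)
    simp only
    linarith
  have h3 : ∫ α, (p L α * (ε / 2) + K⁻¹ * (p L α - p L α * Real.exp (-‖α‖ ^ 2))) =
      ε / 2 + K⁻¹ * (1 - ∫ α, p L α * Real.exp (-‖α‖ ^ 2)) := by
    refine (integral_add (hp.integrable.mul_const _) hi2).trans ?_
    rw [integral_mul_const, integral_const_mul, hp.integral_eq_one, one_mul]
    congr 2
    refine (integral_sub hp.integrable hp.integrable_mul_gaussian).trans ?_
    rw [hp.integral_eq_one]
  linarith

theorem tendsto_sqrt_one_sub_fidelity {Ω : ℝ → ℂ → ℂ} {p : ℝ → ℂ → ℝ}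
    (hΩ : ∀ L, 0 < L → IsPhysicalFilter (Ω L) (p L))
    (hlim : ∀ ξ, Tendsto (fun L => Ω L ξ) atTop (𝓝 1)) (hρ : IsDensityOperator ρ) :
    Tendsto (fun L => √(1 - entanglementFidelity (p L) ρ)) atTop (𝓝 0) := by
  have h := ((tendsto_entanglementFidelity hΩ hlim hρ).const_sub 1).sqrt
  rwa [sub_self, Real.sqrt_zero] at h

end Convergence

/-! ### Generalised convolutions of kernels with Gaussian decay. -/

section GaussianConvolution

/-- `ξ ↦ ∫ G(ζ, ξ - ζ) d²ζ`. -/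
noncomputable def shearIntegral (G : ℂ × ℂ → ℂ) (ξ : ℂ) : ℂ := ∫ ζ, G (ζ, ξ - ζ)

theorem norm_sq_le_two_mul (ζ ξ : ℂ) : ‖ξ‖ ^ 2 ≤ 2 * ‖ζ‖ ^ 2 + 2 * ‖ξ - ζ‖ ^ 2 := by
  have h1 : ‖ξ‖ ≤ ‖ζ‖ + ‖ξ - ζ‖ := by simpa using norm_add_le ζ (ξ - ζ)
  nlinarith [sq_nonneg (‖ζ‖ - ‖ξ - ζ‖), norm_nonneg ξ, norm_nonneg ζ, norm_nonneg (ξ - ζ)]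

variable {G : ℂ × ℂ → ℂ} {M : ℝ}

/-- By the parallelogram bound `|ξ|² / 4` costs at most half of `|ζ|² + |ξ - ζ|²`, which leaves
`|ζ|² / 2` for integrability in `ζ`. -/
theorem norm_shear_le (hM : 0 ≤ M)
    (hG : ∀ ζ η, ‖G (ζ, η)‖ ≤ M * Real.exp (-‖ζ‖ ^ 2 - ‖η‖ ^ 2)) (ξ ζ : ℂ) :
    ‖G (ζ, ξ - ζ)‖ ≤
      M * (Real.exp (-(1 / 4) * ‖ξ‖ ^ 2) * Real.exp (-(1 / 2) * ‖ζ‖ ^ 2)) := by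
  refine (hG _ _).trans (mul_le_mul_of_nonneg_left ?_ hM)
  rw [← Real.exp_add, Real.exp_le_exp]
  linarith [norm_sq_le_two_mul ζ ξ, sq_nonneg ‖ξ - ζ‖]

theorem norm_shearIntegral_le (hM : 0 ≤ M)
    (hG : ∀ ζ η, ‖G (ζ, η)‖ ≤ M * Real.exp (-‖ζ‖ ^ 2 - ‖η‖ ^ 2)) (ξ : ℂ) :
    ‖shearIntegral G ξ‖ ≤ M * (2 * Real.pi) * Real.exp (-(1 / 4) * ‖ξ‖ ^ 2) := by
  have hg := integrable_gaussian (b := 1 / 2) (by norm_num)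
  refine (norm_integral_le_of_norm_le ((hg.const_mul _).const_mul M)
    (Eventually.of_forall fun ζ => norm_shear_le hM hG ξ ζ)).trans_eq ?_
  rw [integral_const_mul, integral_const_mul, integral_gaussian_plane (by norm_num)]
  ring

theorem continuous_shearIntegral (hM : 0 ≤ M) (hc : Continuous G)
    (hG : ∀ ζ η, ‖G (ζ, η)‖ ≤ M * Real.exp (-‖ζ‖ ^ 2 - ‖η‖ ^ 2)) :
    Continuous (shearIntegral G) := by
  have hg := integrable_gaussian (b := 1 / 2) (by norm_num)
  refine continuous_of_dominated
    (bound := fun ζ => M * (1 * Real.exp (-(1 / 2) * ‖ζ‖ ^ 2))) (fun ξ => ?_) (fun ξ => ?_)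
    ((hg.const_mul _).const_mul M) ?_
  · exact (by fun_prop : Continuous fun ζ => G (ζ, ξ - ζ)).aestronglyMeasurable
  · refine Eventually.of_forall fun ζ => (norm_shear_le hM hG ξ ζ).trans ?_
    gcongr
    rw [Real.exp_le_one_iff]
    nlinarith [sq_nonneg ‖ξ‖]
  · exact Eventually.of_forall fun ζ => by fun_prop

theorem integrable_shearIntegral (hM : 0 ≤ M) (hc : Continuous G)
    (hG : ∀ ζ η, ‖G (ζ, η)‖ ≤ M * Real.exp (-‖ζ‖ ^ 2 - ‖η‖ ^ 2)) :
    Integrable (shearIntegral G) :=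
  ((integrable_gaussian (b := 1 / 4) (by norm_num)).const_mul (M * (2 * Real.pi))).mono'
    (continuous_shearIntegral hM hc hG).aestronglyMeasurable
    (Eventually.of_forall fun ξ => norm_shearIntegral_le hM hG ξ)

theorem integrable_of_gaussian_bound (hc : Continuous G)
    (hG : ∀ ζ η, ‖G (ζ, η)‖ ≤ M * Real.exp (-‖ζ‖ ^ 2 - ‖η‖ ^ 2)) :
    Integrable G (volume.prod volume) := by
  have hg := integrable_gaussian one_pos
  refine ((hg.mul_prod hg).const_mul M).mono' hc.aestronglyMeasurable
    (Eventually.of_forall fun q => (hG q.1 q.2).trans_eq ?_)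
  rw [← Real.exp_add]
  ring_nf

/-- Fubini and the substitution `η = ξ - ζ`. The double integral on the right is where kernels that
are not products can be analysed. -/
theorem planeFourier_shearIntegral (hM : 0 ≤ M) (hc : Continuous G)
    (hG : ∀ ζ η, ‖G (ζ, η)‖ ≤ M * Real.exp (-‖ζ‖ ^ 2 - ‖η‖ ^ 2)) (α : ℂ) :
    planeFourier (shearIntegral G) α = ∫ q : ℂ × ℂ,
      G q * (fourierKernel α q.1 * fourierKernel α q.2) ∂(volume.prod volume) := by
  have hi : Integrable (Function.uncurry fun ξ ζ : ℂ => G (ζ, ξ - ζ) * fourierKernel α ξ)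
      (volume.prod volume) := by
    have h4 := integrable_gaussian (b := 1 / 4) (by norm_num)
    have h2 := integrable_gaussian (b := 1 / 2) (by norm_num)
    refine ((h4.mul_prod h2).const_mul M).mono' ?_ (Eventually.of_forall fun q => ?_)
    · exact (by unfold Function.uncurry; fun_prop : Continuous (Function.uncurry
        fun ξ ζ : ℂ => G (ζ, ξ - ζ) * fourierKernel α ξ)).aestronglyMeasurable
    · simp only [Function.uncurry, norm_mul, norm_fourierKernel, mul_one]
      exact norm_shear_le hM hG q.1 q.2
  have hi2 : Integrable (fun q : ℂ × ℂ => G q * (fourierKernel α q.1 * fourierKernel α q.2))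
      (volume.prod volume) := by
    refine (integrable_of_gaussian_bound hc hG).mono
      (by fun_prop : Continuous fun q : ℂ × ℂ =>
        G q * (fourierKernel α q.1 * fourierKernel α q.2)).aestronglyMeasurable
      (Eventually.of_forall fun q => ?_)
    simp only [norm_mul, norm_fourierKernel, mul_one, le_refl]
  rw [integral_prod _ hi2]
  simp only [planeFourier, shearIntegral, ← integral_mul_const]
  rw [integral_integral_swap hi]
  refine integral_congr_ae (Eventually.of_forall fun ζ => ?_)
  simp only
  rw [← integral_add_right_eq_self _ ζ]
  refine integral_congr_ae (Eventually.of_forall fun η => ?_)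
  simp only [add_sub_cancel_right]
  rw [add_comm η ζ, fourierKernel_add_right]

end GaussianConvolution

/-! ### Windows decaying faster than every Gaussian, and their autocorrelations. -/

section Window

/-- Even nonnegative continuous functions decaying faster than every Gaussian. -/
structure IsWindow (κ : ℂ → ℝ) : Prop where
  continuous : Continuous κ
  nonneg : ∀ ζ, 0 ≤ κ ζ
  even : ∀ ζ, κ (-ζ) = κ ζ
  decay : ∀ a : ℝ, ∃ M, ∀ ζ, κ ζ * Real.exp (a * ‖ζ‖ ^ 2) ≤ M

variable {κ : ℂ → ℝ}

/-- `κ(ζ) κ(η) exp(a |ζ + s η|²)`. -/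
noncomputable def windowKernel (κ : ℂ → ℝ) (a s : ℝ) (q : ℂ × ℂ) : ℂ :=
  ((κ q.1 * κ q.2 * Real.exp (a * ‖q.1 + s * q.2‖ ^ 2) : ℝ) : ℂ)

namespace IsWindow

theorem exists_le_gaussian (hκ : IsWindow κ) (a : ℝ) :
    ∃ M, 0 ≤ M ∧ ∀ ζ, κ ζ * Real.exp (a * ‖ζ‖ ^ 2) ≤ M * Real.exp (-‖ζ‖ ^ 2) := by
  obtain ⟨M, hM⟩ := hκ.decay (a + 1)
  refine ⟨M, (mul_nonneg (hκ.nonneg 0) (Real.exp_pos _).le).trans (hM 0), fun ζ => ?_⟩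
  have h1 := mul_le_mul_of_nonneg_right (hM ζ) (Real.exp_pos (-‖ζ‖ ^ 2)).le
  rw [mul_assoc, ← Real.exp_add] at h1
  rwa [show (a + 1) * ‖ζ‖ ^ 2 + -‖ζ‖ ^ 2 = a * ‖ζ‖ ^ 2 by ring] at h1

theorem integrable_mul_exp (hκ : IsWindow κ) (a : ℝ) :
    Integrable fun ζ => κ ζ * Real.exp (a * ‖ζ‖ ^ 2) := by
  obtain ⟨M, -, hM⟩ := hκ.exists_le_gaussian a
  have hc := hκ.continuous
  refine ((integrable_gaussian one_pos).const_mul M).mono'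
    (by fun_prop : Continuous _).aestronglyMeasurable (Eventually.of_forall fun ζ => ?_)
  rw [Real.norm_eq_abs, abs_of_nonneg (mul_nonneg (hκ.nonneg _) (Real.exp_pos _).le)]
  simpa using hM ζ

theorem continuous_windowKernel (hκ : IsWindow κ) (a s : ℝ) :
    Continuous (windowKernel κ a s) := by
  have hc := hκ.continuous
  unfold windowKernel
  fun_prop

theorem exists_windowKernel_le (hκ : IsWindow κ) (a : ℝ) {s : ℝ} (hs : |s| ≤ 1) :
    ∃ M, 0 ≤ M ∧ ∀ ζ η, ‖windowKernel κ a s (ζ, η)‖ ≤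
      M * Real.exp (-‖ζ‖ ^ 2 - ‖η‖ ^ 2) := by
  obtain ⟨M, hM0, hM⟩ := hκ.exists_le_gaussian (2 * |a|)
  refine ⟨M * M, mul_nonneg hM0 hM0, fun ζ η => ?_⟩
  have h1 : a * ‖ζ + s * η‖ ^ 2 ≤ 2 * |a| * ‖ζ‖ ^ 2 + 2 * |a| * ‖η‖ ^ 2 := by
    have h2 : ‖ζ + s * η‖ ≤ ‖ζ‖ + ‖η‖ := by
      refine (norm_add_le _ _).trans (add_le_add le_rfl ?_)
      rw [norm_mul, Complex.norm_real]
      exact mul_le_of_le_one_left (norm_nonneg _) hs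
    have h3 : ‖ζ + s * η‖ ^ 2 ≤ 2 * ‖ζ‖ ^ 2 + 2 * ‖η‖ ^ 2 := by
      nlinarith [sq_nonneg (‖ζ‖ - ‖η‖), norm_nonneg ζ, norm_nonneg η, norm_nonneg (ζ + s * η)]
    calc a * ‖ζ + s * η‖ ^ 2 ≤ |a| * ‖ζ + s * η‖ ^ 2 :=
          mul_le_mul_of_nonneg_right (le_abs_self a) (sq_nonneg _)
      _ ≤ |a| * (2 * ‖ζ‖ ^ 2 + 2 * ‖η‖ ^ 2) := mul_le_mul_of_nonneg_left h3 (abs_nonneg a)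
      _ = _ := by ring
  have h0 : 0 ≤ κ ζ * κ η := mul_nonneg (hκ.nonneg _) (hκ.nonneg _)
  rw [windowKernel, Complex.norm_real, Real.norm_eq_abs,
    abs_of_nonneg (mul_nonneg h0 (Real.exp_pos _).le)]
  calc κ ζ * κ η * Real.exp (a * ‖ζ + s * η‖ ^ 2)
      ≤ κ ζ * κ η * Real.exp (2 * |a| * ‖ζ‖ ^ 2 + 2 * |a| * ‖η‖ ^ 2) :=
        mul_le_mul_of_nonneg_left (Real.exp_le_exp.2 h1) h0
    _ = (κ ζ * Real.exp (2 * |a| * ‖ζ‖ ^ 2)) * (κ η * Real.exp (2 * |a| * ‖η‖ ^ 2)) := by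
        rw [Real.exp_add]; ring
    _ ≤ (M * Real.exp (-‖ζ‖ ^ 2)) * (M * Real.exp (-‖η‖ ^ 2)) :=
        mul_le_mul (hM ζ) (hM η) (mul_nonneg (hκ.nonneg _) (Real.exp_pos _).le)
          (mul_nonneg hM0 (Real.exp_pos _).le)
    _ = _ := by rw [sub_eq_add_neg, Real.exp_add]; ring

theorem continuous_shear (hκ : IsWindow κ) (a : ℝ) {s : ℝ} (hs : |s| ≤ 1) :
    Continuous (shearIntegral (windowKernel κ a s)) := by
  obtain ⟨M, hM0, hM⟩ := hκ.exists_windowKernel_le a hs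
  exact continuous_shearIntegral hM0 (hκ.continuous_windowKernel a s) hM

theorem integrable_shear (hκ : IsWindow κ) (a : ℝ) {s : ℝ} (hs : |s| ≤ 1) :
    Integrable (shearIntegral (windowKernel κ a s)) := by
  obtain ⟨M, hM0, hM⟩ := hκ.exists_windowKernel_le a hs
  exact integrable_shearIntegral hM0 (hκ.continuous_windowKernel a s) hM

theorem exists_norm_shear_le (hκ : IsWindow κ) (a : ℝ) {s : ℝ} (hs : |s| ≤ 1) :
    ∃ C, ∀ ξ, ‖shearIntegral (windowKernel κ a s) ξ‖ ≤ C := by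
  obtain ⟨M, hM0, hM⟩ := hκ.exists_windowKernel_le a hs
  refine ⟨_, fun ξ => (norm_shearIntegral_le hM0 hM ξ).trans
    (mul_le_of_le_one_right (by positivity) ?_)⟩
  rw [Real.exp_le_one_iff]
  nlinarith [sq_nonneg ‖ξ‖]

/-- For `s = 1` the exponential depends only on the total argument `ξ` and leaves the convolution
integral. -/
theorem shear_one (κ : ℂ → ℝ) (a : ℝ) (ξ : ℂ) : shearIntegral (windowKernel κ a 1) ξ =
    ((∫ ζ, κ ζ * κ (ξ - ζ) : ℝ) : ℂ) * Real.exp (a * ‖ξ‖ ^ 2) := by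
  simp only [shearIntegral, windowKernel, Complex.ofReal_one, one_mul, add_sub_cancel]
  rw [integral_complex_ofReal, integral_mul_const, Complex.ofReal_mul]

/-- The Fourier transform of `κ`, which is real. -/
theorem planeFourier_conj (hκ : IsWindow κ) (α : ℂ) :
    starRingEnd ℂ (planeFourier (fun ζ => (κ ζ : ℂ)) α) =
      planeFourier (fun ζ => (κ ζ : ℂ)) α := by
  rw [planeFourier, ← integral_conj, ← integral_neg_eq_self]
  refine integral_congr_ae (Eventually.of_forall fun ζ => ?_)
  simp only [map_mul, Complex.conj_ofReal, conj_fourierKernel, hκ.even]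
  rw [fourierKernel_neg_left]

/-- The convolution theorem; evenness of `κ` makes its transform real, so the square is nonnegative.
-/
theorem planeFourier_shear_zero (hκ : IsWindow κ) (α : ℂ) :
    planeFourier (shearIntegral (windowKernel κ 0 1)) α =
      (((planeFourier (fun ζ => (κ ζ : ℂ)) α).re ^ 2 : ℝ) : ℂ) := by
  obtain ⟨M, hM0, hM⟩ := hκ.exists_windowKernel_le 0 (s := 1) (by simp)
  rw [planeFourier_shearIntegral hM0 (hκ.continuous_windowKernel 0 1) hM]
  have h1 : ∀ q : ℂ × ℂ, windowKernel κ 0 1 q * (fourierKernel α q.1 * fourierKernel α q.2) =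
      ((κ q.1 : ℂ) * fourierKernel α q.1) * ((κ q.2 : ℂ) * fourierKernel α q.2) := by
    intro q
    simp only [windowKernel, zero_mul, Real.exp_zero, mul_one]
    push_cast
    ring
  simp only [h1]
  rw [integral_prod_mul (fun ζ : ℂ => (κ ζ : ℂ) * fourierKernel α ζ)
    (fun ζ : ℂ => (κ ζ : ℂ) * fourierKernel α ζ)]
  change planeFourier (fun ζ => (κ ζ : ℂ)) α * planeFourier (fun ζ => (κ ζ : ℂ)) α = _
  have h2 := Complex.conj_eq_iff_re.1 (hκ.planeFourier_conj α)
  rw [← h2]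
  push_cast
  simp
  ring

theorem integrable_sq_planeFourier (hκ : IsWindow κ) :
    Integrable fun α => (planeFourier (fun ζ => (κ ζ : ℂ)) α).re ^ 2 := by
  obtain ⟨C, hC⟩ := hκ.exists_norm_shear_le 0 (s := 1) (by simp)
  exact integrable_of_planeFourier_nonneg (hκ.integrable_shear 0 (by simp)) hC
    (fun α => sq_nonneg _) hκ.planeFourier_shear_zero

/-- `κ(ζ) exp(2 Re(ζ z*))`. -/
noncomputable def _root_.PhaseSpace.tilt (κ : ℂ → ℝ) (z ζ : ℂ) : ℂ :=
  ((κ ζ * Real.exp (2 * ⟪ζ, z⟫_ℝ) : ℝ) : ℂ)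

theorem _root_.PhaseSpace.integral_gaussian_mul_exp_inner (ζ : ℂ) :
    ∫ z : ℂ, Real.exp (-1 * ‖z‖ ^ 2) * Real.exp (2 * ⟪ζ, z⟫_ℝ) =
      Real.pi * Real.exp (‖ζ‖ ^ 2) := by
  have h := GaussianFourier.integral_cexp_neg_mul_sq_norm_add (V := ℂ) (b := 1) (by simp) 2 ζ
  have h1 : ∀ z : ℂ, Complex.exp (-1 * ‖z‖ ^ 2 + 2 * (⟪ζ, z⟫_ℝ : ℝ)) =
      ((Real.exp (-1 * ‖z‖ ^ 2) * Real.exp (2 * ⟪ζ, z⟫_ℝ) : ℝ) : ℂ) := by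
    intro z
    rw [Complex.exp_add]
    push_cast
    rfl
  simp only [h1] at h
  rw [integral_complex_ofReal, Complex.finrank_real_complex] at h
  have h2 : ((Real.pi / 1 : ℂ) ^ (((2 : ℕ) : ℂ) / 2)) * Complex.exp (2 ^ 2 * ‖ζ‖ ^ 2 / (4 * 1)) =
      ((Real.pi * Real.exp (‖ζ‖ ^ 2) : ℝ) : ℂ) := by
    have h3 : (((2 : ℕ) : ℂ) / 2) = 1 := by norm_num
    rw [h3, Complex.cpow_one]
    push_cast
    congr 1
    · ring
    · congr 1; ring
  rw [h2] at h
  exact_mod_cast h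

/-- A Gaussian integral over `z` replaces `exp(|ζ + s η|²)` by `exp(2 Re(ζ z*)) exp(2 s Re(η z*))`,
which separates `ζ` from `η`. Fubini then makes the transform an average of products. -/
theorem planeFourier_shear_exp (hκ : IsWindow κ) {s : ℝ} (hs : |s| ≤ 1) (α : ℂ) :
    (Real.pi : ℂ) * planeFourier (shearIntegral (windowKernel κ 1 s)) α =
      ∫ z : ℂ, (Real.exp (-1 * ‖z‖ ^ 2) : ℂ) *
        (planeFourier (tilt κ z) α * planeFourier (tilt κ (s * z)) α) := by
  obtain ⟨M, hM0, hM⟩ := hκ.exists_windowKernel_le 1 hs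
  have hc := hκ.continuous
  rw [planeFourier_shearIntegral hM0 (hκ.continuous_windowKernel 1 s) hM]
  let F : ℂ → ℂ × ℂ → ℂ := fun z q => (Real.exp (-1 * ‖z‖ ^ 2) : ℂ) *
    ((tilt κ z q.1 * fourierKernel α q.1) * (tilt κ (s * z) q.2 * fourierKernel α q.2))
  have hF : Integrable (Function.uncurry F) (volume.prod (volume.prod volume)) := by
    have hi := hκ.integrable_mul_exp 4
    refine ((integrable_gaussian (b := 1 / 2) (by norm_num)).mul_prod
      (hi.mul_prod hi)).mono' ?_ (Eventually.of_forall fun q => ?_)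
    · refine Continuous.aestronglyMeasurable ?_
      simp only [F, tilt]
      unfold Function.uncurry
      fun_prop
    · obtain ⟨z, ζ, η⟩ := q
      simp only [Function.uncurry, F, tilt, norm_mul, norm_fourierKernel, mul_one,
        Complex.norm_real, Real.norm_eq_abs, Real.abs_exp, abs_of_nonneg (hκ.nonneg _)]
      -- Each of the two tilts uses up `‖z‖² / 4`, so half of the weight `exp(-‖z‖²)` survives; the
      -- window absorbs `exp(4 ‖x‖²)`.
      have hin : ∀ (x y : ℂ), ‖y‖ ≤ ‖z‖ → 2 * ⟪x, y⟫_ℝ ≤ 4 * ‖x‖ ^ 2 + 1 / 4 * ‖z‖ ^ 2 := by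
        intro x y hy
        have h1 := real_inner_le_norm x y
        have h2 : ‖x‖ * ‖y‖ ≤ ‖x‖ * ‖z‖ := mul_le_mul_of_nonneg_left hy (norm_nonneg _)
        nlinarith [sq_nonneg (2 * ‖x‖ - 1 / 2 * ‖z‖)]
      have h1 := hin ζ z le_rfl
      have h2 := hin η (s * z) (by
        rw [norm_mul, Complex.norm_real]
        exact mul_le_of_le_one_left (norm_nonneg _) hs)
      calc Real.exp (-1 * ‖z‖ ^ 2) *
            (κ ζ * Real.exp (2 * ⟪ζ, z⟫_ℝ) * (κ η * Real.exp (2 * ⟪η, s * z⟫_ℝ)))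
          = κ ζ * κ η * Real.exp (-1 * ‖z‖ ^ 2 + 2 * ⟪ζ, z⟫_ℝ + 2 * ⟪η, s * z⟫_ℝ) := by
            rw [Real.exp_add, Real.exp_add]; ring
        _ ≤ κ ζ * κ η * Real.exp (-(1 / 2) * ‖z‖ ^ 2 + 4 * ‖ζ‖ ^ 2 + 4 * ‖η‖ ^ 2) := by
            refine mul_le_mul_of_nonneg_left (Real.exp_le_exp.2 ?_)
              (mul_nonneg (hκ.nonneg _) (hκ.nonneg _))
            linarith
        _ = _ := by rw [Real.exp_add, Real.exp_add]; ring
  have h1 := integral_integral_swap hF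
  have h2 : ∀ z, ∫ q : ℂ × ℂ, F z q ∂(volume.prod volume) = (Real.exp (-1 * ‖z‖ ^ 2) : ℂ) *
      (planeFourier (tilt κ z) α * planeFourier (tilt κ (s * z)) α) := by
    intro z
    simp only [F]
    rw [integral_const_mul, integral_prod_mul (fun ζ => tilt κ z ζ * fourierKernel α ζ)
      (fun ζ => tilt κ (s * z) ζ * fourierKernel α ζ)]
    rfl
  simp only [h2] at h1
  rw [h1, ← integral_const_mul]
  refine integral_congr_ae (Eventually.of_forall fun q => ?_)
  simp only [F, tilt, windowKernel]
  have h3 : ∀ z : ℂ, (Real.exp (-1 * ‖z‖ ^ 2) : ℂ) *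
      (((κ q.1 * Real.exp (2 * ⟪q.1, z⟫_ℝ) : ℝ) : ℂ) * fourierKernel α q.1 *
        (((κ q.2 * Real.exp (2 * ⟪q.2, s * z⟫_ℝ) : ℝ) : ℂ) * fourierKernel α q.2)) =
      ((κ q.1 * κ q.2 : ℝ) : ℂ) * (fourierKernel α q.1 * fourierKernel α q.2) *
      ((Real.exp (-1 * ‖z‖ ^ 2) * Real.exp (2 * ⟪q.1 + s * q.2, z⟫_ℝ) : ℝ) : ℂ) := by
    intro z
    have h4 : ⟪q.1 + s * q.2, z⟫_ℝ = ⟪q.1, z⟫_ℝ + ⟪q.2, s * z⟫_ℝ := by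
      rw [inner_add_left, ← Complex.real_smul, ← Complex.real_smul, real_inner_smul_left,
        real_inner_smul_right]
    rw [h4, mul_add, Real.exp_add]
    push_cast
    ring
  simp only [h3]
  rw [integral_const_mul, integral_complex_ofReal, integral_gaussian_mul_exp_inner, one_mul]
  push_cast
  ring

theorem planeFourier_tilt_neg (hκ : IsWindow κ) (z α : ℂ) :
    planeFourier (tilt κ (-z)) α = starRingEnd ℂ (planeFourier (tilt κ z) α) := by
  rw [planeFourier, planeFourier, ← integral_conj, ← integral_neg_eq_self]
  refine integral_congr_ae (Eventually.of_forall fun ζ => ?_)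
  simp only [map_mul, tilt, Complex.conj_ofReal, conj_fourierKernel, hκ.even, inner_neg_neg,
    fourierKernel_neg_right]

/-- The Fourier transform of `(κ ∗ κ)(ξ) exp(|ξ|²)` is integrable. -/
theorem integrable_planeFourier_shear_exp (hκ : IsWindow κ) :
    Integrable (planeFourier (shearIntegral (windowKernel κ 1 1))) := by
  obtain ⟨C, hC⟩ := hκ.exists_norm_shear_le 1 (s := -1) (by simp)
  -- `F` is the transform for `s = -1`: the opposite tilt gives the complex conjugate, so the
  -- integrand is nonnegative. The same `F` bounds the modulus of the transform for `s = 1`.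
  let F : ℂ → ℝ := fun α => Real.pi⁻¹ *
    ∫ z : ℂ, Real.exp (-1 * ‖z‖ ^ 2) * ‖planeFourier (tilt κ z) α‖ ^ 2
  have hF : ∀ α, planeFourier (shearIntegral (windowKernel κ 1 (-1))) α = F α := by
    intro α
    have h1 := hκ.planeFourier_shear_exp (s := -1) (by simp) α
    have h2 : ∀ z : ℂ, (Real.exp (-1 * ‖z‖ ^ 2) : ℂ) *
        (planeFourier (tilt κ z) α * planeFourier (tilt κ ((-1 : ℝ) * z)) α) =
        ((Real.exp (-1 * ‖z‖ ^ 2) * ‖planeFourier (tilt κ z) α‖ ^ 2 : ℝ) : ℂ) := by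
      intro z
      have h3 : ((-1 : ℝ) : ℂ) * z = -z := by push_cast; ring
      rw [h3, hκ.planeFourier_tilt_neg, Complex.mul_conj']
      push_cast
      rfl
    simp only [h2] at h1
    rw [integral_complex_ofReal] at h1
    simp only [F]
    rw [Complex.ofReal_mul, ← h1, Complex.ofReal_inv, inv_mul_cancel_left₀]
    exact_mod_cast Real.pi_ne_zero
  have hFi : Integrable F := integrable_of_planeFourier_nonneg
    (hκ.integrable_shear 1 (by simp)) hC (fun α => mul_nonneg (inv_nonneg.2 Real.pi_pos.le)
      (integral_nonneg fun z => mul_nonneg (Real.exp_pos _).le (sq_nonneg _))) hF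
  refine hFi.mono' (continuous_planeFourier (hκ.integrable_shear 1 (by simp))).aestronglyMeasurable
    (Eventually.of_forall fun α => ?_)
  have h1 := hκ.planeFourier_shear_exp (s := 1) (by simp) α
  have h2 : ‖(Real.pi : ℂ) * planeFourier (shearIntegral (windowKernel κ 1 1)) α‖ ≤
      ∫ z : ℂ, Real.exp (-1 * ‖z‖ ^ 2) * ‖planeFourier (tilt κ z) α‖ ^ 2 := by
    rw [h1]
    refine (norm_integral_le_integral_norm _).trans_eq ?_
    refine integral_congr_ae (Eventually.of_forall fun z => ?_)
    simp only [norm_mul, Complex.norm_real, Real.norm_eq_abs, Real.abs_exp, Complex.ofReal_one,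
      one_mul]
    ring
  rw [norm_mul, Complex.norm_real, Real.norm_eq_abs, abs_of_pos Real.pi_pos] at h2
  simp only [F]
  rw [inv_mul_eq_div, le_div_iff₀ Real.pi_pos]
  linarith

end IsWindow

end Window

/-! ### The nonclassicality filters are physical and tend to one. -/

section NonclassicalityFilter

variable {q L : ℝ}

/-- The crossover is at `r = (|a| / c) ^ (1 / (q - 2))`: beyond it the power `q > 2` wins, and
before it the quadratic term is bounded by its value there. -/
theorem exists_sq_sub_rpow_le (hq : 2 < q) {c : ℝ} (hc : 0 < c) (a : ℝ) :
    ∃ M, ∀ r : ℝ, 0 ≤ r → a * r ^ 2 - c * r ^ q ≤ M := by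
  have hq' : 0 < q - 2 := by linarith
  refine ⟨|a| * ((|a| / c) ^ (q - 2)⁻¹) ^ 2, fun r hr => ?_⟩
  have hac : 0 ≤ |a| / c := by positivity
  have har : a * r ^ 2 ≤ |a| * r ^ 2 := mul_le_mul_of_nonneg_right (le_abs_self a) (sq_nonneg r)
  rcases le_total r ((|a| / c) ^ (q - 2)⁻¹) with h | h
  · have h1 : 0 ≤ c * r ^ q := by positivity
    have h2 : |a| * r ^ 2 ≤ |a| * ((|a| / c) ^ (q - 2)⁻¹) ^ 2 := by gcongr
    linarith
  · have h1 : |a| / c ≤ r ^ (q - 2) := by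
      have := Real.rpow_le_rpow (by positivity) h hq'.le
      rwa [Real.rpow_inv_rpow hac hq'.ne'] at this
    have h2 : |a| ≤ c * r ^ (q - 2) := by
      rw [div_le_iff₀ hc] at h1
      linarith
    have h3 : r ^ q = r ^ (q - 2) * r ^ 2 := by
      rw [← Real.rpow_natCast r 2, ← Real.rpow_add' hr (by push_cast; linarith)]
      congr 1
      push_cast
      ring
    have h4 : |a| * r ^ 2 ≤ c * r ^ q := by
      rw [h3, ← mul_assoc]
      exact mul_le_mul_of_nonneg_right h2 (sq_nonneg r)
    have h5 : 0 ≤ |a| * ((|a| / c) ^ (q - 2)⁻¹) ^ 2 := by positivity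
    linarith

theorem isWindow_omegaFn (hq : 2 < q) (hL : 0 < L) : IsWindow (omegaFn q L) where
  continuous := by
    unfold omegaFn
    have : Continuous fun ξ : ℂ => ‖ξ‖ ^ q :=
      continuous_norm.rpow_const fun _ => Or.inr (by linarith)
    fun_prop
  nonneg ζ := by unfold omegaFn; positivity
  even ζ := by simp [omegaFn]
  decay a := by
    obtain ⟨M, hM⟩ := exists_sq_sub_rpow_le hq (c := (L ^ q)⁻¹) (by positivity) a
    refine ⟨(1 / L) * 2 ^ (1 / q) * √(q / (2 * Real.pi * Real.Gamma (2 / q))) * Real.exp M,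
      fun ζ => ?_⟩
    rw [omegaFn, mul_assoc, ← Real.exp_add]
    refine mul_le_mul_of_nonneg_left (Real.exp_le_exp.2 ?_) (by positivity)
    have := hM ‖ζ‖ (norm_nonneg _)
    rw [div_eq_inv_mul]
    linarith

theorem shearIntegral_omegaFn (q L a : ℝ) (ξ : ℂ) :
    shearIntegral (windowKernel (omegaFn q L) a 1) ξ =
      nonclassicalityFilter q L ξ * Real.exp (a * ‖ξ‖ ^ 2) :=
  IsWindow.shear_one _ _ _

theorem nonclassicalityFilter_eq_shear (q L : ℝ) :
    nonclassicalityFilter q L = shearIntegral (windowKernel (omegaFn q L) 0 1) := by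
  funext ξ
  rw [shearIntegral_omegaFn]
  simp

theorem omegaFn_eq_scale (hL : 0 < L) (ζ : ℂ) :
    omegaFn q L ζ = L⁻¹ * omegaFn q 1 (L⁻¹ • ζ) := by
  simp only [omegaFn, norm_smul, Real.norm_eq_abs, abs_of_pos (inv_pos.2 hL), Real.one_rpow,
    div_one, one_mul, one_div]
  rw [Real.mul_rpow (inv_pos.2 hL).le (norm_nonneg _), Real.inv_rpow hL.le, div_eq_inv_mul]
  ring_nf

/-- The prefactor `1 / L` of each window compensates the area factor `L²` of the substitution. Hence
`L → ∞` amounts to evaluating one fixed filter near `0`. -/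
theorem nonclassicalityFilter_eq_scale (hL : 0 < L) (ξ : ℂ) :
    nonclassicalityFilter q L ξ = nonclassicalityFilter q 1 (L⁻¹ • ξ) := by
  let f : ℂ → ℝ := fun η => omegaFn q 1 η * omegaFn q 1 (L⁻¹ • ξ - η)
  have h1 : ∀ ζ : ℂ, omegaFn q L ζ * omegaFn q L (ξ - ζ) = (L⁻¹) ^ 2 * f (L⁻¹ • ζ) := by
    intro ζ
    simp only [f]
    rw [omegaFn_eq_scale hL, omegaFn_eq_scale hL (ξ - ζ), smul_sub]
    ring
  rw [nonclassicalityFilter, nonclassicalityFilter, integral_congr_ae (Eventually.of_forall h1),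
    integral_const_mul, Measure.integral_comp_inv_smul_of_nonneg volume f hL.le,
    Complex.finrank_real_complex, smul_eq_mul, ← mul_assoc, ← mul_pow, inv_mul_cancel₀ hL.ne',
    one_pow, one_mul]

/-- This is the `L²` normalisation of the window: `∫ exp(-2 |ζ|^q) = π 2^(-2/q) Γ(2/q + 1)` cancels
against the squared constant. -/
theorem nonclassicalityFilter_one_zero (hq : 2 < q) : nonclassicalityFilter q 1 0 = 1 := by
  have hq0 : 0 < q := by linarith
  have hG : 0 < Real.Gamma (2 / q) := Real.Gamma_pos_of_pos (by positivity)
  have h1 : ∀ ζ : ℂ, omegaFn q 1 ζ * omegaFn q 1 (0 - ζ) =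
      (2 ^ (2 / q) * (q / (2 * Real.pi * Real.Gamma (2 / q)))) *
        Real.exp (-2 * ‖ζ‖ ^ q) := by
    intro ζ
    have h2 : (2 : ℝ) ^ (2 / q) = 2 ^ (1 / q) * 2 ^ (1 / q) := by
      rw [← Real.rpow_add two_pos]; congr 1; ring
    have h3 : Real.exp (-2 * ‖ζ‖ ^ q) = Real.exp (-‖ζ‖ ^ q) * Real.exp (-‖ζ‖ ^ q) := by
      rw [← Real.exp_add]; congr 1; ring
    have h4 := Real.mul_self_sqrt
      (show 0 ≤ q / (2 * Real.pi * Real.Gamma (2 / q)) by positivity)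
    rw [h2, h3, ← h4]
    simp only [omegaFn, zero_sub, norm_neg, Real.one_rpow, div_one, one_mul]
    generalize √(q / (2 * Real.pi * Real.Gamma (2 / q))) = N
    ring
  rw [nonclassicalityFilter]
  simp only [h1]
  rw [integral_const_mul, Complex.integral_exp_neg_mul_rpow (by linarith) two_pos,
    Real.Gamma_add_one (by positivity), neg_div, Real.rpow_neg two_pos.le]
  have h5 : (0 : ℝ) < 2 ^ (2 / q) := by positivity
  have h6 := Real.pi_pos
  norm_cast
  field_simp

theorem nonclassicalityFilter_zero (hq : 2 < q) (hL : 0 < L) :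
    nonclassicalityFilter q L 0 = 1 := by
  rw [nonclassicalityFilter_eq_scale hL, smul_zero, nonclassicalityFilter_one_zero hq]

theorem continuous_nonclassicalityFilter (hq : 2 < q) (hL : 0 < L) :
    Continuous (nonclassicalityFilter q L) := by
  rw [nonclassicalityFilter_eq_shear]
  exact (isWindow_omegaFn hq hL).continuous_shear 0 (by simp)

theorem integrable_nonclassicalityFilter (hq : 2 < q) (hL : 0 < L) :
    Integrable (nonclassicalityFilter q L) := by
  rw [nonclassicalityFilter_eq_shear]
  exact (isWindow_omegaFn hq hL).integrable_shear 0 (by simp)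

theorem tendsto_nonclassicalityFilter (hq : 2 < q) (ξ : ℂ) :
    Tendsto (fun L => nonclassicalityFilter q L ξ) atTop (𝓝 1) := by
  have h1 : Tendsto (fun L : ℝ => L⁻¹ • ξ) atTop (𝓝 0) := by
    simpa using (tendsto_inv_atTop_zero (𝕜 := ℝ)).smul_const ξ
  have h2 := ((continuous_nonclassicalityFilter hq one_pos).tendsto 0).comp h1
  rw [nonclassicalityFilter_one_zero hq] at h2
  refine h2.congr' ?_
  filter_upwards [eventually_gt_atTop 0] with L hL
  exact (nonclassicalityFilter_eq_scale hL ξ).symm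

theorem nonclassicalityDensity_eq (hq : 2 < q) (hL : 0 < L) (α : ℂ) :
    nonclassicalityDensity q L α =
      (Real.pi ^ 2)⁻¹ * (planeFourier (fun ζ => (omegaFn q L ζ : ℂ)) α).re ^ 2 := by
  have h1 := (isWindow_omegaFn hq hL).planeFourier_shear_zero α
  rw [← nonclassicalityFilter_eq_shear, planeFourier] at h1
  rw [nonclassicalityDensity, h1, one_div]
  norm_cast

/-- The density is a square by `nonclassicalityDensity_eq`, its integrability permits Fourier
inversion, and inversion at `ξ = 0` gives total mass one. -/
theorem isPhysicalFilter_nonclassicality (hq : 2 < q) (hL : 0 < L) :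
    IsPhysicalFilter (nonclassicalityFilter q L) (nonclassicalityDensity q L) := by
  have hw := isWindow_omegaFn hq hL
  have hi : Integrable (nonclassicalityDensity q L) := by
    have := hw.integrable_sq_planeFourier.const_mul (Real.pi ^ 2)⁻¹
    exact this.congr (Eventually.of_forall fun α => (nonclassicalityDensity_eq hq hL α).symm)
  have hpi : (Real.pi : ℂ) ≠ 0 := by exact_mod_cast Real.pi_ne_zero
  have hF : ∀ α, planeFourier (nonclassicalityFilter q L) α =
      (Real.pi : ℂ) ^ 2 * nonclassicalityDensity q L α := by
    intro α
    rw [nonclassicalityFilter_eq_shear, hw.planeFourier_shear_zero,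
      nonclassicalityDensity_eq hq hL]
    push_cast
    field_simp
  have hinv : ∀ ξ, nonclassicalityFilter q L ξ =
      ∫ α, (nonclassicalityDensity q L α : ℂ) * fourierKernel ξ α := by
    intro ξ
    have h1 := planeFourier_inversion (integrable_nonclassicalityFilter hq hL)
      (continuous_nonclassicalityFilter hq hL)
      (((hi.ofReal : Integrable fun α => (nonclassicalityDensity q L α : ℂ)).const_mul
        ((Real.pi : ℂ) ^ 2)).congr (Eventually.of_forall fun α => (hF α).symm)) ξ
    simp only [hF, mul_assoc] at h1
    rw [integral_const_mul] at h1
    exact (mul_left_cancel₀ (pow_ne_zero 2 hpi) h1).symm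
  refine ⟨fun α => ?_, hi, ?_, hinv⟩
  · rw [nonclassicalityDensity_eq hq hL]
    positivity
  · have h1 := hinv 0
    simp only [fourierKernel_zero_left, mul_one] at h1
    rw [nonclassicalityFilter_zero hq hL, integral_complex_ofReal] at h1
    exact_mod_cast h1.symm

end NonclassicalityFilter

/-! ### Totality of coherent states. -/

section Totality

open scoped FourierTransform

/-- An integrable function on the line with vanishing Fourier transform vanishes. -/
theorem ae_eq_zero_of_fourier_eq_zero {f : ℝ → ℂ} (hf : Integrable f) (h : ∀ w, 𝓕 f w = 0) :
    f =ᵐ[volume] 0 := by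
  refine ae_eq_zero_of_integral_contDiff_smul_eq_zero hf.locallyIntegrable fun g hg hgc => ?_
  have hgc' : HasCompactSupport fun x => (g x : ℂ) := hgc.comp_left Complex.ofReal_zero
  have hg' : ContDiff ℝ ∞ fun x => (g x : ℂ) := Complex.ofRealCLM.contDiff.comp hg
  -- Every test function is the Fourier transform of a Schwartz function `K`, so the transform can
  -- be moved onto `f`, where it vanishes.
  let G : SchwartzMap ℝ ℂ := hgc'.toSchwartzMap hg'
  let K : SchwartzMap ℝ ℂ := 𝓕⁻ G
  have hK : ∀ x, 𝓕 (K : ℝ → ℂ) x = g x := by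
    intro x
    rw [← SchwartzMap.fourier_coe, FourierTransform.fourier_fourierInv_eq]
    rfl
  have h1 := VectorFourier.integral_fourierIntegral_smul_eq_flip (L := innerₗ ℝ)
    Real.continuous_fourierChar continuous_inner hf (K.integrable (μ := volume))
  have h2 : ∀ ξ, VectorFourier.fourierIntegral Real.fourierChar volume (innerₗ ℝ) f ξ = 0 := h
  have h3 : ∀ x, VectorFourier.fourierIntegral Real.fourierChar volume (innerₗ ℝ).flip K x =
      g x := by
    intro x
    rw [flip_innerₗ]
    exact hK x
  simp only [h2, h3, zero_smul, integral_zero] at h1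
  rw [h1]
  refine integral_congr_ae (Eventually.of_forall fun x => ?_)
  simp [mul_comm]

/-- Coherent states are total. -/
theorem eq_zero_of_inner_coherentState {χ : Mode} (h : ∀ β, ⟪coherentState β, χ⟫_ℂ = 0) :
    χ = 0 := by
  have hi : Integrable fun x => ⟪(vacuum : Mode) x, χ x⟫_ℂ := L2.integrable_inner vacuum χ
  have hF : ∀ w, 𝓕 (fun x => ⟪(vacuum : Mode) x, χ x⟫_ℂ) w = 0 := by
    intro w
    -- Purely imaginary amplitudes suffice: they multiply the vacuum by `exp(2 π i w x)`, so the
    -- inner products are the Fourier transform of the vacuum times `χ`.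
    rw [← h (((√2 * Real.pi * w : ℝ) : ℂ) * Complex.I), L2.inner_def, Real.fourier_eq']
    refine integral_congr_ae ?_
    filter_upwards [displacement_ae (((√2 * Real.pi * w : ℝ) : ℂ) * Complex.I) vacuum] with x hx
    rw [coherentState, hx]
    simp only [Complex.re_ofReal_mul, Complex.im_ofReal_mul, Complex.I_re, Complex.I_im, mul_zero,
      mul_one, zero_mul, sub_zero, RCLike.inner_apply, map_mul, smul_eq_mul, ← Complex.exp_conj,
      Complex.conj_I, Complex.conj_ofReal]
    have h2 : √2 * (√2 * Real.pi * w) * x = 2 * Real.pi * (x * w) := by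
      rw [← mul_assoc, ← mul_assoc, Real.mul_self_sqrt two_pos.le]; ring
    rw [h2]
    have h3 : Complex.exp (((-2 * Real.pi * (w * starRingEnd ℝ x) : ℝ) : ℂ) * Complex.I) =
        Complex.exp (-Complex.I * ((2 * Real.pi * (x * w) : ℝ) : ℂ)) := by
      congr 1
      simp
      ring
    rw [h3]
    ring
  have h0 := ae_eq_zero_of_fourier_eq_zero hi hF
  refine Lp.ext ?_
  filter_upwards [h0, vacuum_ae, Lp.coeFn_zero ℂ 2 (volume : Measure ℝ)] with x h1 h2 h3
  rw [h3]
  simp only [h2, RCLike.inner_apply, Pi.zero_apply, mul_eq_zero, Complex.conj_ofReal,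
    Complex.ofReal_eq_zero] at h1 ⊢
  refine h1.resolve_right (not_or.2 ⟨?_, (Real.exp_pos _).ne'⟩)
  positivity

end Totality

/-! ### The vacuum projection as a Gaussian integral of displacements, and injectivity of the
characteristic function. -/

section VacuumProjection

theorem integral_cexp_gaussian_linear (u v : ℂ) :
    ∫ ξ : ℂ, Complex.exp (-(ξ * starRingEnd ℂ ξ) + u * ξ + v * starRingEnd ℂ ξ) =
      Real.pi * Complex.exp (u * v) := by
  rw [← (Complex.volume_preserving_equiv_real_prod.symm).integral_comp
    Complex.measurableEquivRealProd.symm.measurableEmbedding]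
  have h1 : ∀ z : ℝ × ℝ, Complex.exp (-(Complex.measurableEquivRealProd.symm z *
      starRingEnd ℂ (Complex.measurableEquivRealProd.symm z)) +
      u * Complex.measurableEquivRealProd.symm z +
      v * starRingEnd ℂ (Complex.measurableEquivRealProd.symm z)) =
      Complex.exp (-1 * z.1 ^ 2 + (u + v) * z.1 + 0) *
        Complex.exp (-1 * z.2 ^ 2 + (Complex.I * (u - v)) * z.2 + 0) := by
    intro z
    have h2 : Complex.measurableEquivRealProd.symm z = z.1 + z.2 * Complex.I := by
      apply Complex.ext <;> simp [Complex.measurableEquivRealProd]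
    rw [h2, ← Complex.exp_add]
    congr 1
    simp only [map_add, map_mul, Complex.conj_ofReal, Complex.conj_I]
    linear_combination (z.2 : ℂ) ^ 2 * Complex.I_sq
  simp only [h1]
  rw [Measure.volume_eq_prod, integral_prod_mul
    (fun x : ℝ => Complex.exp (-1 * (x : ℂ) ^ 2 + (u + v) * x + 0))
    (fun x : ℝ => Complex.exp (-1 * (x : ℂ) ^ 2 + (Complex.I * (u - v)) * x + 0)),
    integral_cexp_quadratic (by simp), integral_cexp_quadratic (by simp), mul_mul_mul_comm,
    ← Complex.exp_add, neg_neg, div_one, ← Complex.cpow_add _ _ (by exact_mod_cast Real.pi_ne_zero)]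
  norm_num
  congr 1
  linear_combination (u - v) ^ 2 / 4 * Complex.I_sq

/-- `∫ exp(-|ξ|²/2) ⟨φ, D(ξ) ψ⟩ d²ξ`. -/
noncomputable def vacuumForm (φ ψ : Mode) : ℂ :=
  ∫ ξ : ℂ, (Real.exp (-‖ξ‖ ^ 2 / 2) : ℂ) * ⟪φ, displacement ξ ψ⟫_ℂ

theorem integrable_gaussian_half : Integrable fun ξ : ℂ => Real.exp (-‖ξ‖ ^ 2 / 2) := by
  refine (integrable_gaussian (b := 1 / 2) (by norm_num)).congr
    (Eventually.of_forall fun ξ => ?_)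
  simp only
  congr 1
  ring

theorem integrable_gaussian_smul_displacement (ψ : Mode) :
    Integrable fun ξ : ℂ => (Real.exp (-‖ξ‖ ^ 2 / 2) : ℂ) • displacement ξ ψ := by
  have hc := continuous_displacement ψ
  refine (integrable_gaussian_half.mul_const ‖ψ‖).mono'
    (by fun_prop : Continuous _).aestronglyMeasurable (Eventually.of_forall fun ξ => ?_)
  rw [norm_smul, norm_displacement, Complex.norm_real, Real.norm_eq_abs, Real.abs_exp]

theorem vacuumForm_eq_inner (φ ψ : Mode) :
    vacuumForm φ ψ =
      ⟪φ, ∫ ξ : ℂ, (Real.exp (-‖ξ‖ ^ 2 / 2) : ℂ) • displacement ξ ψ⟫_ℂ := by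
  rw [← integral_inner (integrable_gaussian_smul_displacement ψ)]
  simp only [inner_smul_right, vacuumForm]

theorem vacuumForm_symm (φ ψ : Mode) :
    vacuumForm φ ψ = starRingEnd ℂ (vacuumForm ψ φ) := by
  rw [vacuumForm, vacuumForm, ← integral_conj, ← integral_neg_eq_self]
  refine integral_congr_ae (Eventually.of_forall fun ξ => ?_)
  simp only [norm_neg, map_mul, Complex.conj_ofReal, inner_conj_symm]
  rw [← adjoint_displacement, ContinuousLinearMap.adjoint_inner_right]

/-- The Weyl relation reduces the integrand to one vacuum expectation, leaving a Gaussian integral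
with linear terms in `ξ` and `ξ*`; its value cancels the mixed term `β* γ`. -/
theorem vacuumForm_coherentState (β γ : ℂ) :
    vacuumForm (coherentState β) (coherentState γ) =
      Real.pi * (⟪coherentState β, vacuum⟫_ℂ * ⟪vacuum, coherentState γ⟫_ℂ) := by
  have hsq : ∀ z : ℂ, ((Real.exp (-‖z‖ ^ 2 / 2) : ℝ) : ℂ) =
      Complex.exp (-(z * starRingEnd ℂ z) / 2) := by
    intro z
    rw [Complex.mul_conj']
    push_cast
    rfl
  have h1 : ∀ ξ : ℂ, (Real.exp (-‖ξ‖ ^ 2 / 2) : ℂ) *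
      ⟪coherentState β, displacement ξ (coherentState γ)⟫_ℂ =
      Complex.exp (-(γ * starRingEnd ℂ γ) / 2 - (β * starRingEnd ℂ β) / 2 +
        starRingEnd ℂ β * γ) *
      Complex.exp (-(ξ * starRingEnd ℂ ξ) + starRingEnd ℂ β * ξ + (-γ) * starRingEnd ℂ ξ) := by
    intro ξ
    rw [coherentState, ← ContinuousLinearMap.adjoint_inner_right, adjoint_displacement,
      coherentState, displacement_apply_displacement ξ γ, map_smul,
      displacement_apply_displacement, inner_smul_right, inner_smul_right, inner_vacuum_displacement_vacuum, hsq, hsq,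
      ← Complex.exp_add, ← Complex.exp_add, ← Complex.exp_add, ← Complex.exp_add]
    congr 1
    simp only [map_add, map_neg]
    ring
  have h2 : ⟪coherentState β, vacuum⟫_ℂ = Complex.exp (-(β * starRingEnd ℂ β) / 2) := by
    rw [← inner_conj_symm, coherentState, inner_vacuum_displacement_vacuum, Complex.conj_ofReal,
      hsq]
  have h3 : ⟪vacuum, coherentState γ⟫_ℂ = Complex.exp (-(γ * starRingEnd ℂ γ) / 2) := by
    rw [coherentState, inner_vacuum_displacement_vacuum, hsq]
  rw [h2, h3, vacuumForm]
  simp only [h1]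
  rw [integral_const_mul, integral_cexp_gaussian_linear, mul_left_comm, ← Complex.exp_add,
    ← Complex.exp_add]
  congr 2
  ring

/-- `∫ exp(-|ξ|²/2) D(ξ) d²ξ = π |0⟩⟨0|`. -/
theorem vacuumForm_eq (φ ψ : Mode) :
    vacuumForm φ ψ = Real.pi * (⟪φ, vacuum⟫_ℂ * ⟪vacuum, ψ⟫_ℂ) := by
  -- Totality extends the identity in the left argument. It is used for a coherent right argument,
  -- then once more after exchanging the arguments by `vacuumForm_symm`.
  have step : ∀ ψ : Mode, (∀ β, vacuumForm (coherentState β) ψ =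
      Real.pi * (⟪coherentState β, vacuum⟫_ℂ * ⟪vacuum, ψ⟫_ℂ)) → ∀ φ,
      vacuumForm φ ψ = Real.pi * (⟪φ, vacuum⟫_ℂ * ⟪vacuum, ψ⟫_ℂ) := by
    intro ψ h φ
    have h1 : (∫ ξ : ℂ, (Real.exp (-‖ξ‖ ^ 2 / 2) : ℂ) • displacement ξ ψ) -
        ((Real.pi : ℂ) * ⟪vacuum, ψ⟫_ℂ) • vacuum = 0 := by
      refine eq_zero_of_inner_coherentState fun β => ?_
      rw [inner_sub_right, ← vacuumForm_eq_inner, h, inner_smul_right]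
      ring
    rw [vacuumForm_eq_inner, sub_eq_zero.1 h1, inner_smul_right]
    ring
  refine step ψ (fun β => ?_) φ
  rw [vacuumForm_symm, step _ (fun γ => vacuumForm_coherentState γ β)]
  simp only [map_mul, inner_conj_symm, Complex.conj_ofReal]
  ring

variable {T : Mode →L[ℂ] Mode} {w v : basisIndex Mode → Mode}

theorem HasRankOneSum.integral_gaussian_mul_charFn (h : HasRankOneSum w v T) :
    ∫ ξ : ℂ, (Real.exp (-‖ξ‖ ^ 2 / 2) : ℂ) * charFn T ξ =
      Real.pi * ⟪vacuum, T vacuum⟫_ℂ := by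
  have hi : ∀ k, Integrable fun ξ : ℂ =>
      (Real.exp (-‖ξ‖ ^ 2 / 2) : ℂ) * ⟪v k, displacement ξ (w k)⟫_ℂ := by
    intro k
    have := (integrable_gaussian_smul_displacement (w k)).const_inner (𝕜 := ℂ) (v k)
    simpa only [inner_smul_right] using this
  have hs : Summable fun k => ∫ ξ : ℂ,
      ‖(Real.exp (-‖ξ‖ ^ 2 / 2) : ℂ) * ⟪v k, displacement ξ (w k)⟫_ℂ‖ := by
    refine .of_nonneg_of_le (fun k => integral_nonneg fun ξ => norm_nonneg _) (fun k => ?_)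
      (h.summable_norm_mul_norm.mul_left (∫ ξ : ℂ, Real.exp (-‖ξ‖ ^ 2 / 2)))
    rw [← integral_mul_const]
    refine integral_mono (hi k).norm (integrable_gaussian_half.mul_const _) fun ξ => ?_
    simp only
    rw [norm_mul, Complex.norm_real, Real.norm_eq_abs, Real.abs_exp]
    refine mul_le_mul_of_nonneg_left ?_ (Real.exp_pos _).le
    refine (norm_inner_le_norm _ _).trans_eq ?_
    rw [norm_displacement, mul_comm]
  have h1 := hasSum_integral_of_summable_integral_norm hi hs
  have h2 := ((h.hasSum_inner vacuum vacuum).mul_left (Real.pi : ℂ))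
  have h3 : ∀ k, ∫ ξ : ℂ, (Real.exp (-‖ξ‖ ^ 2 / 2) : ℂ) * ⟪v k, displacement ξ (w k)⟫_ℂ =
      Real.pi * (⟪vacuum, w k⟫_ℂ * ⟪v k, vacuum⟫_ℂ) := by
    intro k
    have := vacuumForm_eq (v k) (w k)
    rw [vacuumForm] at this
    rw [this, mul_comm ⟪vacuum, w k⟫_ℂ]
  simp only [h3, tsum_mul_left, ← h.charFn_eq] at h1
  exact h1.unique h2

/-- Multiplying by displacements on both sides only shifts the argument and adds Weyl phases, so
vanishing of the characteristic function is inherited. -/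
theorem HasRankOneSum.charFn_displacement_comp (h : HasRankOneSum w v T) (α β ξ : ℂ) :
    ∃ c : ℂ, charFn (displacement β ∘L T ∘L displacement α) ξ = c * charFn T (α + (ξ + β)) := by
  refine ⟨Complex.exp ((ξ * (starRingEnd ℂ) β - (starRingEnd ℂ) ξ * β) / 2) *
    Complex.exp ((α * (starRingEnd ℂ) (ξ + β) - (starRingEnd ℂ) α * (ξ + β)) / 2), ?_⟩
  have h1 := (h.comp_right (displacement α)).comp_left (displacement β)
  rw [h1.charFn_eq, h.charFn_eq, ← tsum_mul_left]
  refine tsum_congr fun k => ?_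
  rw [ContinuousLinearMap.adjoint_inner_left, displacement_apply_displacement ξ β, map_smul,
    displacement_apply_displacement, inner_smul_right, inner_smul_right, mul_assoc]

/-- A trace-class operator is determined by its characteristic function. -/
theorem eq_zero_of_charFn_eq_zero (hT : IsTraceClass T) (h0 : ∀ ξ, charFn T ξ = 0) : T = 0 := by
  obtain ⟨w, v, h, -⟩ := hT.exists_hasRankOneSum
  have h1 : ∀ α β, ⟪coherentState β, T (coherentState α)⟫_ℂ = 0 := by
    intro α β
    -- The vacuum entry of `D(-β) T D(α)` is the entry of `T` between coherent states, and the
    -- Gaussian integral recovers it from the characteristic function.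
    have h2 := ((h.comp_right (displacement α)).comp_left
      (displacement (-β))).integral_gaussian_mul_charFn
    have h3 : ∀ ξ, charFn (displacement (-β) ∘L T ∘L displacement α) ξ = 0 := by
      intro ξ
      obtain ⟨c, hc⟩ := h.charFn_displacement_comp α (-β) ξ
      rw [hc, h0, mul_zero]
    simp only [h3, mul_zero, integral_zero] at h2
    have h4 := (mul_eq_zero.1 h2.symm).resolve_left (by exact_mod_cast Real.pi_ne_zero)
    rw [coherentState, ← ContinuousLinearMap.adjoint_inner_right, adjoint_displacement]
    exact h4
  have h2 : ∀ α, T (coherentState α) = 0 := fun α => eq_zero_of_inner_coherentState (h1 α)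
  have h3 : ∀ x, ContinuousLinearMap.adjoint T x = 0 := fun x =>
    eq_zero_of_inner_coherentState fun α => by
      rw [ContinuousLinearMap.adjoint_inner_right, h2, inner_zero_left]
  ext1 y
  refine ext_inner_left ℂ fun x => ?_
  rw [← ContinuousLinearMap.adjoint_inner_left, h3]
  simp

/-- The Fourier transform of `Φ_ρ(ξ) exp(-|ξ|²/2)` is `π` times the Husimi function. -/
theorem planeFourier_husimi (hT : IsTraceClass T) (α : ℂ) :
    planeFourier (fun ξ => charFn T ξ * Real.exp (-‖ξ‖ ^ 2 / 2)) α =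
      Real.pi * ⟪coherentState α, T (coherentState α)⟫_ℂ := by
  obtain ⟨w, v, h, -⟩ := hT.exists_hasRankOneSum
  have h1 := (h.conj_displacement (-α)).integral_gaussian_mul_charFn
  rw [planeFourier]
  refine Eq.trans (integral_congr_ae (Eventually.of_forall fun ξ => ?_)) (h1.trans ?_)
  · simp only [charFn_conj_displacement hT, fourierKernel_neg_right]
    ring
  · rw [ContinuousLinearMap.comp_apply, ContinuousLinearMap.comp_apply,
      adjoint_displacement, neg_neg, ← adjoint_displacement,
      ContinuousLinearMap.adjoint_inner_right]
    rfl

end VacuumProjection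

/-! ### Integrals of coherent projections. -/

section CoherentProjections

theorem norm_coherentState (α : ℂ) : ‖coherentState α‖ = 1 := by
  rw [coherentState, norm_displacement, norm_vacuum]

theorem hasRankOneSum_coherentProj (α : ℂ) : HasRankOneSum (fun _ : Unit => coherentState α)
    (fun _ => coherentState α) (coherentProj α) where
  summable_left := .of_finite
  summable_right := .of_finite
  hasSum_inner x y := by
    simp [coherentProj, mul_comm]

theorem continuous_coherentProj : Continuous coherentProj :=
  continuous_rankOne_apply (continuous_displacement vacuum) (continuous_displacement vacuum)

theorem norm_coherentProj (α : ℂ) : ‖coherentProj α‖ = 1 := by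
  simp [coherentProj, norm_coherentState]

theorem traceNormLE_coherentProj (α : ℂ) : TraceNormLE (coherentProj α) 1 := by
  simpa [norm_coherentState] using (hasRankOneSum_coherentProj α).traceNormLE

theorem charFn_coherentProj (α ξ : ℂ) :
    charFn (coherentProj α) ξ = fourierKernel ξ α * Real.exp (-‖ξ‖ ^ 2 / 2) := by
  rw [(hasRankOneSum_coherentProj α).charFn_eq, tsum_fintype]
  simp only [Finset.univ_unique, Finset.sum_singleton]
  rw [coherentState, ← ContinuousLinearMap.adjoint_inner_right, adjoint_displacement,
    displacement_conj, inner_smul_right, inner_vacuum_displacement_vacuum]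

variable {P : ℂ → ℝ}

theorem integrable_smul_coherentProj (hP : Integrable P) :
    Integrable fun α => P α • coherentProj α := by
  refine hP.norm.mono' (hP.1.smul continuous_coherentProj.aestronglyMeasurable)
    (Eventually.of_forall fun α => ?_)
  have h := norm_smul (P α) (coherentProj α)
  rw [norm_coherentProj, mul_one] at h
  exact h.le

theorem traceNormLE_smul_coherentProj (P : ℂ → ℝ) (α : ℂ) :
    TraceNormLE (P α • coherentProj α) |P α| := by
  have h := (traceNormLE_coherentProj α).real_smul (P α)
  rwa [mul_one] at h

theorem isTraceClass_integral_coherentProj (hP : Integrable P) :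
    IsTraceClass (∫ α, P α • coherentProj α) :=
  (TraceNormLE.integral (integrable_smul_coherentProj hP) hP.abs
    (traceNormLE_smul_coherentProj P)).isTraceClass

theorem charFn_integral_coherentProj (hP : Integrable P) (ξ : ℂ) :
    charFn (∫ α, P α • coherentProj α) ξ =
      (∫ α, (P α : ℂ) * fourierKernel ξ α) * Real.exp (-‖ξ‖ ^ 2 / 2) := by
  rw [charFn_integral (integrable_smul_coherentProj hP) hP.abs
    (traceNormLE_smul_coherentProj P), ← integral_mul_const]
  refine integral_congr_ae (Eventually.of_forall fun α => ?_)
  simp only [charFn_real_smul, charFn_coherentProj, mul_assoc]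

end CoherentProjections

/-! ### Uniqueness from characteristic functions and integrability of the Husimi function. -/

section CharacteristicFunctions

variable {ρ S T : Mode →L[ℂ] Mode}

theorem charFn_sub (hT : IsTraceClass T) (hS : IsTraceClass S) (ξ : ℂ) :
    charFn (T - S) ξ = charFn T ξ - charFn S ξ := by
  rw [charFn, ContinuousLinearMap.sub_comp,
    (hT.comp_right _).opTrace_sub (hS.comp_right _)]
  rfl

theorem eq_of_charFn_eq (hT : IsTraceClass T) (hS : IsTraceClass S)
    (h : ∀ ξ, charFn T ξ = charFn S ξ) : T = S := by
  refine sub_eq_zero.1 (eq_zero_of_charFn_eq_zero (hT.sub hS) fun ξ => ?_)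
  rw [charFn_sub hT hS, h, sub_self]

theorem IsDensityOperator.charFn_neg (hρ : IsDensityOperator ρ) (ξ : ℂ) :
    charFn ρ (-ξ) = starRingEnd ℂ (charFn ρ ξ) := by
  obtain ⟨v, h, -⟩ := hρ.exists_hasRankOneSum
  rw [h.charFn_eq, h.charFn_eq, Complex.conj_tsum]
  refine tsum_congr fun k => ?_
  rw [inner_conj_symm, ← adjoint_displacement, ContinuousLinearMap.adjoint_inner_right]

theorem continuous_mul_gaussian (hρ : IsTraceClass ρ) :
    Continuous fun ξ => charFn ρ ξ * Real.exp (-‖ξ‖ ^ 2 / 2) := by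
  have := hρ.continuous_charFn
  fun_prop

theorem IsDensityOperator.norm_mul_gaussian_le (hρ : IsDensityOperator ρ) (ξ : ℂ) :
    ‖charFn ρ ξ * Real.exp (-‖ξ‖ ^ 2 / 2)‖ ≤ Real.exp (-‖ξ‖ ^ 2 / 2) := by
  rw [norm_mul, Complex.norm_real, Real.norm_eq_abs, Real.abs_exp]
  exact mul_le_of_le_one_left (Real.exp_pos _).le (hρ.norm_charFn_le_one ξ)

theorem IsDensityOperator.integrable_mul_gaussian (hρ : IsDensityOperator ρ) :
    Integrable fun ξ => charFn ρ ξ * Real.exp (-‖ξ‖ ^ 2 / 2) :=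
  integrable_gaussian_half.mono' (continuous_mul_gaussian hρ.isTraceClass).aestronglyMeasurable
    (Eventually.of_forall hρ.norm_mul_gaussian_le)

/-- The Husimi function of a state is integrable. -/
theorem IsDensityOperator.integrable_husimi (hρ : IsDensityOperator ρ) :
    Integrable (planeFourier fun ξ => charFn ρ ξ * Real.exp (-‖ξ‖ ^ 2 / 2)) := by
  have hpos := hρ.isPositive
  let F : ℂ → ℝ := fun α => Real.pi * (⟪coherentState α, ρ (coherentState α)⟫_ℂ).re
  have hF : ∀ α, planeFourier (fun ξ => charFn ρ ξ * Real.exp (-‖ξ‖ ^ 2 / 2)) α = F α := by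
    intro α
    have h1 : (((⟪coherentState α, ρ (coherentState α)⟫_ℂ).re : ℝ) : ℂ) =
        ⟪coherentState α, ρ (coherentState α)⟫_ℂ :=
      (Complex.nonneg_iff.1 (hpos.inner_nonneg_right (coherentState α))).elim fun _ h =>
        Complex.ext rfl h
    rw [planeFourier_husimi hρ.isTraceClass, Complex.ofReal_mul, h1]
  have hi : Integrable F := integrable_of_planeFourier_nonneg hρ.integrable_mul_gaussian
    (C := 1) (fun ξ => (hρ.norm_mul_gaussian_le ξ).trans
      (Real.exp_le_one_iff.2 (by have := sq_nonneg ‖ξ‖; linarith)))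
    (fun α => mul_nonneg Real.pi_pos.le (hpos.re_inner_nonneg_right _)) hF
  have hi' : Integrable fun α => (F α : ℂ) := hi.ofReal
  exact hi'.congr (Eventually.of_forall fun α => (hF α).symm)

end CharacteristicFunctions

/-! ### Integrability and smoothness of Fourier transforms. -/

section ProductTransform

variable {g u h : ℂ → ℂ}

/-- The Fourier transform of a product of functions with integrable Fourier transforms is
integrable. -/
theorem integrable_planeFourier_mul (hu : Integrable u) (huc : Continuous u)
    (hFu : Integrable (planeFourier u)) (hh : Integrable h) (hFh : Integrable (planeFourier h)) :
    Integrable (planeFourier fun ξ => h ξ * u ξ) := by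
  have hpi : (Real.pi : ℂ) ^ 2 ≠ 0 := pow_ne_zero 2 (by exact_mod_cast Real.pi_ne_zero)
  have hconv := hFu.integrable_convolution (ContinuousLinearMap.mul ℂ ℂ) hFh
  refine (hconv.const_mul (((Real.pi : ℂ) ^ 2)⁻¹)).congr (Eventually.of_forall fun α => ?_)
  simp only [convolution_def, ContinuousLinearMap.mul_apply']
  rw [inv_mul_eq_iff_eq_mul₀ hpi]
  have hha : Integrable fun ξ => h ξ * fourierKernel α ξ := by
    refine hh.mono (hh.1.mul (by fun_prop : Continuous _).aestronglyMeasurable)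
      (Eventually.of_forall fun ξ => ?_)
    rw [norm_mul, norm_fourierKernel, mul_one]
  -- The convolution theorem by duality: multiplying `h` by the character of `α` translates its
  -- transform, while inversion returns `π² u` from the transform of `u`.
  have h1 := integral_mul_planeFourier hFu.comp_neg hha
  have h2 : ∀ γ, planeFourier (fun ξ => h ξ * fourierKernel α ξ) γ = planeFourier h (α + γ) := by
    intro γ
    simp only [planeFourier, fourierKernel_add_left, mul_assoc]
  have h3 : ∀ ξ, ∫ γ, planeFourier u (-γ) * fourierKernel γ ξ = (Real.pi : ℂ) ^ 2 * u ξ := by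
    intro ξ
    rw [← planeFourier_inversion hu huc hFu ξ, ← integral_neg_eq_self]
    simp only [neg_neg, fourierKernel_neg_left]
  simp only [h2, h3] at h1
  rw [← integral_neg_eq_self]
  simp only [sub_neg_eq_add]
  rw [h1, planeFourier, ← integral_const_mul]
  refine integral_congr_ae (Eventually.of_forall fun ξ => ?_)
  simp only
  ring

theorem pow_mul_exp_le (n : ℕ) {r : ℝ} (hr : 0 ≤ r) :
    r ^ n * Real.exp (-(1 / 4) * r ^ 2) ≤ n.factorial * Real.exp 2 * Real.exp (-(1 / 8) * r ^ 2) := by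
  have h1 : r ^ n ≤ n.factorial * Real.exp r := by
    have h2 := Real.pow_div_factorial_le_exp r hr n
    rwa [div_le_iff₀ (by positivity), mul_comm] at h2
  calc r ^ n * Real.exp (-(1 / 4) * r ^ 2)
      ≤ n.factorial * Real.exp r * Real.exp (-(1 / 4) * r ^ 2) :=
        mul_le_mul_of_nonneg_right h1 (Real.exp_pos _).le
    _ = n.factorial * Real.exp (r + -(1 / 4) * r ^ 2) := by rw [Real.exp_add]; ring
    _ ≤ n.factorial * Real.exp (2 + -(1 / 8) * r ^ 2) := by
        refine mul_le_mul_of_nonneg_left (Real.exp_le_exp.2 ?_) (by positivity)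
        nlinarith [sq_nonneg (r - 4)]
    _ = _ := by rw [Real.exp_add]; ring

theorem integrable_pow_mul_norm (hg : Continuous g) {C : ℝ}
    (hC : ∀ ξ, ‖g ξ‖ ≤ C * Real.exp (-(1 / 4) * ‖ξ‖ ^ 2)) (n : ℕ) :
    Integrable fun ξ => ‖ξ‖ ^ n * ‖g ξ‖ := by
  have hC0 : 0 ≤ C := by
    have := (norm_nonneg _).trans (hC 0)
    simpa using this
  refine ((integrable_gaussian (b := 1 / 8) (by norm_num)).const_mul
    (C * (n.factorial * Real.exp 2))).mono' (by fun_prop : Continuous _).aestronglyMeasurable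
    (Eventually.of_forall fun ξ => ?_)
  rw [Real.norm_eq_abs, abs_of_nonneg (by positivity)]
  calc ‖ξ‖ ^ n * ‖g ξ‖ ≤ ‖ξ‖ ^ n * (C * Real.exp (-(1 / 4) * ‖ξ‖ ^ 2)) := by
        gcongr
        exact hC ξ
    _ = C * (‖ξ‖ ^ n * Real.exp (-(1 / 4) * ‖ξ‖ ^ 2)) := by ring
    _ ≤ C * (n.factorial * Real.exp 2 * Real.exp (-(1 / 8) * ‖ξ‖ ^ 2)) :=
        mul_le_mul_of_nonneg_left (pow_mul_exp_le n (norm_nonneg ξ)) hC0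
    _ = _ := by ring

/-- Finiteness of all absolute moments permits differentiating under the integral to any order. -/
theorem contDiff_planeFourier (hg : ∀ n : ℕ, Integrable fun ξ => ‖ξ‖ ^ n * ‖g ξ‖) :
    ContDiff ℝ ∞ (planeFourier g) := by
  have h1 := Real.contDiff_fourier (f := g) (N := ⊤) fun n _ => hg n
  have h2 : ContDiff ℝ ∞ fun α : ℂ => ((Real.pi⁻¹ : ℝ) : ℂ) * (Complex.I * α) := by fun_prop
  have h3 : planeFourier g = fun α => _ := funext (planeFourier_eq g)
  rw [h3]
  exact h1.comp h2

end ProductTransform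

/-! ### Regular Glauber–Sudarshan functions of filtered states. -/

section RegularPFunction

variable {ρ : Mode →L[ℂ] Mode} {κ : ℂ → ℝ} {Ω : ℂ → ℂ} {p : ℂ → ℝ}

/-- States filtered by the autocorrelation of a window decaying faster than every Gaussian have a
regular Glauber–Sudarshan function. -/
theorem exists_isRegularPFunction (hκ : IsWindow κ) (hΩ : IsPhysicalFilter Ω p)
    (hΩκ : ∀ ξ, Ω ξ = ((∫ ζ, κ ζ * κ (ξ - ζ) : ℝ) : ℂ)) (hρ : IsDensityOperator ρ) :
    ∃ P : ℂ → ℝ, IsRegularPFunction (filterMap p ρ) P := by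
  have hσ := isDensityOperator_filterMap hΩ hρ
  have hpi : (Real.pi : ℂ) ^ 2 ≠ 0 := pow_ne_zero 2 (by exact_mod_cast Real.pi_ne_zero)
  set g : ℂ → ℂ := fun ξ => charFn (filterMap p ρ) ξ * Real.exp (‖ξ‖ ^ 2 / 2) with hg
  have hgc : Continuous g := by
    have := hσ.isTraceClass.continuous_charFn
    fun_prop
  have hΦ := charFn_filterMap hΩ hρ.isTraceClass
  -- The factor `exp(|ξ|²/2)` is absorbed into the window kernel with `a = 1 / 2`, which still has
  -- Gaussian decay. This gives absolute convergence and all moments.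
  obtain ⟨C, hC⟩ : ∃ C, ∀ ξ, ‖g ξ‖ ≤ C * Real.exp (-(1 / 4) * ‖ξ‖ ^ 2) := by
    obtain ⟨M, hM0, hM⟩ := hκ.exists_windowKernel_le (1 / 2) (s := 1) (by simp)
    refine ⟨M * (2 * Real.pi), fun ξ => ?_⟩
    have h1 : g ξ = charFn ρ ξ * shearIntegral (windowKernel κ (1 / 2) 1) ξ := by
      rw [IsWindow.shear_one, ← hΩκ, hg]
      simp only
      rw [hΦ, mul_assoc]
      congr 4
      ring
    rw [h1, norm_mul]
    exact (mul_le_of_le_one_left (norm_nonneg _) (hρ.norm_charFn_le_one ξ)).trans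
      (norm_shearIntegral_le hM0 hM ξ)
  have hgi : Integrable g := by
    rw [← integrable_norm_iff hgc.aestronglyMeasurable]
    simpa using integrable_pow_mul_norm hgc hC 0
  have hGi : Integrable (planeFourier g) := by
    -- Here the kernel takes `a = 1`, more than needed, so that a factor `exp(-|ξ|²/2)` remains to
    -- regularise `Φ_ρ` into the transform of the Husimi function.
    have h1 : g = fun ξ => shearIntegral (windowKernel κ 1 1) ξ *
        (charFn ρ ξ * Real.exp (-‖ξ‖ ^ 2 / 2)) := by
      funext ξ
      have h2 : Real.exp (‖ξ‖ ^ 2 / 2) = Real.exp (1 * ‖ξ‖ ^ 2) * Real.exp (-‖ξ‖ ^ 2 / 2) := by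
        rw [← Real.exp_add]; congr 1; ring
      rw [IsWindow.shear_one, ← hΩκ, hg]
      simp only
      rw [hΦ, h2]
      push_cast
      ring
    rw [h1]
    exact integrable_planeFourier_mul hρ.integrable_mul_gaussian
      (continuous_mul_gaussian hρ.isTraceClass) hρ.integrable_husimi
      (hκ.integrable_shear 1 (by simp)) hκ.integrable_planeFourier_shear_exp
  -- Reality comes from `Φ(-ξ) = Φ(ξ)*` together with the substitution `ξ ↦ -ξ`.
  have hreal : ∀ α, starRingEnd ℂ (planeFourier g α) = planeFourier g α := by
    intro α
    rw [planeFourier, ← integral_conj, ← integral_neg_eq_self]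
    refine integral_congr_ae (Eventually.of_forall fun ξ => ?_)
    simp only [hg, map_mul, hσ.charFn_neg, Complex.conj_conj, Complex.conj_ofReal, norm_neg,
      conj_fourierKernel, fourierKernel_neg_left]
  let P : ℂ → ℝ := fun α => (Real.pi ^ 2)⁻¹ * (planeFourier g α).re
  have hP : ∀ α, (P α : ℂ) = ((Real.pi : ℂ) ^ 2)⁻¹ * planeFourier g α := by
    intro α
    have h1 := Complex.conj_eq_iff_re.1 (hreal α)
    rw [← h1]
    simp [P]
  have hPi : Integrable P := hGi.re.const_mul _
  refine ⟨P, hgi, fun α => ?_, ?_, hPi, integrable_smul_coherentProj hPi, ?_⟩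
  · rw [hP, one_div]
    rfl
  · exact contDiff_const.mul (Complex.reCLM.contDiff.comp
      (contDiff_planeFourier (integrable_pow_mul_norm hgc hC)))
  -- By inversion the integral of coherent projections has characteristic function `g(ξ)
  -- exp(-|ξ|²/2)`, which is that of the filtered state.
  · refine eq_of_charFn_eq hσ.isTraceClass (isTraceClass_integral_coherentProj hPi) fun ξ => ?_
    rw [charFn_integral_coherentProj hPi]
    simp only [hP, mul_assoc]
    rw [integral_const_mul, planeFourier_inversion hgi hgc hGi, inv_mul_cancel_left₀ hpi, hg]
    simp only
    rw [mul_assoc, ← Complex.ofReal_mul, ← Real.exp_add, neg_div, add_neg_cancel, Real.exp_zero,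
      Complex.ofReal_one, mul_one]

end RegularPFunction

/-! ### Final bounds and the main statement. -/

theorem IsDensityOperator.isSelfAdjoint_sub {H : Type*} [NormedAddCommGroup H]
    [InnerProductSpace ℂ H] [CompleteSpace H] {ρ σ : H →L[ℂ] H} (hρ : IsDensityOperator ρ)
    (hσ : IsDensityOperator σ) : IsSelfAdjoint (ρ - σ) :=
  hρ.isPositive.isSelfAdjoint.sub hσ.isPositive.isSelfAdjoint

theorem traceDist_filterMap_le_fidelity {Ω : ℂ → ℂ} {p : ℂ → ℝ} {ρ : Mode →L[ℂ] Mode}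
    (hΩ : IsPhysicalFilter Ω p) (hρ : IsDensityOperator ρ) :
    traceDist ρ (filterMap p ρ) ≤ √(1 - entanglementFidelity p ρ) := by
  rw [entanglementFidelity_eq hρ hΩ.integrable]
  exact traceDist_filterMap_le hΩ hρ

end PhaseSpace

open PhaseSpace in
theorem mainTheorem3 :
    -- physical filters: physicality of the filtered state and error bounds
    (∀ (Ω : ℂ → ℂ) (p : ℂ → ℝ), IsPhysicalFilter Ω p →
      IsChannel (filterMap p) ∧
      ∀ ρ : Mode →L[ℂ] Mode, IsDensityOperator ρ →
        Integrable (fun α => p α •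
          (displacement α ∘L ρ ∘L ContinuousLinearMap.adjoint (displacement α))) ∧
        IsDensityOperator (filterMap p ρ) ∧
        (∀ ξ, charFn (filterMap p ρ) ξ = charFn ρ ξ * Ω ξ) ∧
        IsPurification ρ (purification ρ) ∧
        (∀ (E : Type*) [NormedAddCommGroup E] [InnerProductSpace ℂ E] [CompleteSpace E]
          (μ : HilbertTensor Mode E), IsPurification ρ μ →
          purificationOverlap p μ = entanglementFidelity p ρ) ∧
        entanglementFidelity p ρ = ∫ α, p α * ‖charFn ρ α‖ ^ 2 ∧
        entanglementFidelity p ρ ≤ 1 ∧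
        traceDist ρ (filterMap p ρ) ≤ √(1 - entanglementFidelity p ρ) ∧
        (∀ (K : Type*) [NormedAddCommGroup K] [InnerProductSpace ℂ K] [CompleteSpace K]
          (𝓔 : (Mode →L[ℂ] Mode) → (K →L[ℂ] K)), IsChannel 𝓔 →
          traceDist (𝓔 ρ) (𝓔 (filterMap p ρ)) ≤ traceDist ρ (filterMap p ρ)) ∧
        (∀ (ι : Type*) (M : ι → Mode →L[ℂ] Mode), IsPOVM M →
          Summable (fun n => |bornProb ρ (M n) - bornProb (filterMap p ρ) (M n)|) ∧
          (1 / 2) * ∑' n, |bornProb ρ (M n) - bornProb (filterMap p ρ) (M n)| ≤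
            traceDist ρ (filterMap p ρ))) ∧
    -- the bound tends to zero along every family of physical filters tending to one
    (∀ (Ω : ℝ → ℂ → ℂ) (p : ℝ → ℂ → ℝ), (∀ L, 0 < L → IsPhysicalFilter (Ω L) (p L)) →
      (∀ ξ, Tendsto (fun L => Ω L ξ) atTop (𝓝 1)) →
      ∀ ρ : Mode →L[ℂ] Mode, IsDensityOperator ρ →
        Tendsto (fun L => √(1 - entanglementFidelity (p L) ρ)) atTop (𝓝 0)) ∧
    -- approximation of every state by physical states with a regular P function
    (∀ q : ℝ, 2 < q →
      (∀ L, 0 < L → IsPhysicalFilter (nonclassicalityFilter q L) (nonclassicalityDensity q L)) ∧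
      (∀ ξ, Tendsto (fun L => nonclassicalityFilter q L ξ) atTop (𝓝 1)) ∧
      ∀ ρ : Mode →L[ℂ] Mode, IsDensityOperator ρ →
        (∀ L, 0 < L → ∃ P : ℂ → ℝ,
          IsRegularPFunction (filterMap (nonclassicalityDensity q L) ρ) P) ∧
        ∀ δ : ℝ, 0 < δ → ∃ L₀ : ℝ, 0 < L₀ ∧ ∀ L, L₀ ≤ L →
          √(1 - entanglementFidelity (nonclassicalityDensity q L) ρ) ≤ δ ∧
          traceDist ρ (filterMap (nonclassicalityDensity q L) ρ) ≤ δ ∧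
          (∀ (K : Type*) [NormedAddCommGroup K] [InnerProductSpace ℂ K] [CompleteSpace K]
            (𝓔 : (Mode →L[ℂ] Mode) → (K →L[ℂ] K)), IsChannel 𝓔 →
            traceDist (𝓔 ρ) (𝓔 (filterMap (nonclassicalityDensity q L) ρ)) ≤ δ) ∧
          (∀ (ι : Type*) (M : ι → Mode →L[ℂ] Mode), IsPOVM M →
            (1 / 2) * ∑' n, |bornProb ρ (M n) -
              bornProb (filterMap (nonclassicalityDensity q L) ρ) (M n)| ≤ δ)) := by
  refine ⟨fun Ω p hΩ => ⟨isChannel_filterMap hΩ, fun ρ hρ => ?_⟩,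
    fun Ω p hΩ hlim ρ hρ => tendsto_sqrt_one_sub_fidelity hΩ hlim hρ, fun q hq =>
    ⟨fun L hL => isPhysicalFilter_nonclassicality hq hL, tendsto_nonclassicalityFilter hq,
      fun ρ hρ => ⟨fun L hL => exists_isRegularPFunction (isWindow_omegaFn hq hL)
        (isPhysicalFilter_nonclassicality hq hL) (fun _ => rfl) hρ, fun δ hδ => ?_⟩⟩⟩
  · have hσ := isDensityOperator_filterMap hΩ hρ
    have hsa := hρ.isSelfAdjoint_sub hσ
    have hpur := isPurification_purification hρ
    exact ⟨integrable_conj_displacement hΩ.integrable hρ.isTraceClass, hσ,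
      charFn_filterMap hΩ hρ.isTraceClass, hpur,
      fun E _ _ _ μ hμ => (hμ.purificationOverlap_eq hΩ.integrable).trans
        (hpur.purificationOverlap_eq hΩ.integrable).symm,
      entanglementFidelity_eq hρ hΩ.integrable, entanglementFidelity_le_one hΩ hρ,
      traceDist_filterMap_le_fidelity hΩ hρ,
      fun K _ _ _ 𝓔 h𝓔 => h𝓔.traceDist_le hρ.isTraceClass hσ.isTraceClass hsa,
      fun ι M hM => hM.sum_abs_le hρ.isTraceClass hσ.isTraceClass hsa⟩
  · have hphys := fun L hL => isPhysicalFilter_nonclassicality (q := q) (L := L) hq hL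
    have hlim := tendsto_sqrt_one_sub_fidelity hphys (tendsto_nonclassicalityFilter hq) hρ
    obtain ⟨L₁, hL₁⟩ := eventually_atTop.1 (hlim.eventually_le_const hδ)
    -- The maximum with `1` keeps the threshold positive, since `L₁` may be any real number and the
    -- filters are physical only for `L > 0`. All other bounds follow from the first, so the
    -- threshold does not depend on the channel or the measurement.
    refine ⟨max L₁ 1, by positivity, fun L hL => ?_⟩
    have hL0 : 0 < L := one_pos.trans_le ((le_max_right _ _).trans hL)
    have h1 := hL₁ L ((le_max_left _ _).trans hL)
    have hσ := isDensityOperator_filterMap (hphys L hL0) hρ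
    have hsa := hρ.isSelfAdjoint_sub hσ
    have h2 := (traceDist_filterMap_le_fidelity (hphys L hL0) hρ).trans h1
    exact ⟨h1, h2,
      fun K _ _ _ 𝓔 h𝓔 => (h𝓔.traceDist_le hρ.isTraceClass hσ.isTraceClass hsa).trans h2,
      fun ι M hM => (hM.sum_abs_le hρ.isTraceClass hσ.isTraceClass hsa).2.trans h2⟩
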